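/- Let $\mathbb{R}^3=\mathbb{R}_t\times\mathbb{C}_{x+iy}$ carry the contact form $dt-y\,dx$, let $\Lambda\subset\mathbb{R}^3$ be a (compact, smooth, embedded) Legendrian link, and let $\lambda=\pi_{\mathbb{C}}(\Lambda)$ be its immersed projection to $\mathbb{C}$. Assume that $\Lambda$ is left-right-simple, that is: - (good position) over each self-intersection $x_0+iy_0$ of $\lambda$ there are exactly two points of $\Lambda$; near the self-intersection the strand of $\lambda$ with the greater $t$-value is parameterized by $(x_0+q,\,y_0-q)$ and the other strand by $(x_0+q,\,y_0+q)$; - $x|_\Lambda$ is Morse, all local minima of $x|_\Lambda$ have one and the same $x$-value $x_L$, and all local maxima of $x|_\Lambda$ have one and the same $x$-value $x_R$. Let $\dot{\mathbb{D}}$ be the closed unit disk with $m\ge 1$ boundary points (punctures) removed, and let $u:\dot{\mathbb{D}}\to\mathbb{C}$ be a non-constant map, smooth up to the boundary and holomorphic in the interior, with $u(\partial\dot{\mathbb{D}})\subset\lambda$, with finite energy $\int u^*(dx\wedge dy)<\infty$, and such that $u(z)$ converges to a self-intersection of $\lambda$ as $z$ tends to any of the punctures. Let $\eta_1,\dots,\eta_m$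 be the components of $\partial\dot{\mathbb{D}}$ with the boundary orientation. The path $u|_{\eta_k}$ lifts to a continuous path in $\Lambda$; let $\theta(u|_{\eta_k})\in\mathbb{R}$ be the total change, along this lift, of a continuous choice of the angle of the tangent line of $\lambda$. The index of $u$ is $$\operatorname{ind}(u)=\operatorname{Maslov}(u|_{\partial\mathbb{D}})-2\chi(\mathbb{D})+m,\qquad \operatorname{Maslov}(u|_{\partial\mathbb{D}})=\frac1\pi\sum_{k=1}^m\theta(u|_{\eta_k})-\frac m2,\qquad \chi(\mathbb{D})=1.$$ If $\operatorname{ind}(u)=0$, then $u$ is an embedding of $\dot{\mathbb{D}}$ into $\mathbb{C}$: it is an immersion (including at boundary points) and a homeomorphism onto its image. -/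

import Mathlib

open Set Filter Metric
open scoped ContDiff Topology

noncomputable section

/-- The value at `v` of the standard contact form `dt - y dx` at the point `p` of
`ℝ³ = ℝ_t × ℂ`, where `x + i y` is the coordinate on `ℂ`. -/
def stdContactForm (p v : ℝ × ℂ) : ℝ := v.1 - p.2.im * v.2.re

/-- A Legendrian link in `(ℝ³, ker (dt - y dx))`: finitely many closed curves, given by smooth
regular `1`-periodic parameterizations, which are embedded and pairwise disjoint and are
everywhere tangent to the contact planes. -/
structure LegendrianLink where
  /-- the number of components -/
  numComp : ℕ
  /-- the parameterizations of the components -/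
  param : Fin numComp → ℝ → ℝ × ℂ
  smooth : ∀ i, ContDiff ℝ ∞ (param i)
  periodic : ∀ i, Function.Periodic (param i) 1
  regular : ∀ i s, deriv (param i) s ≠ 0
  embedded : ∀ i j s r, param i s = param j r → i = j ∧ ∃ k : ℤ, r = s + k
  legendrian : ∀ i s, stdContactForm (param i s) (deriv (param i) s) = 0

namespace LegendrianLink

/-- The underlying subset `Λ` of `ℝ × ℂ`. -/
def carrier (L : LegendrianLink) : Set (ℝ × ℂ) := {P | ∃ i s, L.param i s = P}

/-- The Lagrangian projection of `Λ`, as a subset of `ℂ`. -/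
def proj (L : LegendrianLink) : Set ℂ := Prod.snd '' L.carrier

/-- The self-intersections of the Lagrangian projection. -/
def doublePoints (L : LegendrianLink) : Set ℂ :=
  {q | ∃ P ∈ L.carrier, ∃ Q ∈ L.carrier, P ≠ Q ∧ P.2 = q ∧ Q.2 = q}

/-- The `x`-coordinate along the `i`-th component. -/
def xCoord (L : LegendrianLink) (i : Fin L.numComp) (s : ℝ) : ℝ := (L.param i s).2.re

/-- Good position: over each self-intersection `q = x₀ + i y₀` of the projection there are exactly
two points of `Λ`. Near the one with the greater `t`-value the projected strand runs along the line
`{(x₀ + r, y₀ - r)}`, and near the other one along the line `{(x₀ + r, y₀ + r)}`. (The projection of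
a Legendrian curve is an immersed curve, so a strand that stays on a line is parameterized
by a segment of it.) -/
def GoodPosition (L : LegendrianLink) : Prop :=
  ∀ q ∈ L.doublePoints, ∃ i s j r,
    (L.param i s).2 = q ∧ (L.param j r).2 = q ∧ (L.param j r).1 < (L.param i s).1 ∧
    (∀ P ∈ L.carrier, P.2 = q → P = L.param i s ∨ P = L.param j r) ∧
    (∀ᶠ s' in 𝓝 s, (L.param i s').2.im - q.im = -((L.param i s').2.re - q.re)) ∧
    (∀ᶠ r' in 𝓝 r, (L.param j r').2.im - q.im = (L.param j r').2.re - q.re)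

/-- The function `x` restricted to `Λ` is Morse. -/
def XMorse (L : LegendrianLink) : Prop :=
  ∀ i s, deriv (L.xCoord i) s = 0 → deriv (deriv (L.xCoord i)) s ≠ 0

/-- All local minima of `x` on `Λ` have the same `x`-value. -/
def LeftSimple (L : LegendrianLink) : Prop :=
  ∃ xL : ℝ, ∀ i s, IsLocalMin (L.xCoord i) s → L.xCoord i s = xL

/-- All local maxima of `x` on `Λ` have the same `x`-value. -/
def RightSimple (L : LegendrianLink) : Prop :=
  ∃ xR : ℝ, ∀ i s, IsLocalMax (L.xCoord i) s → L.xCoord i s = xR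

/-- Left-right-simple Legendrian links. -/
structure LeftRightSimple (L : LegendrianLink) : Prop where
  goodPosition : L.GoodPosition
  morse : L.XMorse
  left : L.LeftSimple
  right : L.RightSimple

/-- The angle `φ` is an angle of the (unoriented) tangent line of the projected link at the
point `P` of `Λ`: the vector `exp (i φ)` is parallel to the projection of a tangent vector. -/
def IsTangentAngle (L : LegendrianLink) (P : ℝ × ℂ) (φ : ℝ) : Prop :=
  ∀ i s, L.param i s = P →
    ∃ c : ℝ, (deriv (L.param i) s).2 = c * Complex.exp (φ * Complex.I)

end LegendrianLink

/-- Boundary punctures on the closed unit disk: `m` points `exp (i a₀), …, exp (i aₘ₋₁)` of the unit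
circle, in counterclockwise order. The last entry is `aₘ = a₀ + 2 π`, so that the components of the
punctured circle are the images of the intervals `(aₖ, aₖ₊₁)`. In particular `m ≥ 1`. -/
structure DiskPunctures where
  /-- the number of punctures -/
  m : ℕ
  /-- the angles of the punctures -/
  angle : Fin (m + 1) → ℝ
  strictMono : StrictMono angle
  closes : angle (Fin.last m) = angle 0 + 2 * Real.pi

namespace DiskPunctures

/-- The point of the unit circle with a given angle. -/
def circlePoint (a : ℝ) : ℂ := Complex.exp (a * Complex.I)

/-- The `k`-th puncture. -/
def point (D : DiskPunctures) (k : Fin D.m) : ℂ := circlePoint (D.angle k.castSucc)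

/-- The closed unit disk with the punctures removed. -/
def domain (D : DiskPunctures) : Set ℂ := closedBall 0 1 \ range D.point

end DiskPunctures

/-- `u` is a holomorphic map from the closed unit disk minus boundary punctures to `ℂ`, with boundary
on the Lagrangian projection of the link: it is smooth up to the boundary, holomorphic in the
interior, of finite energy `∫ u^*(dx ∧ dy) = ∫ |u'|²`, and asymptotic at every puncture to a
self-intersection of the projection. -/
structure IsHolomorphicDisk (L : LegendrianLink) (D : DiskPunctures) (u : ℂ → ℂ) : Prop where
  holomorphic : DifferentiableOn ℂ u (ball 0 1)
  smooth : ContDiffOn ℝ ∞ u D.domain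
  boundary : ∀ z ∈ D.domain, ‖z‖ = 1 → u z ∈ L.proj
  energy : MeasureTheory.IntegrableOn (fun z => ‖deriv u z‖ ^ 2) (ball 0 1)
  asymptotic : ∀ k, ∃ q ∈ L.doublePoints, Tendsto u (𝓝[D.domain] (D.point k)) (𝓝 q)

/-- `θ` is the rotation angle of the path `u (exp (i s))`, `a < s < b`, in the projected link. The
path is lifted to a continuous path `(τ, u)` in `Λ`, the angle of the tangent line of the projection
along this lift is a continuous function `φ`, and `θ` is the total variation `φ b - φ a`. -/
def IsRotationAngle (L : LegendrianLink) (u : ℂ → ℂ) (a b θ : ℝ) : Prop :=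
  ∃ τ φ : ℝ → ℝ,
    ContinuousOn τ (Ioo a b) ∧
    (∀ s ∈ Ioo a b, (τ s, u (DiskPunctures.circlePoint s)) ∈ L.carrier) ∧
    ContinuousOn φ (Icc a b) ∧
    (∀ s ∈ Ioo a b, L.IsTangentAngle (τ s, u (DiskPunctures.circlePoint s)) (φ s)) ∧
    θ = φ b - φ a

/-- `μ` is the Maslov index of the boundary of the disk: the sum of the rotation angles of the
boundary arcs divided by `π`, minus one half for each puncture. -/
def HasMaslovIndex (L : LegendrianLink) (D : DiskPunctures) (u : ℂ → ℂ) (μ : ℝ) : Prop :=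
  ∃ θ : Fin D.m → ℝ,
    (∀ k, IsRotationAngle L u (D.angle k.castSucc) (D.angle k.succ) (θ k)) ∧
    μ = (1 / Real.pi) * ∑ k, θ k - (1 / 2) * D.m

/-- `d` is the index `μ - 2 χ + m` of the disk, where `χ = 1` is the Euler characteristic. -/
def HasIndex (L : LegendrianLink) (D : DiskPunctures) (u : ℂ → ℂ) (d : ℝ) : Prop :=
  ∃ μ : ℝ, HasMaslovIndex L D u μ ∧ d = μ - 2 * 1 + D.m

/-- `f` is a smooth embedding of the set `S` (a domain, possibly with part of its smooth boundary)
into `ℂ`: an immersion that is a homeomorphism onto its image. -/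
structure IsSmoothEmbeddingOn (f : ℂ → ℂ) (S : Set ℂ) : Prop where
  smooth : ContDiffOn ℝ ∞ f S
  immersion : ∀ z ∈ S, Function.Injective (fderivWithin ℝ f S z)
  isEmbedding : Topology.IsEmbedding (fun z : S => f z)

end

/-! Extend `u` continuously over the punctures to `U` on the closed disk. The proof is about the
local extrema of `Re U` on the closed disk, boundary included.

Counting extrema. The maximum principle excludes interior extrema. At a boundary point that is not a
puncture, an extremum forces a vertical tangent of the link. Conversely, vertical tangents of a
left-right-simple link occur only where `x` is globally extreme on the link, so a vertical boundary
point is an extremum of `Re U`. The Hopf lemma fixes the direction in which the boundary runs there,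
and the Morse condition then makes the tangent angle pass the vertical upwards. Hence an arc with
initial slope `d`, final slope `e` and `v` vertical points rotates by at least `π v + (e - d) π / 4`
(`card_vertical_le`). A puncture can be an extremum only if the incoming slope is `1` and the
outgoing slope is `-1` (`slopes_of_right_corner`), so it contributes at most `(e - d + 2) / 4`
extrema. Index zero says that the total rotation is `π (2 - m / 2)`, and summing leaves at most two
extrema: one minimum `p` and one maximum `q` (`ncard_extrema_le`, `exists_unique_extrema`).

Injectivity. With a single maximum and a single minimum, superlevel and sublevel sets are path
connected, and since paths with interlaced endpoints on the circle must cross, `Re U` increases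
along both arcs from `p` to `q` (`le_of_unique_local_extrema`). In the strip chart with ends `p` and
`q`, a Phragmén–Lindelöf argument carries this monotonicity to all horizontal lines, so the
derivative has positive real part. On a convex domain this gives injectivity (Noshiro–Warschawski);
two points of one boundary line are separated by strict monotonicity there.

Immersion at the boundary. At `p` and `q` the derivative is nonzero by the Hopf lemma. At a
non-vertical boundary point a zero of `U'` would be a zero of the product of `U'` with the
translation field of the strip. The boundary values of this product lie in a cone of the right half
plane, so its tangential derivative would vanish, against the Hopf lemma. Compactness turns
injectivity into an embedding. -/

noncomputable section

/-! ### Crossing paths in the disk and connectedness of superlevel sets. -/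

/-- A nowhere vanishing continuous function on the plane has a continuous logarithm. -/
theorem exists_continuous_log (f : ℝ × ℝ → ℂ) (hf : Continuous f) (h0 : ∀ x, f x ≠ 0) :
    ∃ F : ℝ × ℝ → ℂ, Continuous F ∧ ∀ x, Complex.exp (F x) = f x := by
  obtain ⟨F, ⟨-, hF⟩, -⟩ := Complex.isCoveringMapOn_exp.existsUnique_continuousMap_lifts
    (⟨f, hf⟩ : C(ℝ × ℝ, ℂ)) (a₀ := 0) (e₀ := Complex.log (f 0))
    (Complex.exp_log (h0 0)) (by simpa using h0)
  exact ⟨F, F.continuous, fun x => congrFun hF x⟩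

/-- Along a path on which `c * exp ∘ F` stays in the right half plane, the increment of `F` is that
of the principal logarithm. -/
theorem log_increment_eq (F : ℝ → ℂ) (hF : Continuous F) (c : ℂ)
    (h : ∀ t, 0 < (c * Complex.exp (F t)).re) (a b : ℝ) :
    F b - F a = Complex.log (c * Complex.exp (F b)) - Complex.log (c * Complex.exp (F a)) := by
  have hc : c ≠ 0 := by
    rintro rfl
    simpa using h 0
  have hslit : ∀ t, c * Complex.exp (F t) ∈ Complex.slitPlane := fun t => Or.inl (h t)
  set G : ℝ → ℂ := fun t => Complex.log (c * Complex.exp (F t)) - F t with hG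
  have hGc : Continuous G := by
    refine Continuous.sub ?_ hF
    exact Continuous.clog (by fun_prop) hslit
  have hexp : ∀ t, Complex.exp (G t) = c := fun t => by
    rw [hG, Complex.exp_sub, Complex.exp_log (Complex.slitPlane_ne_zero (hslit t))]
    field_simp [Complex.exp_ne_zero]
  -- `G` takes values in the fibre of `exp` over `c`. The fibre is discrete because `exp` is a
  -- covering, so `G` is constant on the connected line.
  obtain ⟨E, hE⟩ : ∃ E : ℝ → Complex.exp ⁻¹' {c}, Continuous E ∧ ∀ t, (E t : ℂ) = G t :=
    ⟨fun t => ⟨G t, hexp t⟩, by fun_prop, fun t => rfl⟩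
  have hdisc : DiscreteTopology (Complex.exp ⁻¹' {c}) :=
    (Complex.isCoveringMapOn_exp c (by simpa using hc)).1
  have := PreconnectedSpace.constant (inferInstance : PreconnectedSpace ℝ) hE.1 (x := a) (y := b)
  have h2 : G a = G b := by rw [← hE.2, ← hE.2, this]
  simp only [hG] at h2
  linear_combination h2

/-- After rotating `w` to `1`: the closed disk meets the line `Re = 1` only at `1`. Differences from
a fixed circle point thus stay, up to a constant factor, in the domain of the principal logarithm.
-/
theorem re_one_sub_div_pos {z w : ℂ} (hz : ‖z‖ ≤ 1) (hw : ‖w‖ = 1) (hne : z ≠ w) :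
    0 < (1 - z / w).re := by
  have hw0 : w ≠ 0 := by
    rintro rfl
    simp at hw
  have hn : ‖z / w‖ ≤ 1 := by rw [norm_div, hw, div_one]; exact hz
  have hne1 : z / w ≠ 1 := by
    intro h
    exact hne ((div_eq_one_iff_eq hw0).1 h)
  set y := z / w
  have h1 : y.re ≤ 1 := (Complex.re_le_norm y).trans hn
  rw [Complex.sub_re, Complex.one_re]
  rcases h1.lt_or_eq with h | h
  · linarith
  · exfalso
    have h2 : ‖y‖ ^ 2 ≤ 1 := by nlinarith [norm_nonneg y]
    rw [← Complex.normSq_eq_norm_sq, Complex.normSq_apply] at h2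
    have : y.im = 0 := by nlinarith
    exact hne1 (Complex.ext h this)

/-- Conjugation is inversion on the circle. Consequently `1 - z / w` and `1 - w / z` have opposite
arguments, which relates the corner terms of adjacent sides of the parameter square below. -/
theorem one_sub_div_eq_conj {z w : ℂ} (hz : ‖z‖ = 1) (hw : ‖w‖ = 1) :
    1 - z / w = (starRingEnd ℂ) (1 - w / z) := by
  have h : ∀ a : ℂ, ‖a‖ = 1 → (starRingEnd ℂ) a = a⁻¹ := fun a ha => by
    rw [Complex.inv_def, Complex.normSq_eq_norm_sq, ha]; simp
  simp [h z hz, h w hw, div_eq_mul_inv, mul_comm]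

/-- If the cross ratio of four points `A, B, C, D` of the unit circle is not positive, then a path
in the closed unit disk from `A` to `B` meets every path in the disk from `C` to `D`. -/
theorem cross_ratio_pos_of_disjoint_paths {A B C D : ℂ} (γ : Path A B) (δ : Path C D)
    (hA : ‖A‖ = 1) (hB : ‖B‖ = 1) (hC : ‖C‖ = 1) (hD : ‖D‖ = 1)
    (hγ : ∀ s, ‖γ s‖ ≤ 1) (hδ : ∀ s, ‖δ s‖ ≤ 1) (hne : ∀ s t, γ s ≠ δ t) :
    ∃ r : ℝ, 0 < r ∧ (C - B) * (D - A) = r * ((C - A) * (D - B)) := by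
  have hA0 : A ≠ 0 := by rintro rfl; simp at hA
  have hB0 : B ≠ 0 := by rintro rfl; simp at hB
  have hC0 : C ≠ 0 := by rintro rfl; simp at hC
  have hD0 : D ≠ 0 := by rintro rfl; simp at hD
  have hγ' : ∀ s, ‖γ.extend s‖ ≤ 1 := fun s => by
    obtain ⟨t, ht⟩ : γ.extend s ∈ range γ := by rw [← γ.extend_range]; exact mem_range_self s
    rw [← ht]; exact hγ t
  have hδ' : ∀ s, ‖δ.extend s‖ ≤ 1 := fun s => by
    obtain ⟨t, ht⟩ : δ.extend s ∈ range δ := by rw [← δ.extend_range]; exact mem_range_self s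
    rw [← ht]; exact hδ t
  have hne' : ∀ s t, γ.extend s ≠ δ.extend t := fun s t => by
    obtain ⟨s', hs⟩ : γ.extend s ∈ range γ := by rw [← γ.extend_range]; exact mem_range_self s
    obtain ⟨t', ht⟩ : δ.extend t ∈ range δ := by rw [← δ.extend_range]; exact mem_range_self t
    rw [← hs, ← ht]; exact hne _ _
  have hCA : A ≠ C := by simpa using hne' 0 0
  have hDA : A ≠ D := by simpa using hne' 0 1
  have hCB : B ≠ C := by simpa using hne' 1 0
  have hDB : B ≠ D := by simpa using hne' 1 1
  -- `F` is a logarithm of `γ s - δ t` on the whole parameter plane, so its increments around the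
  -- unit square cancel. On each side of the square one of the two points is fixed on the circle, so
  -- the increment there is one of principal logarithms.
  obtain ⟨F, hF, hexp⟩ := exists_continuous_log (fun x => γ.extend x.1 - δ.extend x.2)
    (by fun_prop) (fun x => sub_ne_zero.2 (hne' _ _))
  have e1 := log_increment_eq (fun s => F (s, 0)) (by fun_prop) (-1 / C) (fun s => by
    have := re_one_sub_div_pos (hγ' s) hC (by simpa using hne' s 0)
    convert this using 2
    rw [hexp]; simp only [δ.extend_zero]; field_simp; ring) 0 1
  have e2 := log_increment_eq (fun s => F (s, 1)) (by fun_prop) (-1 / D) (fun s => by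
    have := re_one_sub_div_pos (hγ' s) hD (by simpa using hne' s 1)
    convert this using 2
    rw [hexp]; simp only [δ.extend_one]; field_simp; ring) 0 1
  have e3 := log_increment_eq (fun s => F (0, s)) (by fun_prop) (1 / A) (fun s => by
    have := re_one_sub_div_pos (hδ' s) hA (by simpa using (hne' 0 s).symm)
    convert this using 2
    rw [hexp]; simp only [γ.extend_zero]; field_simp) 0 1
  have e4 := log_increment_eq (fun s => F (1, s)) (by fun_prop) (1 / B) (fun s => by
    have := re_one_sub_div_pos (hδ' s) hB (by simpa using (hne' 1 s).symm)
    convert this using 2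
    rw [hexp]; simp only [γ.extend_one]; field_simp) 0 1
  simp only [hexp, γ.extend_zero, γ.extend_one, δ.extend_zero, δ.extend_one] at e1 e2 e3 e4
  have key : ∀ z w : ℂ, w ≠ 0 → -1 / w * (z - w) = 1 - z / w := fun z w hw => by field_simp; ring
  have key' : ∀ z w : ℂ, w ≠ 0 → 1 / w * (w - z) = 1 - z / w := fun z w hw => by field_simp
  rw [key _ _ hC0, key _ _ hC0] at e1
  rw [key _ _ hD0, key _ _ hD0] at e2
  rw [key' _ _ hA0, key' _ _ hA0] at e3
  rw [key' _ _ hB0, key' _ _ hB0] at e4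
  have hconj : ∀ z w : ℂ, ‖z‖ = 1 → ‖w‖ = 1 → z ≠ w →
      (Complex.log (1 - z / w)).im = -(Complex.log (1 - w / z)).im := fun z w hz hw hzw => by
    rw [one_sub_div_eq_conj hz hw, Complex.log_conj, Complex.conj_im]
    intro h
    have := re_one_sub_div_pos hw.le hz hzw.symm
    have h2 := Complex.abs_arg_lt_pi_div_two_iff.2 (Or.inl this)
    rw [h, abs_of_pos Real.pi_pos] at h2
    linarith [Real.pi_pos]
  have h3 := hconj D A hD hA hDA.symm
  have h3' := hconj C A hC hA hCA.symm
  have h4 := hconj D B hD hB hDB.symm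
  have h4' := hconj C B hC hB hCB.symm
  have i1 := congrArg Complex.im e1
  have i2 := congrArg Complex.im e2
  have i3 := congrArg Complex.im e3
  have i4 := congrArg Complex.im e4
  simp only [Complex.sub_im] at i1 i2 i3 i4
  -- By `hconj` each corner argument occurs on two sides with matching sign, so the vanishing total
  -- is twice the argument of the cross ratio.
  have him : (Complex.log (1 - B / C) + Complex.log (1 - A / D) -
      (Complex.log (1 - A / C) + Complex.log (1 - B / D))).im = 0 := by
    simp only [Complex.sub_im, Complex.add_im]
    linarith
  set X := Complex.log (1 - B / C) + Complex.log (1 - A / D) -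
      (Complex.log (1 - A / C) + Complex.log (1 - B / D)) with hX
  have hXr : X = (X.re : ℂ) := Complex.ext rfl (by simpa using him)
  have hnz : ∀ z w : ℂ, ‖z‖ = 1 → ‖w‖ = 1 → z ≠ w → (1 - z / w) ≠ 0 := fun z w hz hw hzw h => by
    have := re_one_sub_div_pos hz.le hw hzw
    rw [h] at this
    simp at this
  refine ⟨Real.exp X.re, Real.exp_pos _, ?_⟩
  rw [Complex.ofReal_exp, ← hXr, hX, Complex.exp_sub, Complex.exp_add, Complex.exp_add,
    Complex.exp_log (hnz _ _ hB hC hCB), Complex.exp_log (hnz _ _ hA hD hDA),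
    Complex.exp_log (hnz _ _ hA hC hCA), Complex.exp_log (hnz _ _ hB hD hDB)]
  have n1 : C - A ≠ 0 := sub_ne_zero.2 hCA.symm
  have n2 : D - B ≠ 0 := sub_ne_zero.2 hDB.symm
  have r : ∀ z w : ℂ, w ≠ 0 → 1 - z / w = (w - z) / w := fun z w hw => by field_simp
  rw [r _ _ hC0, r _ _ hD0, r _ _ hC0, r _ _ hD0]
  field_simp

/-- In a compact convex set, the superlevel sets of a continuous function whose only local maximum
is `p` are path connected: each of their points is joined to `p`. -/
theorem joinedIn_superlevel {S : Set ℂ} (hS : IsCompact S) (hconv : Convex ℝ S) {h : ℂ → ℝ}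
    (hh : ContinuousOn h S) {p : ℂ}
    (hp : ∀ z ∈ S, (∀ᶠ w in 𝓝[S] z, h w ≤ h z) → z = p) {z : ℂ} (hz : z ∈ S) {c : ℝ}
    (hc : c < h z) : JoinedIn (S ∩ {w | c < h w}) z p := by
  have hloc : ∀ w₀ ∈ S, c < h w₀ → ∀ᶠ w in 𝓝[S] w₀, JoinedIn (S ∩ {w | c < h w}) w₀ w := by
    intro w₀ hw₀ hcw
    have h1 : ∀ᶠ w in 𝓝[S] w₀, c < h w := (hh w₀ hw₀).eventually (lt_mem_nhds hcw)
    obtain ⟨ε, hε, hsub⟩ := mem_nhdsWithin_iff.1 h1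
    have hcv : Convex ℝ (ball w₀ ε ∩ S) := (convex_ball w₀ ε).inter hconv
    filter_upwards [self_mem_nhdsWithin, mem_nhdsWithin_of_mem_nhds (ball_mem_nhds w₀ hε)]
      with w hwS hwb
    have hw₀' : w₀ ∈ ball w₀ ε ∩ S := ⟨mem_ball_self hε, hw₀⟩
    have hw' : w ∈ ball w₀ ε ∩ S := ⟨hwb, hwS⟩
    have hpc : IsPathConnected (ball w₀ ε ∩ S) := hcv.isPathConnected ⟨w₀, hw₀'⟩
    exact (hpc.joinedIn _ hw₀' _ hw').mono fun x hx => ⟨hx.2, hsub hx⟩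
  by_contra hj
  -- The non-strict bound `h z ≤ h w`, at a level above `c`, makes `K` closed. A maximum of `h` on
  -- `K` is a local maximum on `S`: nearby points either are in `K` or lie below the level `h z`. So
  -- it is `p`, which is trivially joined to itself.
  set K : Set ℂ := {w | w ∈ S ∧ h z ≤ h w ∧ ¬ JoinedIn (S ∩ {w | c < h w}) w p} with hK
  have hcl : IsClosed (S ∩ h ⁻¹' Ici (h z)) :=
    hh.preimage_isClosed_of_isClosed hS.isClosed isClosed_Ici
  have hKcl : IsClosed K := by
    refine isClosed_of_closure_subset fun x hx => ?_
    have hKsub : K ⊆ S ∩ h ⁻¹' Ici (h z) := fun w hw => ⟨hw.1, hw.2.1⟩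
    have hx1 : x ∈ S ∩ h ⁻¹' Ici (h z) := closure_minimal hKsub hcl hx
    refine ⟨hx1.1, hx1.2, fun hjx => ?_⟩
    have h2 := hloc x hx1.1 (hc.trans_le hx1.2)
    rw [eventually_nhdsWithin_iff] at h2
    obtain ⟨w, hw, hwK⟩ := ((mem_closure_iff_frequently.1 hx).and_eventually h2).exists
    exact hw.2.2 ((hwK hw.1).symm.trans hjx)
  have hKc : IsCompact K := hS.of_isClosed_subset hKcl fun w hw => hw.1
  obtain ⟨x, hxK, hmax⟩ := hKc.exists_isMaxOn ⟨z, hz, le_rfl, hj⟩ (hh.mono fun w hw => hw.1)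
  have hxp : x = p := by
    refine hp x hxK.1 ?_
    filter_upwards [hloc x hxK.1 (hc.trans_le hxK.2.1), self_mem_nhdsWithin] with w hw hwS
    rcases le_total (h z) (h w) with hle | hle
    · exact hmax ⟨hwS, hle, fun hjw => hxK.2.2 (hw.trans hjw)⟩
    · exact hle.trans hxK.2.1
  apply hxK.2.2
  rw [hxp]
  exact JoinedIn.refl ⟨hxp ▸ hxK.1, hxp ▸ hc.trans_le hxK.2.1⟩

/-! ### The half plane chart of the disk. -/

/-- The coefficient in the Möbius transformation `diskMap`. -/
def diskCoeff (p q : ℂ) : ℂ := Complex.I * (p * (starRingEnd ℂ) q - 1)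

/-- A Möbius transformation from the upper half plane to the unit disk, which maps `0` and `∞`
to the points `p` and `q` of the unit circle. -/
def diskMap (p q w : ℂ) : ℂ := (p + q * (diskCoeff p q * w)) / (1 + diskCoeff p q * w)

section diskMap

variable {p q : ℂ}

theorem conj_eq_inv_of_norm_eq_one {a : ℂ} (ha : ‖a‖ = 1) : (starRingEnd ℂ) a = a⁻¹ := by
  rw [Complex.inv_def, Complex.normSq_eq_norm_sq, ha]; simp

theorem mul_conj_of_norm_eq_one {a : ℂ} (ha : ‖a‖ = 1) : a * (starRingEnd ℂ) a = 1 := by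
  rw [Complex.mul_conj, Complex.normSq_eq_norm_sq, ha]; simp

theorem diskCoeff_ne_zero (hq : ‖q‖ = 1) (hpq : p ≠ q) : diskCoeff p q ≠ 0 := by
  intro h
  rcases mul_eq_zero.1 h with h | h
  · exact Complex.I_ne_zero h
  · apply hpq
    linear_combination q * h - p * mul_conj_of_norm_eq_one hq

/-- This identity explains the choice of `diskCoeff`: for `p ≠ q` the sign of the difference is that
of `w.im`, so the upper half plane corresponds to the disk and the real axis to the circle. -/
theorem normSq_diskMap_den_sub (hp : ‖p‖ = 1) (hq : ‖q‖ = 1) (w : ℂ) :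
    Complex.normSq (1 + diskCoeff p q * w) - Complex.normSq (p + q * (diskCoeff p q * w)) =
      2 * w.im * Complex.normSq (diskCoeff p q) := by
  have hp' : p.re ^ 2 + p.im ^ 2 = 1 := by
    have := Complex.normSq_eq_norm_sq p
    rw [hp, Complex.normSq_apply] at this
    linarith
  have hq' : q.re ^ 2 + q.im ^ 2 = 1 := by
    have := Complex.normSq_eq_norm_sq q
    rw [hq, Complex.normSq_apply] at this
    linarith
  simp only [diskCoeff, Complex.normSq_apply, Complex.add_re, Complex.add_im, Complex.mul_re,
    Complex.mul_im, Complex.sub_re, Complex.sub_im, Complex.I_re, Complex.I_im, Complex.conj_re,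
    Complex.conj_im, Complex.one_re, Complex.one_im]
  generalize p.re = a at *
  generalize p.im = b at *
  generalize q.re = c at *
  generalize q.im = d at *
  obtain ⟨x, y⟩ := w
  linear_combination -hp' - ((a * c + b * d - 1) ^ 2 + (b * c - a * d) ^ 2) * (x ^ 2 + y ^ 2) * hq'

/-- If the denominator vanished, the identity above would force the numerator to vanish as well, and
then `p = q`. -/
theorem diskMap_den_ne_zero (hp : ‖p‖ = 1) (hq : ‖q‖ = 1) (hpq : p ≠ q) {w : ℂ} (hw : 0 ≤ w.im) :
    1 + diskCoeff p q * w ≠ 0 := by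
  intro h
  have h1 := normSq_diskMap_den_sub hp hq w
  have h2 : 0 ≤ w.im * Complex.normSq (diskCoeff p q) := mul_nonneg hw (Complex.normSq_nonneg _)
  rw [h, map_zero] at h1
  have h3 := Complex.normSq_nonneg (p + q * (diskCoeff p q * w))
  have h4 : p + q * (diskCoeff p q * w) = 0 := Complex.normSq_eq_zero.1 (by linarith)
  exact hpq (by linear_combination h4 - q * h)

theorem norm_diskMap_le (hp : ‖p‖ = 1) (hq : ‖q‖ = 1) {w : ℂ} (hw : 0 ≤ w.im) :
    ‖diskMap p q w‖ ≤ 1 := by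
  rw [diskMap, norm_div]
  refine div_le_one_of_le₀ ?_ (norm_nonneg _)
  have h1 := normSq_diskMap_den_sub hp hq w
  have h2 : 0 ≤ w.im * Complex.normSq (diskCoeff p q) := mul_nonneg hw (Complex.normSq_nonneg _)
  rw [Complex.normSq_eq_norm_sq, Complex.normSq_eq_norm_sq] at h1
  exact le_of_sq_le_sq (by linarith) (norm_nonneg _)

theorem norm_diskMap_lt (hp : ‖p‖ = 1) (hq : ‖q‖ = 1) (hpq : p ≠ q) {w : ℂ} (hw : 0 < w.im) :
    ‖diskMap p q w‖ < 1 := by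
  rw [diskMap, norm_div, div_lt_one (norm_pos_iff.2 (diskMap_den_ne_zero hp hq hpq hw.le))]
  have h1 := normSq_diskMap_den_sub hp hq w
  have h2 : 0 < w.im * Complex.normSq (diskCoeff p q) :=
    mul_pos hw (Complex.normSq_pos.2 (diskCoeff_ne_zero hq hpq))
  rw [Complex.normSq_eq_norm_sq, Complex.normSq_eq_norm_sq] at h1
  exact lt_of_pow_lt_pow_left₀ 2 (norm_nonneg _) (by linarith)

theorem norm_diskMap_eq (hp : ‖p‖ = 1) (hq : ‖q‖ = 1) (hpq : p ≠ q) {w : ℂ} (hw : w.im = 0) :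
    ‖diskMap p q w‖ = 1 := by
  rw [diskMap, norm_div, div_eq_one_iff_eq (norm_ne_zero_iff.2 (diskMap_den_ne_zero hp hq hpq hw.ge))]
  have h1 := normSq_diskMap_den_sub hp hq w
  rw [hw, Complex.normSq_eq_norm_sq, Complex.normSq_eq_norm_sq] at h1
  exact (pow_left_inj₀ (norm_nonneg _) (norm_nonneg _) two_ne_zero).1 (by linarith)

theorem exists_diskMap_eq (hp : ‖p‖ = 1) (hq : ‖q‖ = 1) (hpq : p ≠ q) {z : ℂ} (hz : ‖z‖ ≤ 1)
    (hzp : z ≠ p) (hzq : z ≠ q) : ∃ w : ℂ, w ≠ 0 ∧ 0 ≤ w.im ∧ diskMap p q w = z := by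
  have hμ := diskCoeff_ne_zero hq hpq
  have h1 : q - z ≠ 0 := sub_ne_zero.2 hzq.symm
  have h2 : q - p ≠ 0 := sub_ne_zero.2 hpq.symm
  set w := (z - p) / (diskCoeff p q * (q - z)) with hw
  have hμw : diskCoeff p q * w = (z - p) / (q - z) := by rw [hw]; field_simp
  have hden : 1 + diskCoeff p q * w = (q - p) / (q - z) := by rw [hμw]; field_simp; ring
  have hden0 : 1 + diskCoeff p q * w ≠ 0 := by rw [hden]; exact div_ne_zero h2 h1
  have hT : diskMap p q w = z := by
    rw [diskMap, div_eq_iff hden0, hden, hμw]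
    field_simp; ring
  refine ⟨w, div_ne_zero (sub_ne_zero.2 hzp) (mul_ne_zero hμ h1), ?_, hT⟩
  have h3 := normSq_diskMap_den_sub hp hq w
  have h4 : p + q * (diskCoeff p q * w) = z * (1 + diskCoeff p q * w) := by
    rw [← div_eq_iff hden0]; exact hT
  rw [h4, map_mul] at h3
  have h5 : Complex.normSq z ≤ 1 := by
    rw [Complex.normSq_eq_norm_sq]; nlinarith [norm_nonneg z]
  have h6 := Complex.normSq_nonneg (1 + diskCoeff p q * w)
  have h7 : 0 < Complex.normSq (diskCoeff p q) := Complex.normSq_pos.2 hμ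
  by_contra hneg
  push Not at hneg
  nlinarith [mul_neg_of_neg_of_pos hneg h7, mul_nonneg h6 (sub_nonneg.2 h5)]

theorem hasDerivAt_diskMap {w : ℂ} (hw : 1 + diskCoeff p q * w ≠ 0) :
    HasDerivAt (diskMap p q) ((q - p) * diskCoeff p q / (1 + diskCoeff p q * w) ^ 2) w := by
  have h1 : HasDerivAt (fun w => p + q * (diskCoeff p q * w)) (q * diskCoeff p q) w := by
    simpa using (((hasDerivAt_id w).const_mul (diskCoeff p q)).const_mul q).const_add p
  have h2 : HasDerivAt (fun w => 1 + diskCoeff p q * w) (diskCoeff p q) w := by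
    simpa using ((hasDerivAt_id w).const_mul (diskCoeff p q)).const_add 1
  refine (h1.div h2 hw).congr_deriv ?_
  congr 1
  ring

theorem diskMap_sub_left {w : ℂ} (hw : 1 + diskCoeff p q * w ≠ 0) :
    diskMap p q w - p = (q - p) * diskCoeff p q * w / (1 + diskCoeff p q * w) := by
  rw [diskMap]; field_simp; ring

theorem diskMap_sub_right {w : ℂ} (hw : 1 + diskCoeff p q * w ≠ 0) :
    diskMap p q w - q = (p - q) / (1 + diskCoeff p q * w) := by
  rw [diskMap]; field_simp; ring

theorem diskMap_sub_diskMap {w v : ℂ} (hw : 1 + diskCoeff p q * w ≠ 0)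
    (hv : 1 + diskCoeff p q * v ≠ 0) : diskMap p q v - diskMap p q w =
      (q - p) * diskCoeff p q * (v - w) / ((1 + diskCoeff p q * w) * (1 + diskCoeff p q * v)) := by
  rw [diskMap, diskMap]; field_simp; ring

end diskMap

/-! ### Monotonicity on the boundary and in the strip. -/

/-- A continuous function on the closed unit disk with a single local minimum `p` and a single local
maximum `q`, both on the circle, increases along the circle from `p` to `q`, on either side. -/
theorem le_of_unique_local_extrema {p q : ℂ} (hp : ‖p‖ = 1) (hq : ‖q‖ = 1) (hpq : p ≠ q) {h : ℂ → ℝ}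
    (hh : ContinuousOn h (closedBall 0 1))
    (hmax : ∀ z ∈ closedBall (0 : ℂ) 1, (∀ᶠ w in 𝓝[closedBall 0 1] z, h w ≤ h z) → z = q)
    (hmin : ∀ z ∈ closedBall (0 : ℂ) 1, (∀ᶠ w in 𝓝[closedBall 0 1] z, h z ≤ h w) → z = p)
    {w₁ w₂ : ℝ} (h₁ : w₁ ≠ 0) (h₁₂ : 0 < (w₂ - w₁) / w₁) :
    h (diskMap p q w₁) ≤ h (diskMap p q w₂) := by
  have hmem : ∀ w : ℝ, diskMap p q w ∈ closedBall (0 : ℂ) 1 := fun w => by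
    rw [mem_closedBall_zero_iff]
    exact norm_diskMap_le hp hq (by simp)
  by_contra! hlt
  -- The path from the first point to `q` stays above `c`, the path from `p` to the second point
  -- stays below, so they are disjoint. The resulting positive cross ratio reads `w₂ - w₁ = -(r *
  -- w₁)` in the half plane coordinate, against `h₁₂`.
  obtain ⟨c, hc2, hc1⟩ := exists_between hlt
  obtain ⟨γ, hγ⟩ := joinedIn_superlevel (isCompact_closedBall (0 : ℂ) 1) (convex_closedBall _ _) hh
    hmax (hmem w₁) hc1
  obtain ⟨δ, hδ⟩ := (joinedIn_superlevel (isCompact_closedBall (0 : ℂ) 1) (convex_closedBall _ _)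
    hh.neg (p := p) (fun z hz hev => hmin z hz (by simpa using hev)) (hmem w₂)
    (c := -c) (by simpa using hc2)).symm
  obtain ⟨r, hr, hcr⟩ := cross_ratio_pos_of_disjoint_paths γ δ
    (norm_diskMap_eq hp hq hpq (by simp)) hq hp (norm_diskMap_eq hp hq hpq (by simp))
    (fun s => by simpa using (hγ s).1) (fun s => by simpa using (hδ s).1) (fun s t hst => by
      have h1 : c < h (γ s) := (hγ s).2
      have h2 : -c < -h (δ t) := (hδ t).2
      rw [hst] at h1
      linarith)
  have d1 := diskMap_den_ne_zero hp hq hpq (w := w₁) (by simp)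
  have d2 := diskMap_den_ne_zero hp hq hpq (w := w₂) (by simp)
  have hμ := diskCoeff_ne_zero hq hpq
  have hqp : q - p ≠ 0 := sub_ne_zero.2 hpq.symm
  have e1 := diskMap_sub_left d1
  have e2 := diskMap_sub_right d2
  have e3 := diskMap_sub_diskMap d1 d2
  rw [e3, e2, ← neg_sub (diskMap p q w₁) p, e1] at hcr
  field_simp at hcr
  have h3 : ((w₂ - w₁ : ℝ) : ℂ) = ((-(r * w₁) : ℝ) : ℂ) := by
    push_cast
    linear_combination hcr
  have h4 : w₂ - w₁ = -(r * w₁) := by exact_mod_cast h3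
  rw [h4] at h₁₂
  have : -(r * w₁) / w₁ = -r := by field_simp
  rw [this] at h₁₂
  linarith

/-- A bounded holomorphic function on a horizontal strip whose real part increases from left to
right along both boundary lines has a real part that increases along all horizontal lines. -/
theorem re_le_re_add_of_strip {F : ℂ → ℂ} (hc : ContinuousOn F (Complex.im ⁻¹' Icc 0 Real.pi))
    (hd : DifferentiableOn ℂ F (Complex.im ⁻¹' Ioo 0 Real.pi)) {M : ℝ}
    (hM : ∀ ζ ∈ Complex.im ⁻¹' Icc 0 Real.pi, ‖F ζ‖ ≤ M)
    (hmono : ∀ ζ : ℂ, ζ.im = 0 ∨ ζ.im = Real.pi → ∀ t : ℝ, 0 ≤ t → (F ζ).re ≤ (F (ζ + t)).re)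
    {ζ : ℂ} (hζ : ζ ∈ Complex.im ⁻¹' Icc 0 Real.pi) {t : ℝ} (ht : 0 ≤ t) :
    (F ζ).re ≤ (F (ζ + t)).re := by
  have hshift : ∀ z : ℂ, (z + t).im = z.im := fun z => by simp
  have hnorm : ∀ z : ℂ, ‖Complex.exp (F z - F (z + t))‖ = Real.exp ((F z).re - (F (z + t)).re) :=
    fun z => by rw [Complex.norm_exp, Complex.sub_re]
  have hcl : closure (Complex.im ⁻¹' Ioo 0 Real.pi) ⊆ Complex.im ⁻¹' Icc 0 Real.pi :=
    closure_minimal (preimage_mono Ioo_subset_Icc_self)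
      (isClosed_Icc.preimage Complex.continuous_im)
  have hD : DiffContOnCl ℂ (fun z => Complex.exp (F z - F (z + t)))
      (Complex.im ⁻¹' Ioo 0 Real.pi) := by
    constructor
    · refine (hd.sub (hd.comp (by fun_prop) fun z hz => ?_)).cexp
      simpa using hz
    · refine (ContinuousOn.sub hc (hc.comp (by fun_prop) fun z hz => ?_)).cexp.mono hcl
      simpa using hz
  have hbd : ∀ z : ℂ, z.im = 0 ∨ z.im = Real.pi → ‖Complex.exp (F z - F (z + t))‖ ≤ 1 := by
    intro z hz
    rw [hnorm, Real.exp_le_one_iff]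
    linarith [hmono z hz t ht]
  -- The modulus of `exp (F z - F (z + t))` is at most `1` exactly when `Re F` does not decrease
  -- under the shift. Since `F` is bounded, the growth condition holds with both constants zero.
  have := PhragmenLindelof.horizontal_strip (C := 1) hD ⟨0, by
    rw [sub_zero, div_self Real.pi_ne_zero]; exact one_pos, 0, by
    simp only [zero_mul, Real.exp_zero]
    refine Asymptotics.IsBigO.of_bound (Real.exp (2 * M)) ?_
    filter_upwards [mem_inf_of_right (mem_principal_self _)] with z hz
    have hz' : z ∈ Complex.im ⁻¹' Icc 0 Real.pi := preimage_mono Ioo_subset_Icc_self hz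
    have h1 := hM z hz'
    have h2 := hM (z + t) (by simpa using hz')
    have h3 := (Complex.abs_re_le_norm (F z)).trans h1
    have h4 := (Complex.abs_re_le_norm (F (z + t))).trans h2
    rw [hnorm, norm_one, mul_one, Real.exp_le_exp]
    linarith [abs_le.1 h3, abs_le.1 h4]⟩
    (fun z hz => hbd z (Or.inl hz)) (fun z hz => hbd z (Or.inr hz)) hζ.1 hζ.2
  rw [hnorm, Real.exp_le_one_iff] at this
  linarith

/-- If the real part of a holomorphic function on a horizontal strip increases along horizontal
lines, and is constant along none of them, its derivative has positive real part. -/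
theorem re_deriv_pos_of_strip {F : ℂ → ℂ} (hd : DifferentiableOn ℂ F (Complex.im ⁻¹' Ioo 0 Real.pi))
    (hmono : ∀ ζ ∈ Complex.im ⁻¹' Ioo 0 Real.pi, ∀ t : ℝ, 0 ≤ t → (F ζ).re ≤ (F (ζ + t)).re)
    (hne : ∀ ζ ∈ Complex.im ⁻¹' Ioo 0 Real.pi, ∃ t : ℝ, (F (ζ + t)).re ≠ (F ζ).re)
    {ζ : ℂ} (hζ : ζ ∈ Complex.im ⁻¹' Ioo 0 Real.pi) : 0 < (deriv F ζ).re := by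
  have hopen : IsOpen (Complex.im ⁻¹' Ioo 0 Real.pi) := isOpen_Ioo.preimage Complex.continuous_im
  have hder : ∀ ζ ∈ Complex.im ⁻¹' Ioo 0 Real.pi, ∀ s : ℝ,
      HasDerivAt (fun t : ℝ => (F (ζ + t)).re) (deriv F (ζ + s)).re s := by
    intro ζ hζ s
    have h1 : HasDerivAt F (deriv F (ζ + s)) (ζ + s) :=
      (hd.differentiableAt (hopen.mem_nhds (by simpa using hζ))).hasDerivAt
    have h2 : HasDerivAt (fun t : ℂ => F (ζ + t)) (deriv F (ζ + s)) (s : ℂ) := by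
      simpa using h1.comp_const_add ζ (s : ℂ)
    exact h2.real_of_complex
  have hnonneg : ∀ ζ ∈ Complex.im ⁻¹' Ioo 0 Real.pi, 0 ≤ (deriv F ζ).re := by
    intro ζ hζ
    have h1 := hder ζ hζ 0
    have hm : Monotone (fun t : ℝ => (F (ζ + t)).re) := by
      intro a b hab
      have := hmono (ζ + a) (by simpa using hζ) (b - a) (sub_nonneg.2 hab)
      simpa [add_assoc] using this
    simpa [h1.deriv] using (hm.monotoneOn univ).derivWithin_nonneg (x := 0)
  refine (hnonneg ζ hζ).lt_of_ne fun h0 => ?_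
  -- A zero of the nonnegative function `Re F'` is a maximum point of `|exp (-F')|`, so `Re F'`
  -- vanishes identically and `Re F` is constant on horizontal lines.
  have hd' : DifferentiableOn ℂ (fun z => Complex.exp (-deriv F z))
      (Complex.im ⁻¹' Ioo 0 Real.pi) := (hd.deriv hopen).neg.cexp
  have hpre : IsPreconnected (Complex.im ⁻¹' Ioo 0 Real.pi) := by
    have : Convex ℝ (Complex.im ⁻¹' Ioo 0 Real.pi) :=
      (convex_Ioo 0 Real.pi).linear_preimage Complex.imLm
    exact this.isPreconnected
  have hmax : IsMaxOn (norm ∘ fun z => Complex.exp (-deriv F z)) (Complex.im ⁻¹' Ioo 0 Real.pi) ζ := by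
    intro z hz
    simp only [Function.comp_apply, mem_ofPred_eq, Complex.norm_exp, Complex.neg_re, ← h0, neg_zero,
      Real.exp_zero, Real.exp_le_one_iff]
    linarith [hnonneg z hz]
  have hconst := Complex.norm_eqOn_of_isPreconnected_of_isMaxOn hpre hopen hd' hζ hmax
  have hzero : ∀ s : ℝ, (deriv F (ζ + s)).re = 0 := by
    intro s
    have := hconst (x := ζ + s) (by simpa using hζ)
    simp only [Function.comp_apply, Function.const_apply, Complex.norm_exp, Complex.neg_re, ← h0,
      neg_zero, Real.exp_zero, Real.exp_eq_one_iff] at this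
    linarith
  obtain ⟨t, ht⟩ := hne ζ hζ
  apply ht
  have := is_const_of_deriv_eq_zero (f := fun t : ℝ => (F (ζ + t)).re)
    (fun s => (hder ζ hζ s).differentiableAt) (fun s => by rw [(hder ζ hζ s).deriv, hzero]) t 0
  simpa using this

/-- A holomorphic function on a horizontal strip whose derivative has positive real part separates
any two points of the closed strip which are not on a common boundary line. -/
theorem ne_of_re_deriv_pos_of_strip {F : ℂ → ℂ}
    (hc : ContinuousOn F (Complex.im ⁻¹' Icc 0 Real.pi))
    (hd : DifferentiableOn ℂ F (Complex.im ⁻¹' Ioo 0 Real.pi))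
    (hpos : ∀ ζ ∈ Complex.im ⁻¹' Ioo 0 Real.pi, 0 < (deriv F ζ).re)
    {ζ ξ : ℂ} (hζ : ζ ∈ Complex.im ⁻¹' Icc 0 Real.pi) (hξ : ξ ∈ Complex.im ⁻¹' Icc 0 Real.pi)
    (hne : ζ ≠ ξ) (h : ζ.im = ξ.im → ζ ∈ Complex.im ⁻¹' Ioo 0 Real.pi) : F ζ ≠ F ξ := by
  have hopen : IsOpen (Complex.im ⁻¹' Ioo 0 Real.pi) := isOpen_Ioo.preimage Complex.continuous_im
  set d := ξ - ζ with hdd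
  have hd0 : d ≠ 0 := sub_ne_zero.2 hne.symm
  have him : ∀ s : ℝ, (ζ + s * d).im = (1 - s) * ζ.im + s * ξ.im := fun s => by
    simp [hdd]; ring
  have hmem : ∀ s ∈ Icc (0 : ℝ) 1, ζ + s * d ∈ Complex.im ⁻¹' Icc 0 Real.pi := by
    intro s hs
    simp only [mem_preimage, him, mem_Icc] at hζ hξ ⊢
    constructor
    · nlinarith [hs.1, hs.2]
    · nlinarith [hs.1, hs.2]
  have hmem' : ∀ s ∈ Ioo (0 : ℝ) 1, ζ + s * d ∈ Complex.im ⁻¹' Ioo 0 Real.pi := by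
    intro s hs
    simp only [mem_preimage, him, mem_Icc, mem_Ioo] at hζ hξ h ⊢
    obtain ⟨hs0, hs1⟩ := hs
    rcases lt_trichotomy ζ.im ξ.im with hlt | heq | hlt
    · constructor <;> nlinarith
    · rw [← heq]
      have := h heq
      constructor <;> nlinarith
    · constructor <;> nlinarith
  -- Along the segment from `ζ` to `ξ` the function `Re (F * conj d)` has derivative `Re F' * |d|²`,
  -- which is positive because the open segment lies in the open strip.
  have hcont : ContinuousOn (fun s : ℝ => (F (ζ + s * d) * (starRingEnd ℂ) d).re) (Icc 0 1) := by
    refine Complex.continuous_re.comp_continuousOn (ContinuousOn.mul ?_ continuousOn_const)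
    exact hc.comp (by fun_prop) hmem
  have hderiv : ∀ s ∈ Ioo (0 : ℝ) 1,
      HasDerivAt (fun s : ℝ => (F (ζ + s * d) * (starRingEnd ℂ) d).re)
        ((deriv F (ζ + s * d)).re * Complex.normSq d) s := by
    intro s hs
    have h1 : HasDerivAt F (deriv F (ζ + s * d)) (ζ + s * d) :=
      (hd.differentiableAt (hopen.mem_nhds (hmem' s hs))).hasDerivAt
    have h2 : HasDerivAt (fun z : ℂ => ζ + z * d) d (s : ℂ) := by
      simpa using ((hasDerivAt_id (s : ℂ)).mul_const d).const_add ζ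
    have h3 := (HasDerivAt.comp (s : ℂ) h1 h2).mul_const ((starRingEnd ℂ) d)
    refine h3.real_of_complex.congr_deriv ?_
    rw [mul_assoc, Complex.mul_conj, Complex.re_mul_ofReal]
  have hsm := strictMonoOn_of_deriv_pos (convex_Icc (0 : ℝ) 1) hcont (fun s hs => by
    rw [interior_Icc] at hs
    rw [(hderiv s hs).deriv]
    exact mul_pos (hpos _ (hmem' s hs)) (Complex.normSq_pos.2 hd0))
  have := hsm (left_mem_Icc.2 zero_le_one) (right_mem_Icc.2 zero_le_one) zero_lt_one
  intro heq
  simp [hdd, heq] at this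

/-! ### Boundary point lemmas. -/

/-- A Harnack inequality for the real part of a holomorphic function. -/
theorem harnack_re {f : ℂ → ℂ} {c : ℂ} {r : ℝ} (hf : DifferentiableOn ℂ f (ball c r))
    (hpos : ∀ z ∈ ball c r, 0 < (f z).re) {z : ℂ} (hz : z ∈ ball c r) :
    (f c).re * (1 - dist z c / r) / 2 ≤ (f z).re := by
  have hr : 0 < r := dist_nonneg.trans_lt hz
  have hc0 := hpos c (mem_ball_self hr)
  have hden : ∀ z ∈ ball c r, f z + (starRingEnd ℂ) (f c) ≠ 0 := fun z hz h => by
    have := congrArg Complex.re h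
    simp at this
    linarith [hpos z hz]
  have hsq : ∀ w : ℂ, ‖w‖ ^ 2 = w.re * w.re + w.im * w.im := fun w => by
    rw [← Complex.normSq_eq_norm_sq, Complex.normSq_apply]
  -- The Cayley transform sending `f c` to `0` takes the right half plane into the unit disk, so the
  -- Schwarz lemma applies.
  have hmaps : MapsTo (fun z => (f z - f c) / (f z + (starRingEnd ℂ) (f c))) (ball c r)
      (closedBall ((f c - f c) / (f c + (starRingEnd ℂ) (f c))) 1) := by
    intro w hw
    simp only [sub_self, zero_div, mem_closedBall, dist_zero_right, norm_div]
    refine div_le_one_of_le₀ ?_ (norm_nonneg _)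
    refine le_of_sq_le_sq ?_ (norm_nonneg _)
    rw [hsq, hsq]
    simp only [Complex.sub_re, Complex.sub_im, Complex.add_re, Complex.add_im, Complex.conj_re,
      Complex.conj_im]
    nlinarith [mul_pos (hpos w hw) hc0]
  have hdiff : DifferentiableOn ℂ (fun z => (f z - f c) / (f z + (starRingEnd ℂ) (f c))) (ball c r) :=
    (hf.sub_const _).div (hf.add_const _) hden
  have h := Complex.dist_le_div_mul_dist_of_mapsTo_ball hdiff hmaps hz
  simp only [sub_self, zero_div, dist_zero_right, norm_div] at h
  rw [div_le_iff₀ (norm_pos_iff.2 (hden z hz))] at h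
  set t := 1 - dist z c / r with ht
  have ht0 : 0 < t := by rw [ht, sub_pos, div_lt_one hr]; exact hz
  have ht1 : t ≤ 1 := by rw [ht]; linarith [div_nonneg (dist_nonneg (x := z) (y := c)) hr.le]
  have h1 : 1 / r * dist z c = 1 - t := by rw [ht]; ring
  rw [h1] at h
  have h2 : ‖f z - f c‖ ^ 2 ≤ (1 - t) ^ 2 * ‖f z + (starRingEnd ℂ) (f c)‖ ^ 2 := by
    rw [← mul_pow]; exact pow_le_pow_left₀ (norm_nonneg _) h 2
  rw [hsq, hsq] at h2
  simp only [Complex.sub_re, Complex.sub_im, Complex.add_re, Complex.add_im, Complex.conj_re,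
      Complex.conj_im] at h2
  have hx := hpos z hz
  -- The imaginary parts contribute the same square to both norms, and the factor `(1 - t) ^ 2` is
  -- at most `1`, so they can be dropped.
  have h3 : ((f c).re - (f z).re) ^ 2 ≤ ((1 - t) * ((f z).re + (f c).re)) ^ 2 := by
    have : (1 - t) ^ 2 ≤ 1 := by nlinarith
    nlinarith [mul_nonneg (sub_nonneg.2 this) (mul_self_nonneg ((f z).im - (f c).im))]
  have h4 := (abs_le_of_sq_le_sq' h3 (by nlinarith)).2
  nlinarith

/-- The Hopf boundary point lemma for the real part of a holomorphic function. -/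
theorem hopf_re {f : ℂ → ℂ} {c p l : ℂ} {S : Set ℂ} (hpc : p ≠ c)
    (hf : DifferentiableOn ℂ f (ball c (dist p c)))
    (hpos : ∀ z ∈ ball c (dist p c), 0 < (f z).re) (hS : ball c (dist p c) ⊆ S)
    (hl : HasDerivWithinAt f l S p) (hp : (f p).re = 0) : 0 < (l * (c - p)).re := by
  have hr : 0 < dist p c := dist_pos.2 hpc
  have hmem : ∀ t ∈ Ioo (0 : ℝ) 1, p + t * (c - p) ∈ ball c (dist p c) := by
    intro t ht
    rw [mem_ball, Complex.dist_eq, Complex.dist_eq,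
      show p + t * (c - p) - c = (1 - t : ℝ) * (p - c) by push_cast; ring, norm_mul,
      Complex.norm_real, Real.norm_of_nonneg (by linarith [ht.2])]
    rw [Complex.dist_eq] at hr
    nlinarith [ht.1]
  have h1 : HasDerivWithinAt (fun t : ℝ => p + t * (c - p)) (c - p) (Ioo 0 1) 0 := by
    have : HasDerivAt (fun t : ℝ => p + t * (c - p)) (c - p) 0 := by
      simpa using (((hasDerivAt_id (0 : ℝ)).ofReal_comp).mul_const (c - p)).const_add p
    exact this.hasDerivWithinAt
  have h2 : HasDerivWithinAt (fun t : ℝ => f (p + t * (c - p))) ((c - p) • l) (Ioo 0 1) 0 := by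
    refine HasDerivWithinAt.scomp (t' := S) (0 : ℝ) (by simpa using hl) h1 fun t ht => hS (hmem t ht)
  have h3 : HasDerivWithinAt (fun t : ℝ => (f (p + t * (c - p))).re) ((c - p) • l).re (Ioo 0 1) 0 :=
    (Complex.reCLM.hasFDerivAt.comp_hasDerivWithinAt (0 : ℝ) h2)
  rw [hasDerivWithinAt_iff_tendsto_slope' (by simp)] at h3
  have hne : (𝓝[Ioo (0 : ℝ) 1] 0).NeBot := by
    rw [nhdsWithin_Ioo_eq_nhdsGT one_pos]; infer_instance
  -- On the radius from `p` to `c` the Harnack bound is linear in the parameter, so all difference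
  -- quotients at `p` are at least `(f c).re / 2`.
  have hge : (f c).re / 2 ≤ ((c - p) • l).re := by
    refine ge_of_tendsto h3 ?_
    filter_upwards [self_mem_nhdsWithin] with t ht
    have h4 := harnack_re hf hpos (hmem t ht)
    have h5 : 1 - dist (p + t * (c - p)) c / dist p c = t := by
      have : dist (p + t * (c - p)) c = (1 - t) * dist p c := by
        rw [Complex.dist_eq, Complex.dist_eq,
          show p + t * (c - p) - c = (1 - t : ℝ) * (p - c) by push_cast; ring, norm_mul,
          Complex.norm_real, Real.norm_of_nonneg (by linarith [ht.2])]
      rw [this]; field_simp; ring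
    rw [h5] at h4
    rw [slope_def_field, le_div_iff₀ (by linarith [ht.1])]
    simp [hp]
    linarith
  rw [mul_comm]
  have := hpos c (mem_ball_self hr)
  simp only [smul_eq_mul] at hge
  linarith

/-! ### Corners with edges of slope `±1`. -/

/-- Such a `v` is a positive multiple of `1 + e * I`, so its argument depends on the slope alone. -/
theorem log_im_of_slope {v : ℂ} (hv : 0 < v.re) {e : ℝ} (h : v.im = e * v.re) :
    (Complex.log v).im = (Complex.log (1 + e * Complex.I)).im := by
  have : v = v.re * (1 + e * Complex.I) := by
    apply Complex.ext <;> simp [h, mul_comm]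
  rw [Complex.log_im, Complex.log_im, this, Complex.arg_real_mul _ hv]

theorem exp_im_nonneg_of_mem_strip {ζ : ℂ} (h : ζ ∈ Complex.im ⁻¹' Icc 0 Real.pi) :
    0 ≤ (Complex.exp ζ).im := by
  rw [Complex.exp_im]
  exact mul_nonneg (Real.exp_pos _).le (Real.sin_nonneg_of_mem_Icc h)

theorem exp_im_pos_of_mem_strip {ζ : ℂ} (h : ζ ∈ Complex.im ⁻¹' Ioo 0 Real.pi) :
    0 < (Complex.exp ζ).im := by
  rw [Complex.exp_im]
  exact mul_pos (Real.exp_pos _) (Real.sin_pos_of_mem_Ioo h)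

/-- For antipodal points the coefficient is `-2 * I`, so the numerator has norm `2 * 2 * ‖w‖`, while
the denominator has real part `1 + 2 * w.im ≥ 1`. -/
theorem norm_diskMap_neg_sub_le {p : ℂ} (hp : ‖p‖ = 1) {w : ℂ} (hw : 0 ≤ w.im) :
    ‖diskMap p (-p) w - p‖ ≤ 4 * ‖w‖ := by
  have hp0 : p ≠ 0 := by rintro rfl; simp at hp
  have hpp : p ≠ -p := fun h => hp0 (self_eq_neg.1 h)
  have hq : ‖-p‖ = 1 := by rw [norm_neg, hp]
  have hd := diskMap_den_ne_zero hp hq hpp hw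
  have hμ : diskCoeff p (-p) = -2 * Complex.I := by
    rw [diskCoeff, map_neg, mul_neg, mul_conj_of_norm_eq_one hp]; ring
  rw [diskMap_sub_left hd, norm_div, hμ]
  have h1 : 1 ≤ ‖1 + -2 * Complex.I * w‖ := by
    refine le_trans ?_ (Complex.re_le_norm _)
    simp; linarith
  refine (div_le_self (norm_nonneg _) h1).trans ?_
  rw [norm_mul, norm_mul, ← neg_add', norm_neg, ← two_mul]
  simp [hp]; norm_num

/-- The corner of a holomorphic map at a boundary point `p` of the disk, if the images of the two
boundary arcs at `p` lie on lines of slope `±1` and the image of the disk lies to the right of the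
corner: the incoming arc has slope `1` and the outgoing arc has slope `-1`. -/
theorem slopes_of_right_corner {v : ℂ → ℂ} {p : ℂ} (hp : ‖p‖ = 1) {ε : ℝ} (hε : 0 < ε)
    (hc : ContinuousOn v (closedBall 0 1 ∩ ball p ε))
    (hd : DifferentiableOn ℂ v (ball 0 1 ∩ ball p ε)) (hvp : v p = 0)
    (hpos : ∀ z ∈ closedBall (0 : ℂ) 1 ∩ ball p ε, z ≠ p → 0 < (v z).re)
    {a b : ℝ} (ha : a = 1 ∨ a = -1) (hb : b = 1 ∨ b = -1)
    (hout : ∀ᶠ x : ℝ in 𝓝[>] (0 : ℝ), (v (diskMap p (-p) x)).im = a * (v (diskMap p (-p) x)).re)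
    (hin : ∀ᶠ x : ℝ in 𝓝[<] (0 : ℝ), (v (diskMap p (-p) x)).im = b * (v (diskMap p (-p) x)).re) :
    a = -1 ∧ b = 1 := by
  by_contra hab
  have hp0 : p ≠ 0 := by rintro rfl; simp at hp
  have hpp : p ≠ -p := fun h => hp0 (self_eq_neg.1 h)
  have hq : ‖-p‖ = 1 := by rw [norm_neg, hp]
  set A : ℝ → ℝ := fun e => (Complex.log (1 + e * Complex.I)).im with hA
  have hA1 : 0 ≤ A 1 := by
    rw [hA]; simp only [Complex.log_im, Complex.arg_nonneg_iff]; simp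
  have hA2 : A (-1) ≤ 0 := by
    rw [hA]; simp only [Complex.log_im]
    exact (Complex.arg_neg_iff.2 (by simp)).le
  -- This slope makes the imaginary part of `log v + κ ζ` agree on the two boundary lines of the
  -- half strip. It is nonnegative unless `a = -1` and `b = 1`.
  set κ := (A a - A b) / Real.pi with hκ
  have hκ0 : 0 ≤ κ := by
    refine div_nonneg ?_ Real.pi_pos.le
    rcases ha with rfl | rfl <;> rcases hb with rfl | rfl
    · simp
    · linarith
    · simp at hab
    · simp
  -- a neighbourhood of the corner in the half plane chart
  obtain ⟨δ₁, hδ₁, hout'⟩ := mem_nhdsGT_iff_exists_Ioo_subset.1 hout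
  obtain ⟨δ₂, hδ₂, hin'⟩ := mem_nhdsLT_iff_exists_Ioo_subset.1 hin
  simp only [mem_Ioi, mem_Iio] at hδ₁ hδ₂
  obtain ⟨x₀, hx₀⟩ : ∃ x₀ : ℝ, ∀ x ≤ x₀,
      4 * Real.exp x < ε ∧ Real.exp x < δ₁ ∧ Real.exp x < -δ₂ := by
    have h1 := Real.tendsto_exp_atBot
    have h2 : Tendsto (fun x => 4 * Real.exp x) atBot (𝓝 0) := by simpa using h1.const_mul 4
    have := (h2.eventually (gt_mem_nhds hε)).and ((h1.eventually (gt_mem_nhds hδ₁)).and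
      (h1.eventually (gt_mem_nhds (neg_pos.2 hδ₂))))
    exact eventually_atBot.1 this
  set Z : ℂ → ℂ := fun ζ => diskMap p (-p) (Complex.exp ζ) with hZ
  have hZsub : ∀ ζ ∈ Complex.im ⁻¹' Icc 0 Real.pi, ‖Z ζ - p‖ ≤ 4 * Real.exp ζ.re := fun ζ hζ => by
    have := norm_diskMap_neg_sub_le hp (exp_im_nonneg_of_mem_strip hζ)
    rwa [Complex.norm_exp] at this
  have hZd : ∀ ζ ∈ Complex.im ⁻¹' Icc 0 Real.pi, DifferentiableAt ℂ Z ζ := fun ζ hζ => by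
    have h1 := (hasDerivAt_diskMap
      (diskMap_den_ne_zero hp hq hpp (exp_im_nonneg_of_mem_strip hζ))).differentiableAt
    exact h1.comp ζ Complex.differentiable_exp.differentiableAt
  have hZne : ∀ ζ ∈ Complex.im ⁻¹' Icc 0 Real.pi, Z ζ ≠ p := fun ζ hζ => by
    have h1 := diskMap_den_ne_zero hp hq hpp (exp_im_nonneg_of_mem_strip hζ)
    have h2 := diskMap_sub_left h1
    rw [← sub_ne_zero]
    rw [hZ]; simp only [h2]
    exact div_ne_zero (mul_ne_zero (mul_ne_zero (sub_ne_zero.2 hpp.symm)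
      (diskCoeff_ne_zero hq hpp)) (Complex.exp_ne_zero _)) h1
  have hZmem : ∀ ζ ∈ Complex.im ⁻¹' Icc 0 Real.pi, ζ.re ≤ x₀ →
      Z ζ ∈ closedBall (0 : ℂ) 1 ∩ ball p ε := fun ζ hζ hre => by
    refine ⟨?_, ?_⟩
    · rw [mem_closedBall_zero_iff]
      exact norm_diskMap_le hp hq (exp_im_nonneg_of_mem_strip hζ)
    · rw [mem_ball, dist_eq_norm]
      exact (hZsub ζ hζ).trans_lt (hx₀ _ hre).1
  have hZmem' : ∀ ζ ∈ Complex.im ⁻¹' Ioo 0 Real.pi, ζ.re ≤ x₀ →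
      Z ζ ∈ ball (0 : ℂ) 1 ∩ ball p ε := fun ζ hζ hre => by
    refine ⟨?_, (hZmem ζ (preimage_mono Ioo_subset_Icc_self hζ) hre).2⟩
    rw [mem_ball_zero_iff]
    exact norm_diskMap_lt hp hq hpp (exp_im_pos_of_mem_strip hζ)
  have hvpos : ∀ ζ ∈ Complex.im ⁻¹' Icc 0 Real.pi, ζ.re ≤ x₀ → 0 < (v (Z ζ)).re :=
    fun ζ hζ hre => hpos _ (hZmem ζ hζ hre) (hZne ζ hζ)
  set f : ℂ → ℂ := fun ζ => Complex.log (v (Z ζ)) + κ * ζ with hf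
  -- the logarithm has the same imaginary part on the two boundary lines
  have hline : ∀ x : ℝ, x ≤ x₀ → (f (x + (0 : ℝ) * Complex.I)).im = (f (x + Real.pi * Complex.I)).im := by
    intro x hx
    have e1 : Z (x + (0 : ℝ) * Complex.I) = diskMap p (-p) ((Real.exp x : ℝ) : ℂ) := by
      simp [hZ]
    have e2 : Z (x + Real.pi * Complex.I) = diskMap p (-p) ((-Real.exp x : ℝ) : ℂ) := by
      simp [hZ, Complex.exp_add]
    have m1 : (x + (0 : ℝ) * Complex.I : ℂ) ∈ Complex.im ⁻¹' Icc 0 Real.pi := by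
      simp [Real.pi_pos.le]
    have m2 : (x + Real.pi * Complex.I : ℂ) ∈ Complex.im ⁻¹' Icc 0 Real.pi := by
      simp [Real.pi_pos.le]
    have p1 := hvpos _ m1 (by simpa using hx)
    have p2 := hvpos _ m2 (by simpa using hx)
    have s1 : (v (Z (x + (0 : ℝ) * Complex.I))).im = a * (v (Z (x + (0 : ℝ) * Complex.I))).re := by
      rw [e1]; exact hout' ⟨Real.exp_pos x, (hx₀ x hx).2.1⟩
    have s2 : (v (Z (x + Real.pi * Complex.I))).im = b * (v (Z (x + Real.pi * Complex.I))).re := by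
      rw [e2]; exact hin' ⟨by linarith [(hx₀ x hx).2.2], by simpa using Real.exp_pos x⟩
    simp only [hf, Complex.add_im, log_im_of_slope p1 s1, log_im_of_slope p2 s2,
      Complex.im_ofReal_mul]
    simp only [Complex.ofReal_im, Complex.I_im, mul_zero, mul_one, add_zero, zero_add, hκ]
    change A a = A b + _
    field_simp
    ring
  have hfc : ContinuousOn f (Complex.im ⁻¹' Icc 0 Real.pi ∩ Complex.re ⁻¹' Iic x₀) := by
    refine ContinuousOn.add (ContinuousOn.clog ?_ fun ζ hζ => Or.inl (hvpos ζ hζ.1 hζ.2))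
      (by fun_prop)
    exact hc.comp (fun ζ hζ => (hZd ζ hζ.1).continuousAt.continuousWithinAt)
      fun ζ hζ => hZmem ζ hζ.1 hζ.2
  have hfd : ∀ ζ ∈ Complex.im ⁻¹' Ioo 0 Real.pi, ζ.re ≤ x₀ → DifferentiableAt ℂ f ζ := by
    intro ζ hζ hre
    have hζ' := preimage_mono (f := Complex.im) Ioo_subset_Icc_self hζ
    have hv : DifferentiableAt ℂ v (Z ζ) :=
      hd.differentiableAt ((isOpen_ball.inter isOpen_ball).mem_nhds (hZmem' ζ hζ hre))
    exact ((hv.comp ζ (hZd ζ hζ')).clog (Or.inl (hvpos ζ hζ' hre))).add (by fun_prop)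
  -- Cauchy's theorem on the rectangle between `x` and `x₀`: the imaginary parts of the two
  -- horizontal integrals cancel by `hline`, leaving equality of the real parts integrated over the
  -- vertical sides.
  have hint : ∀ x ≤ x₀, ∫ y in (0 : ℝ)..Real.pi, (f (x + y * Complex.I)).re =
      ∫ y in (0 : ℝ)..Real.pi, (f (x₀ + y * Complex.I)).re := by
    intro x hx
    have hpi := Real.pi_pos.le
    have hC := Complex.integral_boundary_rect_eq_zero_of_continuousOn_of_differentiableOn f
      (x : ℂ) (x₀ + Real.pi * Complex.I) (by
        refine hfc.mono ?_
        intro ζ hζ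
        simp only [Complex.mem_reProdIm, Complex.add_re, Complex.ofReal_re, Complex.mul_re,
          Complex.I_re, mul_zero, Complex.ofReal_im, Complex.I_im, sub_zero, add_zero,
          Complex.add_im, Complex.mul_im, mul_one, zero_add, uIcc_of_le hx, uIcc_of_le hpi] at hζ
        exact ⟨hζ.2, hζ.1.2⟩) (by
        intro ζ hζ
        simp only [Complex.mem_reProdIm, Complex.add_re, Complex.ofReal_re, Complex.mul_re,
          Complex.I_re, mul_zero, Complex.ofReal_im, Complex.I_im, sub_zero, add_zero,
          Complex.add_im, Complex.mul_im, mul_one, zero_add, min_eq_left hx, max_eq_right hx,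
          min_eq_left hpi, max_eq_right hpi] at hζ
        exact (hfd ζ hζ.2 hζ.1.2.le).differentiableWithinAt)
    simp only [Complex.add_re, Complex.ofReal_re, Complex.mul_re,
          Complex.I_re, mul_zero, Complex.ofReal_im, Complex.I_im, sub_zero, add_zero,
          Complex.add_im, Complex.mul_im, mul_one, zero_add] at hC
    have hci : ∀ x' ≤ x₀, IntervalIntegrable (fun y : ℝ => f (x' + y * Complex.I))
        MeasureTheory.volume 0 Real.pi := by
      intro x' hx'
      refine ContinuousOn.intervalIntegrable (hfc.comp (by fun_prop) ?_)
      intro y hy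
      rw [uIcc_of_le hpi] at hy
      simpa using ⟨hy, hx'⟩
    have hre : ∀ x' ≤ x₀, (∫ y in (0 : ℝ)..Real.pi, f (x' + y * Complex.I)).re =
        ∫ y in (0 : ℝ)..Real.pi, (f (x' + y * Complex.I)).re := fun x' hx' =>
      (Complex.reCLM.intervalIntegral_comp_comm (hci x' hx')).symm
    have hhor : ∀ θ ∈ Icc 0 Real.pi, IntervalIntegrable (fun s : ℝ => f (s + θ * Complex.I))
        MeasureTheory.volume x x₀ := by
      intro θ hθ
      refine ContinuousOn.intervalIntegrable (hfc.comp (by fun_prop) ?_)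
      intro y hy
      rw [uIcc_of_le hx] at hy
      simpa using ⟨hθ, hy.2⟩
    have him : ((∫ s in x..x₀, f (s + (0 : ℝ) * Complex.I)) -
        ∫ s in x..x₀, f (s + Real.pi * Complex.I)).im = 0 := by
      rw [← intervalIntegral.integral_sub (hhor 0 ⟨le_rfl, hpi⟩) (hhor Real.pi ⟨hpi, le_rfl⟩)]
      have := Complex.imCLM.intervalIntegral_comp_comm
        ((hhor 0 ⟨le_rfl, hpi⟩).sub (hhor Real.pi ⟨hpi, le_rfl⟩))
      simp only [Complex.imCLM_apply] at this
      rw [← this]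
      rw [intervalIntegral.integral_congr (g := fun _ => (0 : ℝ))]
      · simp
      · intro s hs
        rw [uIcc_of_le hx] at hs
        simp only [Complex.sub_im, hline s hs.2, sub_self]
    have h2 := congrArg Complex.im hC
    simp only [Complex.ofReal_zero, zero_mul, add_zero] at him
    simp only [Complex.sub_im, Complex.add_im, smul_eq_mul, Complex.I_mul_im, Complex.zero_im,
      Complex.ofReal_zero, zero_mul, add_zero] at h2 him
    rw [hre x hx, hre x₀ le_rfl] at h2
    linarith
  -- but the real part tends to `-∞` at the corner
  set C := ∫ y in (0 : ℝ)..Real.pi, (f (x₀ + y * Complex.I)).re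
  -- With this choice `-π K < -|C| ≤ C`, so pushing the integrand below `-K` contradicts the
  -- constancy of the integral.
  set K := |C| + 1 with hK
  have hvlim : ∀ᶠ z in 𝓝[closedBall 0 1 ∩ ball p ε] p, ‖v z‖ < Real.exp (-K) := by
    have hpm : p ∈ closedBall (0 : ℂ) 1 ∩ ball p ε := ⟨by simp [hp], mem_ball_self hε⟩
    have := (hc p hpm).norm
    rw [ContinuousWithinAt, hvp, norm_zero] at this
    exact this.eventually (gt_mem_nhds (Real.exp_pos _))
  obtain ⟨η, hη, hηv⟩ := mem_nhdsWithin_iff.1 hvlim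
  obtain ⟨x, hx, hx0, hxη⟩ : ∃ x : ℝ, x ≤ x₀ ∧ x ≤ 0 ∧ 4 * Real.exp x < η := by
    have h2 : Tendsto (fun x => 4 * Real.exp x) atBot (𝓝 0) := by
      simpa using Real.tendsto_exp_atBot.const_mul 4
    exact ((eventually_le_atBot x₀).and ((eventually_le_atBot 0).and
      (h2.eventually (gt_mem_nhds hη)))).exists
  have hbound : ∀ y ∈ Icc 0 Real.pi, (f (x + y * Complex.I)).re ≤ -K := by
    intro y hy
    have m : (x + y * Complex.I : ℂ) ∈ Complex.im ⁻¹' Icc 0 Real.pi := by simpa using hy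
    have hre : (x + y * Complex.I : ℂ).re = x := by simp
    have h1 : ‖v (Z (x + y * Complex.I))‖ < Real.exp (-K) := by
      refine hηv ⟨?_, hZmem _ m (by rw [hre]; exact hx)⟩
      rw [mem_ball, dist_eq_norm]
      have := hZsub _ m
      rw [hre] at this
      linarith
    have h2 : 0 < ‖v (Z (x + y * Complex.I))‖ := by
      rw [norm_pos_iff]
      intro h0
      have := hvpos _ m (by rw [hre]; exact hx)
      simp [h0] at this
    have h3 := Real.log_lt_log h2 h1
    rw [Real.log_exp] at h3
    simp only [hf, Complex.add_re, Complex.log_re, Complex.re_ofReal_mul]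
    have : (x : ℂ).re + y * Complex.I.re = x := by simp
    rw [this]
    nlinarith [mul_nonneg hκ0 (neg_nonneg.2 hx0)]
  have hle : ∫ y in (0 : ℝ)..Real.pi, (f (x + y * Complex.I)).re ≤ ∫ y in (0 : ℝ)..Real.pi, -K := by
    refine intervalIntegral.integral_mono_on Real.pi_pos.le ?_ (by simp) hbound
    refine ContinuousOn.intervalIntegrable
      (Complex.continuous_re.comp_continuousOn (hfc.comp (by fun_prop) ?_))
    intro y hy
    rw [uIcc_of_le Real.pi_pos.le] at hy
    simpa using ⟨hy, hx⟩
  rw [hint x hx, intervalIntegral.integral_const, sub_zero, smul_eq_mul] at hle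
  have h1 := neg_abs_le C
  have h2 : 0 ≤ |C| := abs_nonneg C
  nlinarith [Real.pi_gt_three]

/-! ### The strip chart and injectivity on the closed disk. -/

/-- The holomorphic vector field on the unit disk whose flow is the one-parameter group of
automorphisms with repelling fixed point `p` and attracting fixed point `q`. -/
def diskField (p q z : ℂ) : ℂ := (z - p) * (q - z) / (q - p)

theorem diskField_ne_zero {p q z : ℂ} (hpq : p ≠ q) (hzp : z ≠ p) (hzq : z ≠ q) :
    diskField p q z ≠ 0 :=
  div_ne_zero (mul_ne_zero (sub_ne_zero.2 hzp) (sub_ne_zero.2 hzq.symm)) (sub_ne_zero.2 hpq.symm)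

/-- On the unit circle, the vector field is tangent to the circle. -/
theorem exists_diskField_eq {p q z : ℂ} (hp : ‖p‖ = 1) (hq : ‖q‖ = 1) (hpq : p ≠ q) (hz : ‖z‖ = 1) :
    ∃ r : ℝ, diskField p q z = r * (Complex.I * z) := by
  have hp0 : p ≠ 0 := by rintro rfl; simp at hp
  have hq0 : q ≠ 0 := by rintro rfl; simp at hq
  have hz0 : z ≠ 0 := by rintro rfl; simp at hz
  have hI : Complex.I * z ≠ 0 := mul_ne_zero Complex.I_ne_zero hz0
  have h1 : q - p ≠ 0 := sub_ne_zero.2 hpq.symm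
  have h2 : p - q ≠ 0 := sub_ne_zero.2 hpq
  have hreal : (starRingEnd ℂ) (diskField p q z / (Complex.I * z)) =
      diskField p q z / (Complex.I * z) := by
    simp only [diskField, map_div₀, map_mul, map_sub, Complex.conj_I, conj_eq_inv_of_norm_eq_one hp,
      conj_eq_inv_of_norm_eq_one hq, conj_eq_inv_of_norm_eq_one hz]
    have h3 : q⁻¹ - p⁻¹ = (p - q) / (p * q) := by field_simp
    rw [h3, ← neg_sub p q]
    field_simp
    ring
  obtain ⟨r, hr⟩ := Complex.conj_eq_iff_real.1 hreal
  exact ⟨r, by rw [← hr]; field_simp⟩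

section

variable {U : ℂ → ℂ} {p q : ℂ} (hp : ‖p‖ = 1) (hq : ‖q‖ = 1) (hpq : p ≠ q)

/-- The strip chart of the closed unit disk, which maps `∓∞` to `p` and `q`. -/
def stripMap (p q ζ : ℂ) : ℂ := diskMap p q (Complex.exp ζ)

include hp hq hpq

omit hpq in
theorem stripMap_mem_closedBall {ζ : ℂ} (hζ : ζ ∈ Complex.im ⁻¹' Icc 0 Real.pi) :
    stripMap p q ζ ∈ closedBall (0 : ℂ) 1 := by
  rw [mem_closedBall_zero_iff]
  exact norm_diskMap_le hp hq (exp_im_nonneg_of_mem_strip hζ)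

theorem stripMap_mem_ball {ζ : ℂ} (hζ : ζ ∈ Complex.im ⁻¹' Ioo 0 Real.pi) :
    stripMap p q ζ ∈ ball (0 : ℂ) 1 := by
  rw [mem_ball_zero_iff]
  exact norm_diskMap_lt hp hq hpq (exp_im_pos_of_mem_strip hζ)

theorem stripMap_ne_left {ζ : ℂ} (hζ : ζ ∈ Complex.im ⁻¹' Icc 0 Real.pi) :
    stripMap p q ζ ≠ p := by
  have h1 := diskMap_den_ne_zero hp hq hpq (exp_im_nonneg_of_mem_strip hζ)
  rw [← sub_ne_zero, stripMap, diskMap_sub_left h1]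
  exact div_ne_zero (mul_ne_zero (mul_ne_zero (sub_ne_zero.2 hpq.symm)
    (diskCoeff_ne_zero hq hpq)) (Complex.exp_ne_zero _)) h1

theorem stripMap_ne_right {ζ : ℂ} (hζ : ζ ∈ Complex.im ⁻¹' Icc 0 Real.pi) :
    stripMap p q ζ ≠ q := by
  have h1 := diskMap_den_ne_zero hp hq hpq (exp_im_nonneg_of_mem_strip hζ)
  rw [← sub_ne_zero, stripMap, diskMap_sub_right h1]
  exact div_ne_zero (sub_ne_zero.2 hpq) h1

/-- Horizontal translation of the strip corresponds to the flow of `diskField`, so the derivative of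
the chart is the field at the image point. -/
theorem hasDerivAt_stripMap {ζ : ℂ} (hζ : ζ ∈ Complex.im ⁻¹' Icc 0 Real.pi) :
    HasDerivAt (stripMap p q) (diskField p q (stripMap p q ζ)) ζ := by
  have h1 := diskMap_den_ne_zero hp hq hpq (exp_im_nonneg_of_mem_strip hζ)
  refine ((hasDerivAt_diskMap h1).comp ζ (Complex.hasDerivAt_exp ζ)).congr_deriv ?_
  have h2 : q - p ≠ 0 := sub_ne_zero.2 hpq.symm
  rw [diskField, stripMap, diskMap_sub_left h1, ← neg_sub (diskMap p q _) q, diskMap_sub_right h1]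
  field_simp
  ring

theorem exists_stripMap_eq {z : ℂ} (hz : ‖z‖ ≤ 1) (hzp : z ≠ p) (hzq : z ≠ q) :
    ∃ ζ ∈ Complex.im ⁻¹' Icc 0 Real.pi, stripMap p q ζ = z := by
  obtain ⟨w, hw0, hw, hwz⟩ := exists_diskMap_eq hp hq hpq hz hzp hzq
  refine ⟨Complex.log w, ?_, by rw [stripMap, Complex.exp_log hw0, hwz]⟩
  simp only [mem_preimage, Complex.log_im]
  exact ⟨Complex.arg_nonneg_iff.2 hw, Complex.arg_le_pi w⟩

theorem norm_stripMap_eq {ζ : ℂ} (hζ : ζ.im = 0 ∨ ζ.im = Real.pi) : ‖stripMap p q ζ‖ = 1 := by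
  refine norm_diskMap_eq hp hq hpq ?_
  rw [Complex.exp_im]
  rcases hζ with h | h <;> rw [h] <;> simp

theorem stripMap_add_injective {ζ : ℂ} (hζ : ζ ∈ Complex.im ⁻¹' Icc 0 Real.pi) :
    Function.Injective (fun t : ℝ => stripMap p q (ζ + t)) := by
  intro s t hst
  have hm : ∀ t : ℝ, ζ + t ∈ Complex.im ⁻¹' Icc 0 Real.pi := fun t => by simpa using hζ
  have h1 := fun t => diskMap_den_ne_zero hp hq hpq (exp_im_nonneg_of_mem_strip (hm t))
  have h2 := diskMap_sub_diskMap (h1 s) (h1 t)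
  simp only [stripMap] at hst
  rw [hst, sub_self, eq_comm, div_eq_zero_iff] at h2
  have h3 : Complex.exp (ζ + t) - Complex.exp (ζ + s) = 0 := by
    rcases h2 with h | h
    · rcases mul_eq_zero.1 h with h | h
      · exact absurd h (mul_ne_zero (sub_ne_zero.2 hpq.symm) (diskCoeff_ne_zero hq hpq))
      · exact h
    · exact absurd h (mul_ne_zero (h1 s) (h1 t))
  rw [Complex.exp_add, Complex.exp_add, ← mul_sub] at h3
  have h4 := (mul_eq_zero.1 h3).resolve_left (Complex.exp_ne_zero _)
  rw [sub_eq_zero, ← Complex.ofReal_exp, ← Complex.ofReal_exp, Complex.ofReal_inj] at h4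
  exact (Real.exp_injective h4).symm

variable (hc : ContinuousOn U (closedBall 0 1)) (hd : DifferentiableOn ℂ U (ball 0 1))
  (hmax : ∀ z ∈ closedBall (0 : ℂ) 1,
    (∀ᶠ w in 𝓝[closedBall 0 1] z, (U w).re ≤ (U z).re) → z = q)
  (hmin : ∀ z ∈ closedBall (0 : ℂ) 1,
    (∀ᶠ w in 𝓝[closedBall 0 1] z, (U z).re ≤ (U w).re) → z = p)

omit hp hq hpq in
include hc hmin in
-- A global minimum exists by compactness and every global minimum is a local one, hence equal to
-- `p`; no other point can attain the value.
theorem re_lt_of_unique_local_min {z : ℂ} (hz : z ∈ closedBall (0 : ℂ) 1) (hzp : z ≠ p) :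
    (U p).re < (U z).re := by
  obtain ⟨x, hx, hxmin⟩ := (isCompact_closedBall (0 : ℂ) 1).exists_isMinOn ⟨0, by simp⟩
    (Complex.continuous_re.comp_continuousOn hc)
  have hmin' : ∀ y ∈ closedBall (0 : ℂ) 1, (∀ w ∈ closedBall (0 : ℂ) 1, (U y).re ≤ (U w).re) →
      y = p := fun y hy h => hmin y hy (eventually_nhdsWithin_of_forall h)
  have hxp := hmin' x hx fun w hw => hxmin hw
  subst hxp
  refine lt_of_le_of_ne (hxmin hz) fun h => hzp (hmin' z hz fun w hw => ?_)
  rw [← h]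
  exact hxmin hw

omit hp hq hpq in
include hc hmax in
theorem re_lt_of_unique_local_max {z : ℂ} (hz : z ∈ closedBall (0 : ℂ) 1) (hzq : z ≠ q) :
    (U z).re < (U q).re := by
  have := re_lt_of_unique_local_min (U := fun z => -U z) (p := q) hc.neg
    (fun z hz h => hmax z hz (by simpa using h)) hz hzq
  simpa using this

omit hd in
include hc hmax hmin in
-- Translation by `t` multiplies the half plane coordinate by `exp t`. On a boundary line this
-- coordinate is real, so the point moves along its arc away from `p` towards `q`.
theorem re_stripMap_le {ζ : ℂ} (hζ : ζ.im = 0 ∨ ζ.im = Real.pi) {t : ℝ} (ht : 0 ≤ t) :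
    (U (stripMap p q ζ)).re ≤ (U (stripMap p q (ζ + t))).re := by
  rcases ht.eq_or_lt with rfl | ht
  · simp
  obtain ⟨e, he, hexp⟩ : ∃ e : ℝ, e ≠ 0 ∧ Complex.exp ζ = e := by
    rcases hζ with h | h
    · refine ⟨Real.exp ζ.re, (Real.exp_pos _).ne', ?_⟩
      rw [Complex.ofReal_exp]; congr 1; apply Complex.ext <;> simp [h]
    · refine ⟨-Real.exp ζ.re, by simp [Real.exp_ne_zero], ?_⟩
      rw [Complex.exp_eq_exp_re_mul_sin_add_cos, h]
      simp
  have h2 : Complex.exp (ζ + t) = ((e * Real.exp t : ℝ) : ℂ) := by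
    rw [Complex.exp_add, hexp]; simp
  rw [stripMap, stripMap, hexp, h2]
  refine le_of_unique_local_extrema hp hq hpq (h := fun z => (U z).re)
    (Complex.continuous_re.comp_continuousOn hc) hmax hmin he ?_
  have : (e * Real.exp t - e) / e = Real.exp t - 1 := by field_simp
  rw [this, sub_pos, Real.one_lt_exp_iff]
  exact ht

include hc in
theorem continuousOn_comp_stripMap :
    ContinuousOn (fun ζ => U (stripMap p q ζ)) (Complex.im ⁻¹' Icc 0 Real.pi) :=
  hc.comp (fun _ hζ => (hasDerivAt_stripMap hp hq hpq hζ).continuousAt.continuousWithinAt)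
    fun _ hζ => stripMap_mem_closedBall hp hq hζ

include hd in
theorem hasDerivAt_comp_stripMap {ζ : ℂ} (hζ : ζ ∈ Complex.im ⁻¹' Ioo 0 Real.pi) :
    HasDerivAt (fun ζ => U (stripMap p q ζ))
      (deriv U (stripMap p q ζ) * diskField p q (stripMap p q ζ)) ζ :=
  (hd.differentiableAt (isOpen_ball.mem_nhds (stripMap_mem_ball hp hq hpq hζ))).hasDerivAt.comp ζ
    (hasDerivAt_stripMap hp hq hpq (preimage_mono Ioo_subset_Icc_self hζ))

include hc hd hmax hmin

theorem re_deriv_comp_stripMap_pos {ζ : ℂ} (hζ : ζ ∈ Complex.im ⁻¹' Ioo 0 Real.pi) :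
    0 < (deriv (fun ζ => U (stripMap p q ζ)) ζ).re := by
  have hI := fun {ζ : ℂ} (h : ζ ∈ Complex.im ⁻¹' Ioo 0 Real.pi) =>
    preimage_mono (f := Complex.im) Ioo_subset_Icc_self h
  have hdF : DifferentiableOn ℂ (fun ζ => U (stripMap p q ζ)) (Complex.im ⁻¹' Ioo 0 Real.pi) :=
    fun ζ hζ =>
      (hasDerivAt_comp_stripMap hp hq hpq hd hζ).differentiableAt.differentiableWithinAt
  obtain ⟨M, hM⟩ := (isCompact_closedBall (0 : ℂ) 1).exists_bound_of_continuousOn hc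
  refine re_deriv_pos_of_strip hdF (fun ζ hζ t ht => ?_) (fun ζ hζ => ?_) hζ
  · exact re_le_re_add_of_strip (continuousOn_comp_stripMap hp hq hpq hc) hdF
      (fun ζ hζ => hM _ (stripMap_mem_closedBall hp hq hζ))
      (fun ζ hζ t ht => re_stripMap_le hp hq hpq hc hmax hmin hζ ht) (hI hζ) ht
  -- If `Re U` were constant on a horizontal line, letting the line run to `p` would give an
  -- interior point with the minimal value.
  · by_contra! hconst
    have hlim : Tendsto (fun t : ℝ => stripMap p q (ζ + t)) atBot (𝓝[closedBall 0 1] p) := by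
      refine tendsto_nhdsWithin_iff.2 ⟨?_, Eventually.of_forall fun t =>
        stripMap_mem_closedBall hp hq (by simpa using hI hζ)⟩
      have h0 : diskMap p q 0 = p := by simp [diskMap]
      have h1 : ContinuousAt (diskMap p q) 0 :=
        (hasDerivAt_diskMap (p := p) (q := q) (w := 0) (by simp)).continuousAt
      rw [ContinuousAt, h0] at h1
      refine h1.comp ?_
      have h2 : Tendsto (fun t : ℝ => ((Real.exp t : ℝ) : ℂ)) atBot (𝓝 ((0 : ℝ) : ℂ)) :=
        (Complex.continuous_ofReal.tendsto 0).comp Real.tendsto_exp_atBot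
      simpa [Complex.exp_add] using h2.const_mul (Complex.exp ζ)
    have hpm : p ∈ closedBall (0 : ℂ) 1 := by simp [hp]
    have h3 := (Complex.continuous_re.comp_continuousOn hc p hpm).tendsto.comp hlim
    have h4 : (U p).re = (U (stripMap p q ζ)).re := by
      refine tendsto_nhds_unique h3 ?_
      exact tendsto_const_nhds.congr fun t => (hconst t).symm
    exact (re_lt_of_unique_local_min hc hmin (stripMap_mem_closedBall hp hq (hI hζ))
      (stripMap_ne_left hp hq hpq (hI hζ))).ne h4

/-- This is the positivity of the derivative in the strip, transported to the disk by the chain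
rule; in this form it can be studied at the boundary. -/
theorem re_deriv_mul_diskField_pos {z : ℂ} (hz : z ∈ ball (0 : ℂ) 1) :
    0 < (deriv U z * diskField p q z).re := by
  have hz1 : ‖z‖ < 1 := by simpa using hz
  obtain ⟨ζ, hζ, rfl⟩ := exists_stripMap_eq hp hq hpq hz1.le (by rintro rfl; linarith)
    (by rintro rfl; linarith)
  have hζ' : ζ ∈ Complex.im ⁻¹' Ioo 0 Real.pi := by
    refine ⟨lt_of_le_of_ne hζ.1 fun h => ?_, lt_of_le_of_ne hζ.2 fun h => ?_⟩
    · exact hz1.ne (norm_stripMap_eq hp hq hpq (Or.inl h.symm))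
    · exact hz1.ne (norm_stripMap_eq hp hq hpq (Or.inr h))
  have := re_deriv_comp_stripMap_pos hp hq hpq hc hd hmax hmin hζ'
  rwa [(hasDerivAt_comp_stripMap hp hq hpq hd hζ').deriv] at this

omit hd in
-- Equality at two points would make `Re U` constant on the boundary segment between them. The
-- finitely many exceptional points cannot fill it, and elsewhere the tangential derivative of `Re
-- U` is nonzero.
theorem re_stripMap_lt {P : Set ℂ} (hP : P.Finite)
    (hbd : ∀ z : ℂ, ‖z‖ = 1 → z ∉ P → z ≠ p → z ≠ q →
      ∃ g, HasDerivWithinAt U g (sphere 0 1) z ∧ (g * (Complex.I * z)).re ≠ 0)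
    {ζ : ℂ} (hζ : ζ.im = 0 ∨ ζ.im = Real.pi) {t : ℝ} (ht : 0 < t) :
    (U (stripMap p q ζ)).re < (U (stripMap p q (ζ + t))).re := by
  have hs : ζ ∈ Complex.im ⁻¹' Icc 0 Real.pi := by
    rcases hζ with h | h <;> simp [h, Real.pi_pos.le]
  have hζ' : ∀ s : ℝ, (ζ + s).im = 0 ∨ (ζ + s).im = Real.pi := fun s => by simpa using hζ
  have hs' : ∀ s : ℝ, ζ + s ∈ Complex.im ⁻¹' Icc 0 Real.pi := fun s => by simpa using hs
  refine lt_of_le_of_ne (re_stripMap_le hp hq hpq hc hmax hmin hζ ht.le) fun heq => ?_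
  have hconst : ∀ s ∈ Ioo 0 t, (U (stripMap p q (ζ + s))).re = (U (stripMap p q ζ)).re := by
    intro s hs
    refine le_antisymm ?_ (re_stripMap_le hp hq hpq hc hmax hmin hζ hs.1.le)
    have := re_stripMap_le hp hq hpq hc hmax hmin (hζ' s) (sub_nonneg.2 hs.2.le)
    rw [heq]
    simpa [add_assoc] using this
  have hfin : ((fun s : ℝ => stripMap p q (ζ + s)) ⁻¹' P).Finite :=
    hP.preimage (stripMap_add_injective hp hq hpq hs).injOn
  obtain ⟨s, hst, hsP⟩ := (Ioo_infinite ht).exists_notMem_finite hfin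
  obtain ⟨g, hg, hgne⟩ := hbd (stripMap p q (ζ + s)) (norm_stripMap_eq hp hq hpq (hζ' s)) hsP
    (stripMap_ne_left hp hq hpq (hs' s)) (stripMap_ne_right hp hq hpq (hs' s))
  obtain ⟨r, hr⟩ := exists_diskField_eq hp hq hpq (norm_stripMap_eq hp hq hpq (hζ' s))
  have hX := diskField_ne_zero hpq (stripMap_ne_left hp hq hpq (hs' s))
    (stripMap_ne_right hp hq hpq (hs' s))
  have hr0 : r ≠ 0 := by
    rintro rfl
    rw [hr] at hX
    simp at hX
  have h1 : HasDerivAt (fun x : ℝ => stripMap p q (ζ + x)) (diskField p q (stripMap p q (ζ + s))) s := by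
    have h2 : HasDerivAt (fun x : ℂ => stripMap p q (ζ + x)) _ (s : ℂ) :=
      (hasDerivAt_stripMap hp hq hpq (hs' s)).comp_const_add ζ (s : ℂ)
    exact h2.comp_ofReal
  have h3 : HasDerivAt (fun x : ℝ => U (stripMap p q (ζ + x)))
      (diskField p q (stripMap p q (ζ + s)) • g) s := by
    rw [← hasDerivWithinAt_univ] at h1 ⊢
    exact HasDerivWithinAt.scomp (t' := sphere (0 : ℂ) 1) s hg h1 fun x _ => by
      simpa using norm_stripMap_eq hp hq hpq (hζ' x)
  have h4 : HasDerivAt (fun x : ℝ => (U (stripMap p q (ζ + x))).re)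
      (diskField p q (stripMap p q (ζ + s)) • g).re s :=
    Complex.reCLM.hasFDerivAt.comp_hasDerivAt s h3
  have h5 : HasDerivAt (fun x : ℝ => (U (stripMap p q (ζ + x))).re) 0 s := by
    refine (hasDerivAt_const s ((U (stripMap p q ζ)).re)).congr_of_eventuallyEq ?_
    filter_upwards [Ioo_mem_nhds hst.1 hst.2] with x hx using hconst x hx
  have h6 := h4.unique h5
  rw [hr, smul_eq_mul, mul_comm, ← mul_assoc, mul_comm g, mul_assoc, Complex.re_ofReal_mul] at h6
  exact hgne ((mul_eq_zero.1 h6).resolve_left hr0)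

/-- A holomorphic function on the disk, continuous up to the boundary, whose real part has only two
local extrema on the closed disk, is injective on the closed disk. -/
theorem injOn_of_unique_local_extrema {P : Set ℂ} (hP : P.Finite)
    (hbd : ∀ z : ℂ, ‖z‖ = 1 → z ∉ P → z ≠ p → z ≠ q →
      ∃ g, HasDerivWithinAt U g (sphere 0 1) z ∧ (g * (Complex.I * z)).re ≠ 0) :
    InjOn U (closedBall 0 1) := by
  intro z hz z' hz' heq
  by_contra hne
  have hzp : z ≠ p := by
    rintro rfl
    exact (re_lt_of_unique_local_min hc hmin hz' (Ne.symm hne)).ne (by rw [heq])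
  have hzp' : z' ≠ p := by
    rintro rfl
    exact (re_lt_of_unique_local_min hc hmin hz hne).ne (by rw [heq])
  have hzq : z ≠ q := by
    rintro rfl
    exact (re_lt_of_unique_local_max hc hmax hz' (Ne.symm hne)).ne (by rw [heq])
  have hzq' : z' ≠ q := by
    rintro rfl
    exact (re_lt_of_unique_local_max hc hmax hz hne).ne (by rw [heq])
  obtain ⟨ζ, hζ, rfl⟩ := exists_stripMap_eq hp hq hpq (mem_closedBall_zero_iff.1 hz) hzp hzq
  obtain ⟨ξ, hξ, rfl⟩ := exists_stripMap_eq hp hq hpq (mem_closedBall_zero_iff.1 hz') hzp' hzq'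
  have hζξ : ζ ≠ ξ := fun h => hne (by rw [h])
  refine ne_of_re_deriv_pos_of_strip (F := fun ζ => U (stripMap p q ζ))
    (continuousOn_comp_stripMap hp hq hpq hc)
    (fun ζ hζ =>
      (hasDerivAt_comp_stripMap hp hq hpq hd hζ).differentiableAt.differentiableWithinAt)
    (fun ζ hζ => re_deriv_comp_stripMap_pos hp hq hpq hc hd hmax hmin hζ) hζ hξ hζξ
    (fun him => ?_) heq
  -- The only case left open by the convexity argument: both points on one boundary line, where
  -- strict monotonicity of the real part applies.
  by_contra hnot
  have hbdry : ζ.im = 0 ∨ ζ.im = Real.pi := by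
    by_contra! hcon
    exact hnot ⟨lt_of_le_of_ne hζ.1 hcon.1.symm, lt_of_le_of_ne hζ.2 hcon.2⟩
  have hlt : ∀ a b : ℂ, (a.im = 0 ∨ a.im = Real.pi) → a.im = b.im → a.re < b.re →
      (U (stripMap p q a)).re < (U (stripMap p q b)).re := by
    intro a b ha hab hre
    have := re_stripMap_lt hp hq hpq hc hmax hmin hP hbd ha (sub_pos.2 hre)
    have hb : a + ((b.re - a.re : ℝ) : ℂ) = b := by apply Complex.ext <;> simp [hab]
    rwa [hb] at this
  rcases lt_trichotomy ζ.re ξ.re with h | h | h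
  · exact (hlt ζ ξ hbdry him h).ne (by rw [heq])
  · exact hζξ (Complex.ext h him)
  · exact (hlt ξ ζ (by rwa [← him]) him.symm h).ne (by rw [heq])

end

/-! ### Counting the vertical moments of an angle function. -/

theorem eventually_sign_of_hasDerivAt {f : ℝ → ℝ} {f' x : ℝ} (h : HasDerivAt f f' x) (h0 : f' ≠ 0) :
    ∀ᶠ y in 𝓝[≠] x, 0 < f' * (f y - f x) * (y - x) := by
  have h1 : Tendsto (fun y => f' * slope f x y) (𝓝[≠] x) (𝓝 (f' * f')) :=
    (hasDerivAt_iff_tendsto_slope.1 h).const_mul f'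
  filter_upwards [h1.eventually (lt_mem_nhds (mul_self_pos.2 h0)), self_mem_nhdsWithin] with y hy hne
  have h2 : y - x ≠ 0 := sub_ne_zero.2 hne
  rw [slope_def_field] at hy
  have h3 : f' * (f y - f x) * (y - x) = f' * ((f y - f x) / (y - x)) * (y - x) ^ 2 := by
    field_simp
  rw [h3]
  positivity

/-- A continuous function which crosses the level `l` only upwards stays above `l`. -/
theorem lt_of_upward_crossings {φ : ℝ → ℝ} {a b l : ℝ} (hc : ContinuousOn φ (Icc a b))
    (hb : φ b ≠ l) (hup : ∀ s ∈ Ioo a b, φ s = l → ∀ᶠ t in 𝓝[<] s, φ t < φ s)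
    {s t : ℝ} (hs : a ≤ s) (hst : s ≤ t) (ht : t ≤ b) (hsl : l < φ s) : l < φ t := by
  by_contra! htl
  have hc' : ContinuousOn φ (Icc s t) := hc.mono (Icc_subset_Icc hs ht)
  have hK : IsCompact (Icc s t ∩ φ ⁻¹' Iic l) :=
    isCompact_Icc.of_isClosed_subset (hc'.preimage_isClosed_of_isClosed isClosed_Icc isClosed_Iic)
      inter_subset_left
  -- At the first time `r` with `φ r ≤ l` the value is exactly `l`, approached from above, contrary
  -- to the upward crossing.
  obtain ⟨r, ⟨hr, hrl⟩, hmin⟩ := hK.exists_isLeast ⟨t, ⟨hst, le_rfl⟩, htl⟩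
  have hrl' : φ r ≤ l := hrl
  have hsr : s < r := lt_of_le_of_ne hr.1 fun h => by rw [h] at hsl; linarith
  have hbefore : ∀ x ∈ Ioo s r, l < φ x := fun x hx => by
    by_contra! hxl
    exact (hmin ⟨⟨hx.1.le, hx.2.le.trans hr.2⟩, hxl⟩).not_gt hx.2
  have hev : ∀ᶠ x in 𝓝[<] r, l < φ x := by
    filter_upwards [Ioo_mem_nhdsLT hsr] with x hx using hbefore x hx
  have hrl2 : φ r = l := by
    refine le_antisymm hrl' ?_
    have h1 : Tendsto φ (𝓝[<] r) (𝓝 (φ r)) := by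
      have hsub : Ioo s r ⊆ Icc s t := fun x hx => ⟨hx.1.le, hx.2.le.trans hr.2⟩
      have h2 := (hc' r hr).mono hsub
      rwa [ContinuousWithinAt, nhdsWithin_Ioo_eq_nhdsLT hsr] at h2
    exact ge_of_tendsto h1 (hev.mono fun x hx => hx.le)
  have hrb : r < b := lt_of_le_of_ne (hr.2.trans ht) fun h => hb (h ▸ hrl2)
  obtain ⟨x, hx1, hx2⟩ := (hev.and (hup r ⟨hs.trans_lt hsr, hrb⟩ hrl2)).exists
  linarith

/-- The number of vertical moments of an angle function which passes the vertical angles only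
upwards, in terms of its values at the ends, where it is an angle of a line of slope `±1`. -/
theorem card_vertical_le {φ : ℝ → ℝ} {a b : ℝ} (hab : a < b) (hc : ContinuousOn φ (Icc a b))
    (hup : ∀ s ∈ Ioo a b, Real.cos (φ s) = 0 →
      (∀ᶠ t in 𝓝[>] s, φ s < φ t) ∧ ∀ᶠ t in 𝓝[<] s, φ t < φ s)
    {d e : ℝ} (hd : d = 1 ∨ d = -1) (he : e = 1 ∨ e = -1)
    (hda : Real.sin (φ a) = d * Real.cos (φ a)) (heb : Real.sin (φ b) = e * Real.cos (φ b)) :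
    {s ∈ Ioo a b | Real.cos (φ s) = 0}.Finite ∧
      Real.pi * {s ∈ Ioo a b | Real.cos (φ s) = 0}.ncard + (e - d) * (Real.pi / 4) ≤ φ b - φ a := by
  have hpi := Real.pi_pos
  have hform : ∀ d x : ℝ, (d = 1 ∨ d = -1) → Real.sin x = d * Real.cos x →
      ∃ n : ℤ, x = n * Real.pi + d * (Real.pi / 4) := by
    intro d x hd hx
    have : Real.sin (x - d * (Real.pi / 4)) = 0 := by
      rw [Real.sin_sub, hx]
      rcases hd with rfl | rfl
      · simp
      · simp [Real.cos_neg, Real.sin_neg]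
    obtain ⟨n, hn⟩ := Real.sin_eq_zero_iff.1 this
    exact ⟨n, by linarith⟩
  obtain ⟨na, hna⟩ := hform d _ hd hda
  obtain ⟨nb, hnb⟩ := hform e _ he heb
  -- The vertical angles. The end values are `na * π + d * π / 4` and `nb * π + e * π / 4`, off
  -- these levels by less than half a period.
  set l : ℤ → ℝ := fun n => (2 * n + 1) * Real.pi / 2 with hl
  have hcosl : ∀ n, Real.cos (l n) = 0 := fun n => Real.cos_eq_zero_iff.2 ⟨n, rfl⟩
  have hd1 : -1 ≤ d ∧ d ≤ 1 := by rcases hd with rfl | rfl <;> norm_num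
  have he1 : -1 ≤ e ∧ e ≤ 1 := by rcases he with rfl | rfl <;> norm_num
  have hlt_a : ∀ n : ℤ, l n < φ a ↔ n < na := by
    intro n
    rw [hna, hl]
    constructor
    · intro h
      by_contra! hn
      have : (na : ℝ) ≤ n := by exact_mod_cast hn
      nlinarith
    · intro h
      have : (n : ℝ) + 1 ≤ na := by exact_mod_cast h
      simp only
      nlinarith
  have hlt_b : ∀ n : ℤ, l n < φ b ↔ n < nb := by
    intro n
    rw [hnb, hl]
    constructor
    · intro h
      by_contra! hn
      have : (nb : ℝ) ≤ n := by exact_mod_cast hn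
      nlinarith
    · intro h
      have : (n : ℝ) + 1 ≤ nb := by exact_mod_cast h
      simp only
      nlinarith
  have hsc : ∀ x d : ℝ, Real.sin x = d * Real.cos x → Real.cos x ≠ 0 := fun x d h h0 => by
    have := Real.sin_sq_add_cos_sq x
    rw [h, h0] at this
    norm_num at this
  have hne_b : ∀ n, φ b ≠ l n := fun n h => hsc _ _ heb (by rw [h]; exact hcosl n)
  have hne_a : ∀ n, φ a ≠ l n := fun n h => hsc _ _ hda (by rw [h]; exact hcosl n)
  have habove : ∀ n : ℤ, ∀ s t : ℝ, a ≤ s → s ≤ t → t ≤ b → l n < φ s → l n < φ t :=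
    fun n s t hs hst ht h => lt_of_upward_crossings hc (hne_b n)
      (fun s hs hsl => (hup s hs (by rw [hsl]; exact hcosl n)).2) hs hst ht h
  have hafter : ∀ n : ℤ, ∀ s t : ℝ, s ∈ Ioo a b → s < t → t ≤ b → φ s = l n → l n < φ t := by
    intro n s t hs hst ht h
    obtain ⟨x, hx, hx1⟩ := ((hup s hs (by rw [h]; exact hcosl n)).1.and
      (Ioo_mem_nhdsGT hst)).exists
    exact habove n x t (hs.1.trans hx1.1).le hx1.2.le ht (h ▸ hx)
  set T := {s ∈ Ioo a b | Real.cos (φ s) = 0} with hT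
  have hlev : ∀ s ∈ T, ∃ n : ℤ, φ s = l n := fun s hs => Real.cos_eq_zero_iff.1 hs.2
  choose! n hn using hlev
  have hinj : InjOn n T := by
    intro s hs t ht hst
    rcases lt_trichotomy s t with h | h | h
    · have := hafter _ s t hs.1 h ht.1.2.le (hn s hs)
      rw [hn t ht, hst] at this
      exact absurd this (lt_irrefl _)
    · exact h
    · have := hafter _ t s ht.1 h hs.1.2.le (hn t ht)
      rw [hn s hs, hst] at this
      exact absurd this (lt_irrefl _)
  -- A level below `φ a` has been passed at the start, and a level that is met stays below `φ b`; so
  -- only levels with index in `[na, nb)` occur.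
  have hmaps : MapsTo n T (Finset.Ico na nb : Set ℤ) := by
    intro s hs
    rw [Finset.coe_Ico]
    constructor
    · by_contra! h
      have := habove _ a s le_rfl hs.1.1.le hs.1.2.le ((hlt_a _).2 h)
      rw [hn s hs] at this
      exact lt_irrefl _ this
    · exact (hlt_b _).1 (hafter _ s b hs.1 hs.1.2 le_rfl (hn s hs))
  have hle : na ≤ nb := by
    by_contra! h
    have h1 := habove (nb) a b le_rfl hab.le le_rfl ((hlt_a _).2 h)
    exact lt_irrefl _ ((hlt_b _).1 h1)
  have hfin : T.Finite := Finite.of_injOn hmaps hinj (Finset.finite_toSet _)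
  refine ⟨hfin, ?_⟩
  have hcard : T.ncard ≤ (Finset.Ico na nb).card := by
    have := ncard_le_ncard_of_injOn n hmaps hinj (Finset.finite_toSet _)
    rwa [ncard_coe_finset] at this
  rw [Int.card_Ico] at hcard
  have h1 : (T.ncard : ℤ) ≤ nb - na := by
    rw [← Int.toNat_of_nonneg (sub_nonneg.2 hle)]
    exact_mod_cast hcard
  have h2 : (T.ncard : ℝ) ≤ nb - na := by exact_mod_cast h1
  rw [hna, hnb]
  nlinarith

/-! ### Local geometry of the link and its projection. -/

namespace LegendrianLink

variable (L : LegendrianLink)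

theorem continuous_param (i : Fin L.numComp) : Continuous (L.param i) := (L.smooth i).continuous

theorem hasDerivAt_param (i : Fin L.numComp) (s : ℝ) :
    HasDerivAt (L.param i) (deriv (L.param i) s) s :=
  ((L.smooth i).differentiable (by simp) s).hasDerivAt

theorem hasDerivAt_snd (i : Fin L.numComp) (s : ℝ) :
    HasDerivAt (fun s => (L.param i s).2) (deriv (L.param i) s).2 s :=
  (ContinuousLinearMap.snd ℝ ℝ ℂ).hasFDerivAt.comp_hasDerivAt s (L.hasDerivAt_param i s)

theorem hasDerivAt_xCoord (i : Fin L.numComp) (s : ℝ) :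
    HasDerivAt (L.xCoord i) (deriv (L.param i) s).2.re s :=
  Complex.reCLM.hasFDerivAt.comp_hasDerivAt s (L.hasDerivAt_snd i s)

theorem hasDerivAt_yCoord (i : Fin L.numComp) (s : ℝ) :
    HasDerivAt (fun s => (L.param i s).2.im) (deriv (L.param i) s).2.im s :=
  Complex.imCLM.hasFDerivAt.comp_hasDerivAt s (L.hasDerivAt_snd i s)

theorem deriv_snd_ne_zero (i : Fin L.numComp) (s : ℝ) : (deriv (L.param i) s).2 ≠ 0 := by
  intro h
  have h1 := L.legendrian i s
  simp only [stdContactForm, h, Complex.zero_re, mul_zero, sub_zero] at h1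
  exact L.regular i s (Prod.ext h1 h)

theorem contDiff_deriv_param (i : Fin L.numComp) : ContDiff ℝ ∞ (deriv (L.param i)) := by
  have := L.smooth i
  exact (contDiff_infty_iff_deriv.1 this).2

theorem hasDerivAt_deriv_xCoord (i : Fin L.numComp) (s : ℝ) :
    HasDerivAt (fun s => (deriv (L.param i) s).2.re) (deriv (deriv (L.xCoord i)) s) s := by
  have h1 : deriv (L.xCoord i) = fun s => (deriv (L.param i) s).2.re :=
    funext fun s => (L.hasDerivAt_xCoord i s).deriv
  rw [h1]
  have h2 : Differentiable ℝ (fun s => (deriv (L.param i) s).2.re) := by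
    have h3 := (L.contDiff_deriv_param i).differentiable (by simp)
    exact Complex.reCLM.differentiable.comp h3.snd
  exact (h2 s).hasDerivAt

theorem isCompact_carrier : IsCompact L.carrier := by
  have h : L.carrier = ⋃ i, L.param i '' Icc 0 1 := by
    ext P
    simp only [carrier, mem_ofPred_eq, mem_iUnion, mem_image]
    constructor
    · rintro ⟨i, s, rfl⟩
      obtain ⟨t, ht, hst⟩ := (L.periodic i).exists_mem_Ico₀ one_pos s
      exact ⟨i, t, Ico_subset_Icc_self ht, hst.symm⟩
    · rintro ⟨i, s, -, rfl⟩
      exact ⟨i, s, rfl⟩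
  rw [h]
  exact isCompact_iUnion fun i => isCompact_Icc.image (L.continuous_param i)

/-- Near one of its points, the link consists of a single strand. -/
theorem eventually_exists_param_eq (i : Fin L.numComp) (s : ℝ) {ε : ℝ} (hε : 0 < ε) :
    ∀ᶠ P in 𝓝[L.carrier] (L.param i s), ∃ r, |r - s| < ε ∧ L.param i r = P := by
  -- The rest of the link: all other components, and one period of this component without the
  -- parameters within `ε` of `s`. It is compact and misses the point by embeddedness.
  set K : Set (ℝ × ℂ) := ⋃ j, L.param j '' (if j = i then Icc (s + ε) (s + 1 - ε) else Icc 0 1)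
    with hK
  have hKc : IsCompact K := by
    refine isCompact_iUnion fun j => IsCompact.image ?_ (L.continuous_param j)
    split_ifs <;> exact isCompact_Icc
  have hsK : L.param i s ∉ K := by
    rw [hK, mem_iUnion]
    rintro ⟨j, r, hr, hrs⟩
    obtain ⟨rfl, k, hk⟩ := L.embedded _ _ _ _ hrs.symm
    rw [if_pos rfl] at hr
    have h1 : (0 : ℝ) < k := by linarith [hr.1]
    have h2 : (k : ℝ) < 1 := by linarith [hr.2]
    have h3 : (0 : ℤ) < k := by exact_mod_cast h1
    have h4 : k < 1 := by exact_mod_cast h2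
    omega
  filter_upwards [self_mem_nhdsWithin, mem_nhdsWithin_of_mem_nhds
    (hKc.isClosed.isOpen_compl.mem_nhds hsK)] with P hP hPK
  obtain ⟨j, r, rfl⟩ := hP
  by_cases hj : j = i
  · subst hj
    obtain ⟨t, ht, hrt⟩ := (L.periodic j).exists_mem_Ioc one_pos r (s - ε)
    refine ⟨t, ?_, hrt.symm⟩
    by_contra! habs
    apply hPK
    rw [hK, mem_iUnion]
    refine ⟨j, t, ?_, hrt.symm⟩
    rw [if_pos rfl]
    have h1 : s + ε ≤ t := by
      by_contra! h
      exact habs.not_gt (abs_lt.2 ⟨by linarith [ht.1], by linarith⟩)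
    exact ⟨h1, by linarith [ht.2]⟩
  · exfalso
    apply hPK
    rw [hK, mem_iUnion]
    obtain ⟨t, ht, hrt⟩ := (L.periodic j).exists_mem_Ico₀ one_pos r
    refine ⟨j, t, ?_, hrt.symm⟩
    rw [if_neg hj]
    exact Ico_subset_Icc_self ht

/-- If `f` holds along the link near all points over `q`, it holds near the fibre over `q`. -/
theorem eventually_of_fibre {q : ℂ} {f : ℝ × ℂ → Prop}
    (h : ∀ P ∈ L.carrier, P.2 = q → ∀ᶠ Q in 𝓝[L.carrier] P, f Q) :
    ∀ᶠ z in 𝓝 q, ∀ P ∈ L.carrier, P.2 = z → f P := by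
  -- The closure of the bad points is compact and avoids the fibre, so its projection is a closed
  -- set missing `q`.
  set K : Set (ℝ × ℂ) := closure {P ∈ L.carrier | ¬ f P} with hK
  have hKL : K ⊆ L.carrier :=
    closure_minimal (fun P hP => hP.1) L.isCompact_carrier.isClosed
  have hKc : IsCompact K := L.isCompact_carrier.of_isClosed_subset isClosed_closure hKL
  have hq : q ∉ Prod.snd '' K := by
    rintro ⟨P, hP, hPq⟩
    have h1 := h P (hKL hP) hPq
    rw [eventually_nhdsWithin_iff] at h1
    obtain ⟨Q, hQ, hQf⟩ := ((mem_closure_iff_frequently.1 hP).and_eventually h1).exists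
    exact hQ.2 (hQf hQ.1)
  filter_upwards [(hKc.image continuous_snd).isClosed.isOpen_compl.mem_nhds hq] with z hz P hP hPz
  by_contra hf
  exact hz ⟨P, subset_closure ⟨hP, hf⟩, hPz⟩

variable {L}

/-- Near a self-intersection, the projected link runs along two lines of slope `±1`. -/
theorem GoodPosition.eventually_slope (hL : L.GoodPosition) {q : ℂ} (hq : q ∈ L.doublePoints) :
    ∀ᶠ z in 𝓝 q, ∀ P ∈ L.carrier, P.2 = z → ∃ e : ℝ, (e = 1 ∨ e = -1) ∧
      z.im - q.im = e * (z.re - q.re) ∧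
      ∀ φ, L.IsTangentAngle P φ → Real.sin φ = e * Real.cos φ := by
  obtain ⟨i, s, j, r, -, -, -, hfib, h1, h2⟩ := hL q hq
  have key : ∀ (i : Fin L.numComp) (s e : ℝ), (e = 1 ∨ e = -1) →
      (∀ᶠ s' in 𝓝 s, (L.param i s').2.im - q.im = e * ((L.param i s').2.re - q.re)) →
      ∀ᶠ P in 𝓝[L.carrier] (L.param i s), ∃ e : ℝ, (e = 1 ∨ e = -1) ∧
      P.2.im - q.im = e * (P.2.re - q.re) ∧
      ∀ φ, L.IsTangentAngle P φ → Real.sin φ = e * Real.cos φ := by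
    intro i s e he hev
    obtain ⟨ε, hε, hball⟩ := Metric.eventually_nhds_iff.1 hev.eventually_nhds
    filter_upwards [L.eventually_exists_param_eq i s hε] with P hP
    obtain ⟨t, ht, rfl⟩ := hP
    have hline := hball ht
    refine ⟨e, he, hline.self_of_nhds, fun φ hφ => ?_⟩
    obtain ⟨c, hc⟩ := hφ i t rfl
    have hd : (deriv (L.param i) t).2.im = e * (deriv (L.param i) t).2.re := by
      have d1 := (L.hasDerivAt_yCoord i t).sub_const q.im
      have d2 := ((L.hasDerivAt_xCoord i t).sub_const q.re).const_mul e
      exact d1.unique (d2.congr_of_eventuallyEq hline)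
    have hc0 : c ≠ 0 := by
      rintro rfl
      exact L.deriv_snd_ne_zero i t (by rw [hc]; simp)
    rw [hc, Complex.im_ofReal_mul, Complex.re_ofReal_mul, Complex.exp_ofReal_mul_I_re,
      Complex.exp_ofReal_mul_I_im] at hd
    apply mul_left_cancel₀ hc0
    linear_combination hd
  have := L.eventually_of_fibre (q := q) (f := fun P => ∃ e : ℝ, (e = 1 ∨ e = -1) ∧
      P.2.im - q.im = e * (P.2.re - q.re) ∧
      ∀ φ, L.IsTangentAngle P φ → Real.sin φ = e * Real.cos φ) (fun P hP hPq => by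
    rcases hfib P hP hPq with rfl | rfl
    · exact key i s (-1) (Or.inr rfl) (h1.mono fun t ht => by rw [ht]; ring)
    · exact key j r 1 (Or.inl rfl) (h2.mono fun t ht => by rw [ht]; ring))
  filter_upwards [this] with z hz P hP hPz
  obtain ⟨e, he, h3, h4⟩ := hz P hP hPz
  exact ⟨e, he, hPz ▸ h3, h4⟩

theorem exists_global_max_xCoord (i : Fin L.numComp) :
    ∃ s, ∀ t, L.xCoord i t ≤ L.xCoord i s := by
  have hcont : Continuous (L.xCoord i) := by
    unfold xCoord
    exact Complex.continuous_re.comp (continuous_snd.comp (L.continuous_param i))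
  obtain ⟨s, -, hs⟩ := (isCompact_Icc (a := (0 : ℝ)) (b := 1)).exists_isMaxOn ⟨0, by simp⟩
    hcont.continuousOn
  refine ⟨s, fun t => ?_⟩
  obtain ⟨t', ht', htt⟩ := (L.periodic i).exists_mem_Ico₀ one_pos t
  have : L.xCoord i t = L.xCoord i t' := by simp only [xCoord, htt]
  rw [this]
  exact hs (Ico_subset_Icc_self ht')

theorem exists_global_min_xCoord (i : Fin L.numComp) :
    ∃ s, ∀ t, L.xCoord i s ≤ L.xCoord i t := by
  have hcont : Continuous (L.xCoord i) := by
    unfold xCoord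
    exact Complex.continuous_re.comp (continuous_snd.comp (L.continuous_param i))
  obtain ⟨s, -, hs⟩ := (isCompact_Icc (a := (0 : ℝ)) (b := 1)).exists_isMinOn ⟨0, by simp⟩
    hcont.continuousOn
  refine ⟨s, fun t => ?_⟩
  obtain ⟨t', ht', htt⟩ := (L.periodic i).exists_mem_Ico₀ one_pos t
  have : L.xCoord i t = L.xCoord i t' := by simp only [xCoord, htt]
  rw [this]
  exact hs (Ico_subset_Icc_self ht')

/-- In a left-right-simple link, the points with a vertical tangent are exactly the leftmost and the
rightmost points. -/
theorem LeftRightSimple.of_vertical (hL : L.LeftRightSimple) {i : Fin L.numComp} {s : ℝ}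
    (hv : (deriv (L.param i) s).2.re = 0) :
    (deriv (deriv (L.xCoord i)) s < 0 ∧ ∀ P ∈ L.carrier, P.2.re ≤ (L.param i s).2.re) ∨
    (0 < deriv (deriv (L.xCoord i)) s ∧ ∀ P ∈ L.carrier, (L.param i s).2.re ≤ P.2.re) := by
  have hd : deriv (L.xCoord i) s = 0 := by rw [(L.hasDerivAt_xCoord i s).deriv, hv]
  have hca := (L.hasDerivAt_xCoord i s).continuousAt
  rcases lt_or_gt_of_ne (hL.morse i s hd) with h | h
  · refine Or.inl ⟨h, ?_⟩
    obtain ⟨xR, hR⟩ := hL.right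
    rintro P ⟨j, t, rfl⟩
    -- The maximum of `x` on any component is a local maximum, as is the vertical point, so both
    -- have the common value `xR`.
    obtain ⟨m, hm⟩ := exists_global_max_xCoord (L := L) j
    have h1 := hR j m (Eventually.of_forall hm)
    have h2 := hR i s (isLocalMax_of_deriv_deriv_neg h hd hca)
    have h3 := hm t
    rw [h1, ← h2] at h3
    exact h3
  · refine Or.inr ⟨h, ?_⟩
    obtain ⟨xR, hR⟩ := hL.left
    rintro P ⟨j, t, rfl⟩
    obtain ⟨m, hm⟩ := exists_global_min_xCoord (L := L) j
    have h1 := hR j m (Eventually.of_forall hm)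
    have h2 := hR i s (isLocalMin_of_deriv_deriv_pos h hd hca)
    have h3 := hm t
    rw [h1, ← h2] at h3
    exact h3

/-- The velocity of a path in the projected link which lifts to the link is tangent to the link. -/
theorem exists_velocity_eq {τ : ℝ → ℝ} {w : ℝ → ℂ} {s φ : ℝ} {w' : ℂ} (hτ : ContinuousAt τ s)
    (hw : HasDerivAt w w' s) (hcar : ∀ᶠ t in 𝓝 s, (τ t, w t) ∈ L.carrier)
    (hφ : L.IsTangentAngle (τ s, w s) φ) : ∃ ρ : ℝ, w' = ρ * Complex.exp (φ * Complex.I) := by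
  obtain ⟨i, r, hr⟩ := hcar.self_of_nhds
  obtain ⟨c, hc⟩ := hφ i r hr
  have hc0 : c ≠ 0 := by
    rintro rfl
    exact L.deriv_snd_ne_zero i r (by rw [hc]; simp)
  have hcn : 0 < |c| := abs_pos.2 hc0
  have hlift : Tendsto (fun t => (τ t, w t)) (𝓝 s) (𝓝[L.carrier] (L.param i r)) := by
    refine tendsto_nhdsWithin_iff.2 ⟨?_, hcar⟩
    rw [hr]
    exact hτ.prodMk hw.continuousAt
  have hEn : ∀ x : ℝ, ‖Complex.exp (-(x * Complex.I))‖ = 1 := fun x => by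
    rw [← neg_mul, ← Complex.ofReal_neg, Complex.norm_exp_ofReal_mul_I]
  have hsmall : ∀ η > 0, |(w' * Complex.exp (-(φ * Complex.I))).im| ≤ η * ‖w'‖ := by
    intro η hη
    -- The first bound gives `|c| / 2 * |x - r| ≤ ‖Δ‖` for the chord `Δ`; the second then makes the
    -- deviation of the chord from the tangent line at most `η * ‖Δ‖`.
    set δ := min (|c| / 2) (η * |c| / 2) with hδ
    have hδ0 : 0 < δ := by positivity
    have hlo := (hasDerivAt_iff_isLittleO.1 (L.hasDerivAt_snd i r)).def hδ0
    obtain ⟨ε, hε, hball⟩ := Metric.eventually_nhds_iff.1 hlo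
    have hev : ∀ᶠ t in 𝓝 s, |((w t - w s) * Complex.exp (-(φ * Complex.I))).im| ≤
        η * ‖w t - w s‖ := by
      filter_upwards [hlift.eventually (L.eventually_exists_param_eq i r hε)] with t ht
      obtain ⟨x, hx, hxt⟩ := ht
      have h1 := hball (y := x) hx
      have e1 : w t = (L.param i x).2 := by rw [hxt]
      have e2 : w s = (L.param i r).2 := by rw [hr]
      rw [e1, e2]
      set Δ := (L.param i x).2 - (L.param i r).2
      rw [hc] at h1
      set E := Δ - (x - r) • (c * Complex.exp (φ * Complex.I)) with hE
      have hΔ : Δ = E + (x - r) • (c * Complex.exp (φ * Complex.I)) := by rw [hE]; ring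
      have h2 : (Δ * Complex.exp (-(φ * Complex.I))).im = (E * Complex.exp (-(φ * Complex.I))).im := by
        rw [hΔ, add_mul, Complex.add_im, Complex.real_smul, mul_assoc, mul_assoc, ← Complex.exp_add,
          add_neg_cancel, Complex.exp_zero, mul_one, ← Complex.ofReal_mul, Complex.ofReal_im,
          add_zero]
      have h3 : |(E * Complex.exp (-(φ * Complex.I))).im| ≤ ‖E‖ := by
        refine (Complex.abs_im_le_norm _).trans ?_
        rw [norm_mul, hEn, mul_one]
      have h4 : |c| * |x - r| - ‖E‖ ≤ ‖Δ‖ := by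
        have h5 : ‖(x - r) • ((c : ℂ) * Complex.exp (φ * Complex.I))‖ = |c| * |x - r| := by
          rw [norm_smul, norm_mul, Complex.norm_exp_ofReal_mul_I, Complex.norm_real,
            Real.norm_eq_abs, Real.norm_eq_abs]; ring
        rw [← h5]
        have : (x - r) • ((c : ℂ) * Complex.exp (φ * Complex.I)) = Δ - E := by rw [hE]; ring
        rw [this]
        linarith [norm_sub_le Δ E]
      rw [Real.norm_eq_abs] at h1
      rw [h2]
      refine h3.trans (h1.trans ?_)
      have h6 : δ ≤ |c| / 2 := min_le_left _ _
      have h7 : δ ≤ η * |c| / 2 := min_le_right _ _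
      have h8 := abs_nonneg (x - r)
      have h9 : |c| / 2 * |x - r| ≤ ‖Δ‖ := by nlinarith
      nlinarith
    have hsl := hasDerivAt_iff_tendsto_slope.1 hw
    have t1 : Tendsto (fun t => |(slope w s t * Complex.exp (-(φ * Complex.I))).im|) (𝓝[≠] s)
        (𝓝 |(w' * Complex.exp (-(φ * Complex.I))).im|) :=
      (Complex.continuous_im.tendsto _).comp (hsl.mul_const _) |>.abs
    refine le_of_tendsto_of_tendsto t1 (hsl.norm.const_mul η) ?_
    filter_upwards [mem_nhdsWithin_of_mem_nhds hev] with t ht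
    rw [slope_def_module, norm_smul, Real.norm_eq_abs, smul_mul_assoc, Complex.smul_im, smul_eq_mul,
      abs_mul]
    have := mul_le_mul_of_nonneg_left ht (abs_nonneg (t - s)⁻¹)
    linarith
  have hzero : (w' * Complex.exp (-(φ * Complex.I))).im = 0 := by
    by_contra hne
    have h1 := abs_pos.2 hne
    have h2 := hsmall (|(w' * Complex.exp (-(φ * Complex.I))).im| / (2 * (‖w'‖ + 1))) (by positivity)
    have h3 : |(w' * Complex.exp (-(φ * Complex.I))).im| / (2 * (‖w'‖ + 1)) * ‖w'‖ =
      |(w' * Complex.exp (-(φ * Complex.I))).im| * (‖w'‖ / (2 * (‖w'‖ + 1))) := by ring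
    have h4 : ‖w'‖ / (2 * (‖w'‖ + 1)) < 1 := by
      rw [div_lt_one (by positivity)]; linarith [norm_nonneg w']
    rw [h3] at h2
    nlinarith
  refine ⟨(w' * Complex.exp (-(φ * Complex.I))).re, ?_⟩
  have h1 : (((w' * Complex.exp (-(φ * Complex.I))).re : ℝ) : ℂ) =
      w' * Complex.exp (-(φ * Complex.I)) := Complex.ext rfl (by simpa using hzero.symm)
  rw [h1, mul_assoc, ← Complex.exp_add, neg_add_cancel, Complex.exp_zero, mul_one]

/-- The angle of the tangent line along a path in the projected link increases where the path
passes a vertical tangent with the link bending to the left. -/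
theorem upward_crossing {τ φ : ℝ → ℝ} {w : ℝ → ℂ} {s r : ℝ} {w' : ℂ} {i : Fin L.numComp}
    (hτ : ContinuousAt τ s) (hφc : ContinuousAt φ s)
    (hw : HasDerivAt w w' s) (hcar : ∀ᶠ t in 𝓝 s, (τ t, w t) ∈ L.carrier)
    (hφ : ∀ᶠ t in 𝓝 s, L.IsTangentAngle (τ t, w t) (φ t)) (hr : L.param i r = (τ s, w s))
    (hcos : Real.cos (φ s) = 0) (hsign : deriv (deriv (L.xCoord i)) r * w'.im < 0) :
    (∀ᶠ t in 𝓝[>] s, φ s < φ t) ∧ ∀ᶠ t in 𝓝[<] s, φ t < φ s := by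
  have hX0 : deriv (deriv (L.xCoord i)) r ≠ 0 := by
    intro h; rw [h] at hsign; simp at hsign
  have hw0 : w'.im ≠ 0 := by
    intro h; rw [h] at hsign; simp at hsign
  obtain ⟨c₀, hc₀⟩ := hφ.self_of_nhds i r hr
  have hx0 : (deriv (L.param i) r).2.re = 0 := by
    rw [hc₀, Complex.re_ofReal_mul, Complex.exp_ofReal_mul_I_re, hcos, mul_zero]
  have hY0 : (deriv (L.param i) r).2.im ≠ 0 := fun h =>
    L.deriv_snd_ne_zero i r (Complex.ext hx0 h)
  have hlift : Tendsto (fun t => (τ t, w t)) (𝓝 s) (𝓝[L.carrier] (L.param i r)) := by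
    refine tendsto_nhdsWithin_iff.2 ⟨?_, hcar⟩
    rw [hr]
    exact hτ.prodMk hw.continuousAt
  set X := deriv (deriv (L.xCoord i)) r with hX
  set Y := (deriv (L.param i) r).2.im with hY
  have hstrand : ∀ᶠ x in 𝓝 r, 0 < Y * (deriv (L.param i) x).2.im ∧ (x ≠ r →
      0 < X * (deriv (L.param i) x).2.re * (x - r) ∧
      0 < Y * ((L.param i x).2.im - (L.param i r).2.im) * (x - r)) := by
    have e1 := eventually_sign_of_hasDerivAt (L.hasDerivAt_deriv_xCoord i r) hX0
    have e2 := eventually_sign_of_hasDerivAt (L.hasDerivAt_yCoord i r) hY0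
    rw [eventually_nhdsWithin_iff] at e1 e2
    have e3 : Continuous fun x => Y * (deriv (L.param i) x).2.im := by
      have := (L.contDiff_deriv_param i).continuous
      fun_prop
    have e4 : ∀ᶠ x in 𝓝 r, 0 < Y * (deriv (L.param i) x).2.im :=
      e3.continuousAt.eventually (lt_mem_nhds (mul_self_pos.2 hY0))
    filter_upwards [e1, e2, e4] with x h1 h2 h3
    refine ⟨h3, fun hne => ⟨?_, h2 hne⟩⟩
    have := h1 hne
    rwa [hx0, sub_zero] at this
  obtain ⟨ε, hε, hball⟩ := Metric.eventually_nhds_iff.1 hstrand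
  have hwim : HasDerivAt (fun t => (w t).im) w'.im s :=
    Complex.imCLM.hasFDerivAt.comp_hasDerivAt s hw
  have hpath := eventually_sign_of_hasDerivAt hwim hw0
  have hclose : ∀ᶠ t in 𝓝 s, |φ t - φ s| < Real.pi / 2 := by
    have := Metric.tendsto_nhds.1 hφc (Real.pi / 2) (by positivity)
    exact this
  have hmain : ∀ᶠ t in 𝓝[≠] s, 0 < (φ t - φ s) * (t - s) := by
    filter_upwards [hpath, mem_nhdsWithin_of_mem_nhds hclose, mem_nhdsWithin_of_mem_nhds hφ,
      mem_nhdsWithin_of_mem_nhds (hlift.eventually (L.eventually_exists_param_eq i r hε))]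
      with t h1 h2 h3 h4
    obtain ⟨x, hx, hxt⟩ := h4
    obtain ⟨c, hc⟩ := h3 i x hxt
    have e1 : w t = (L.param i x).2 := by rw [hxt]
    have e2 : w s = (L.param i r).2 := by rw [hr]
    obtain ⟨p1, p2⟩ := hball (y := x) hx
    have hxr : x ≠ r := by
      rintro rfl
      rw [e1, e2] at h1
      simp at h1
    obtain ⟨p2, p3⟩ := p2 hxr
    rw [e1, e2] at h1
    rw [hc, Complex.im_ofReal_mul, Complex.exp_ofReal_mul_I_im] at p1
    rw [hc, Complex.re_ofReal_mul, Complex.exp_ofReal_mul_I_re] at p2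
    set d := φ t - φ s with hd
    have hφt : φ t = φ s + d := by rw [hd]; ring
    rw [hφt, Real.sin_add, hcos, zero_mul, add_zero] at p1
    rw [hφt, Real.cos_add, hcos, zero_mul, zero_sub] at p2
    have hι : Real.sin (φ s) ^ 2 = 1 := by
      have := Real.sin_sq_add_cos_sq (φ s)
      rw [hcos] at this
      linarith
    have hcosd : 0 < Real.cos d := Real.cos_pos_of_mem_Ioo ⟨by linarith [(abs_lt.1 h2).1], (abs_lt.1 h2).2⟩
    -- In the product of the four sign conditions, the unknown signs of `c`, `Y`, `y` and `x - r`
    -- enter as squares. What remains is the sign of `-(X * w'.im) * sin d * (t - s)`.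
    have hprod := mul_pos (mul_pos p1 p2) (mul_pos p3 h1)
    set y := (L.param i x).2.im - (L.param i r).2.im
    have h5 : 0 < -(X * w'.im) * (Real.sin d * (t - s)) *
        (c ^ 2 * Y ^ 2 * y ^ 2 * (x - r) ^ 2 * Real.cos d) := by
      refine hprod.trans_eq ?_
      linear_combination (Y ^ 2 * c ^ 2 * Real.cos d * X * (-Real.sin d) * (x - r) ^ 2 * y ^ 2 *
        w'.im * (t - s)) * hι
    have h6 : 0 ≤ c ^ 2 * Y ^ 2 * y ^ 2 * (x - r) ^ 2 * Real.cos d := by positivity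
    have h7 : 0 < -(X * w'.im) * (Real.sin d * (t - s)) := by
      by_contra! h
      linarith [mul_nonpos_of_nonpos_of_nonneg h h6]
    have h8 : 0 < Real.sin d * (t - s) := by
      by_contra! hneg
      exact h7.not_ge (mul_nonpos_of_nonneg_of_nonpos (by linarith) hneg)
    rcases lt_trichotomy d 0 with h | h | h
    · have : Real.sin d < 0 := Real.sin_neg_of_neg_of_neg_pi_lt h (by
        linarith [(abs_lt.1 h2).1, Real.pi_pos])
      refine mul_pos_of_neg_of_neg h ?_
      by_contra! hts
      exact h8.not_ge (mul_nonpos_of_nonpos_of_nonneg this.le hts)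
    · rw [h] at h8; simp at h8
    · have : 0 < Real.sin d := Real.sin_pos_of_pos_of_lt_pi h (by
        linarith [(abs_lt.1 h2).2, Real.pi_pos])
      refine mul_pos h ?_
      by_contra! hts
      exact h8.not_ge (mul_nonpos_of_nonneg_of_nonpos this.le hts)
  constructor
  · filter_upwards [nhdsWithin_mono s (fun t (ht : s < t) => ht.ne') hmain, self_mem_nhdsWithin]
      with t ht hst
    have : 0 < t - s := sub_pos.2 hst
    by_contra! h
    nlinarith
  · filter_upwards [nhdsWithin_mono s (fun t (ht : t < s) => ht.ne) hmain, self_mem_nhdsWithin]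
      with t ht hst
    have : t - s < 0 := sub_neg.2 hst
    by_contra! h
    nlinarith

end LegendrianLink

/-! ### Boundary arcs of the punctured disk. -/

namespace DiskPunctures

theorem norm_circlePoint (s : ℝ) : ‖circlePoint s‖ = 1 := Complex.norm_exp_ofReal_mul_I s

theorem circlePoint_mem_closedBall (s : ℝ) : circlePoint s ∈ closedBall (0 : ℂ) 1 := by
  simp [norm_circlePoint]

theorem hasDerivAt_circlePoint (s : ℝ) :
    HasDerivAt circlePoint (Complex.I * circlePoint s) s := by
  have h : HasDerivAt (fun z : ℂ => Complex.exp (z * Complex.I))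
      (Complex.exp (s * Complex.I) * Complex.I) (s : ℂ) := by
    simpa using ((hasDerivAt_id (s : ℂ)).mul_const Complex.I).cexp
  exact h.comp_ofReal.congr_deriv (mul_comm _ _)

theorem continuous_circlePoint : Continuous circlePoint :=
  continuous_iff_continuousAt.2 fun s => (hasDerivAt_circlePoint s).continuousAt

theorem circlePoint_eq_iff {s t : ℝ} :
    circlePoint s = circlePoint t ↔ ∃ n : ℤ, s = t + n * (2 * Real.pi) := by
  rw [circlePoint, circlePoint, Complex.exp_eq_exp_iff_exists_int]
  refine exists_congr fun n => ?_
  have : (t : ℂ) * Complex.I + n * (2 * Real.pi * Complex.I) =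
      ((t + n * (2 * Real.pi) : ℝ) : ℂ) * Complex.I := by push_cast; ring
  rw [this, mul_left_inj' Complex.I_ne_zero, Complex.ofReal_inj]

theorem exists_circlePoint_eq {z : ℂ} (hz : ‖z‖ = 1) (a : ℝ) :
    ∃ s ∈ Ico a (a + 2 * Real.pi), circlePoint s = z := by
  have hper : Function.Periodic circlePoint (2 * Real.pi) := fun s =>
    circlePoint_eq_iff.2 ⟨1, by simp⟩
  obtain ⟨s, hs, hs2⟩ := hper.exists_mem_Ico Real.two_pi_pos (Complex.arg z) a
  refine ⟨s, hs, ?_⟩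
  rw [← hs2, circlePoint]
  have := Complex.norm_mul_exp_arg_mul_I z
  rwa [hz, Complex.ofReal_one, one_mul] at this

variable (D : DiskPunctures)

theorem norm_point (k : Fin D.m) : ‖D.point k‖ = 1 := norm_circlePoint _

/-- The end of an arc is the start of the next one. -/
theorem exists_next : ∃ next : Equiv.Perm (Fin D.m),
    ∀ k, circlePoint (D.angle k.succ) = D.point (next k) := by
  obtain ⟨m, angle, hmono, hcl⟩ := D
  cases m with
  | zero => exact ⟨1, fun k => k.elim0⟩
  | succ m =>
    refine ⟨finRotate (m + 1), fun k => ?_⟩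
    simp only [point]
    rcases Fin.eq_castSucc_or_eq_last k with ⟨j, rfl⟩ | rfl
    · have : finRotate (m + 1) j.castSucc = j.succ := by
        rw [finRotate_apply]; simp
      rw [this]
      congr 1
    · rw [finRotate_last]
      refine circlePoint_eq_iff.2 ⟨1, ?_⟩
      simpa using hcl

theorem angle_zero_le (k : Fin (D.m + 1)) : D.angle 0 ≤ D.angle k :=
  D.strictMono.monotone (Fin.zero_le k)

theorem angle_le (k : Fin (D.m + 1)) : D.angle k ≤ D.angle 0 + 2 * Real.pi := by
  rw [← D.closes]; exact D.strictMono.monotone (Fin.le_last k)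

theorem angle_lt (k : Fin D.m) : D.angle k.castSucc < D.angle k.succ :=
  D.strictMono Fin.castSucc_lt_succ

theorem circlePoint_mem_domain {k : Fin D.m} {s : ℝ}
    (hs : s ∈ Ioo (D.angle k.castSucc) (D.angle k.succ)) : circlePoint s ∈ D.domain := by
  refine ⟨circlePoint_mem_closedBall s, ?_⟩
  rintro ⟨j, hj⟩
  obtain ⟨n, hn⟩ := circlePoint_eq_iff.1 hj
  have hpi := Real.pi_pos
  have h1 := D.angle_zero_le k.castSucc
  have h2 := D.angle_le k.succ
  have h3 := D.angle_zero_le j.castSucc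
  have h4 : D.angle j.castSucc < D.angle 0 + 2 * Real.pi := (D.angle_lt j).trans_le (D.angle_le _)
  -- Both angles lie in the window of length `2π` starting at `D.angle 0`, which leaves only `n =
  -- 0`; and no puncture angle lies between consecutive ones.
  have h5 : (n : ℝ) < 1 := by
    by_contra! h
    nlinarith [hs.1]
  have h6 : (-1 : ℝ) < n := by
    by_contra! h
    nlinarith [hs.2]
  have h7 : n < 1 := by exact_mod_cast h5
  have h8 : -1 < n := by exact_mod_cast h6
  obtain rfl : n = 0 := by omega
  simp only [Int.cast_zero, zero_mul, add_zero] at hn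
  rw [← hn] at hs
  have h9 := D.strictMono.lt_iff_lt.1 hs.1
  have h10 := D.strictMono.lt_iff_lt.1 hs.2
  rw [Fin.lt_def] at h9 h10
  simp at h9 h10
  omega

theorem exists_arc {z : ℂ} (hz : z ∈ D.domain) (hz1 : ‖z‖ = 1) :
    ∃ k : Fin D.m, ∃ s ∈ Ioo (D.angle k.castSucc) (D.angle k.succ), circlePoint s = z := by
  obtain ⟨s, hs, rfl⟩ := exists_circlePoint_eq hz1 (D.angle 0)
  have hne : (Finset.univ.filter fun k => D.angle k ≤ s).Nonempty := ⟨0, by simpa using hs.1⟩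
  set k := (Finset.univ.filter fun k => D.angle k ≤ s).max' hne with hk
  have hks : D.angle k ≤ s := (Finset.mem_filter.1 (Finset.max'_mem _ hne)).2
  rcases Fin.eq_castSucc_or_eq_last k with ⟨j, hj⟩ | hlast
  · rw [hj] at hks
    refine ⟨j, s, ⟨lt_of_le_of_ne hks fun h => ?_, ?_⟩, rfl⟩
    · exact hz.2 ⟨j, by rw [point, h]⟩
    · by_contra! h
      have h1 : j.succ ≤ k := Finset.le_max' _ _ (by simpa using h)
      rw [hj] at h1
      exact absurd h1 (not_le.2 Fin.castSucc_lt_succ)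
  · rw [hlast, D.closes] at hks
    exact absurd hks (not_le.2 hs.2)

theorem ball_subset_domain : ball 0 1 ⊆ D.domain := fun z hz => by
  refine ⟨ball_subset_closedBall hz, ?_⟩
  rintro ⟨k, rfl⟩
  simp [norm_point] at hz

theorem domain_subset : D.domain ⊆ closedBall 0 1 := sdiff_subset

theorem closedBall_subset_closure : closedBall 0 1 ⊆ closure D.domain := by
  rw [← closure_ball (0 : ℂ) one_ne_zero]
  exact closure_mono D.ball_subset_domain

theorem isOpen_compl_range : IsOpen (range D.point)ᶜ :=
  (finite_range D.point).isClosed.isOpen_compl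

theorem domain_mem_nhdsWithin {z : ℂ} (hz : z ∈ D.domain) : D.domain ∈ 𝓝[closedBall 0 1] z :=
  inter_mem_nhdsWithin _ (D.isOpen_compl_range.mem_nhds hz.2)

theorem uniqueDiffOn_domain : UniqueDiffOn ℝ D.domain := by
  refine UniqueDiffOn.inter (uniqueDiffOn_convex (convex_closedBall 0 1) ?_) D.isOpen_compl_range
  rw [interior_closedBall (0 : ℂ) one_ne_zero]
  exact ⟨0, by simp⟩

end DiskPunctures

/-! ### Complex differentiability up to the boundary and extension over the punctures. -/

/-- The differential of a map that is smooth up to the boundary and holomorphic in the interior is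
complex linear up to the boundary. -/
theorem fderivWithin_domain_apply {D : DiskPunctures} {f : ℂ → ℂ} (hf : ContDiffOn ℝ ∞ f D.domain)
    (hd : DifferentiableOn ℂ f (ball 0 1)) {z : ℂ} (hz : z ∈ D.domain) (v : ℂ) :
    fderivWithin ℝ f D.domain z v = v * fderivWithin ℝ f D.domain z 1 := by
  have hcont : ContinuousOn (fderivWithin ℝ f D.domain) D.domain :=
    hf.continuousOn_fderivWithin D.uniqueDiffOn_domain (by simp)
  have hball : ∀ x ∈ ball (0 : ℂ) 1,
      fderivWithin ℝ f D.domain x v - v * fderivWithin ℝ f D.domain x 1 = 0 := by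
    intro x hx
    have h1 : HasFDerivAt f (fderiv ℂ f x) x :=
      (hd.differentiableAt (isOpen_ball.mem_nhds hx)).hasFDerivAt
    have h2 := (h1.restrictScalars ℝ).hasFDerivWithinAt (s := D.domain)
    rw [h2.fderivWithin (D.uniqueDiffOn_domain x (D.ball_subset_domain hx))]
    have h3 : fderiv ℂ f x v = v * fderiv ℂ f x 1 := by
      conv_lhs => rw [← mul_one v, ← smul_eq_mul, map_smul, smul_eq_mul]
    simp only [ContinuousLinearMap.coe_restrictScalars', h3, sub_self]
  -- Complex linearity holds in the open disk and is a closed condition on the continuous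
  -- differential, so it passes to the boundary.
  have hlim : Tendsto (fun x => fderivWithin ℝ f D.domain x v - v * fderivWithin ℝ f D.domain x 1)
      (𝓝[ball 0 1] z)
      (𝓝 (fderivWithin ℝ f D.domain z v - v * fderivWithin ℝ f D.domain z 1)) := by
    have h1 := (hcont z hz).mono D.ball_subset_domain
    have h2 : ContinuousWithinAt (fun x => fderivWithin ℝ f D.domain x v) (ball 0 1) z :=
      h1.clm_apply continuousWithinAt_const
    have h3 : ContinuousWithinAt (fun x => fderivWithin ℝ f D.domain x 1) (ball 0 1) z :=
      h1.clm_apply continuousWithinAt_const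
    exact h2.sub (continuousWithinAt_const.mul h3)
  have hne : (𝓝[ball (0 : ℂ) 1] z).NeBot := by
    rw [← mem_closure_iff_nhdsWithin_neBot, closure_ball (0 : ℂ) one_ne_zero]
    exact D.domain_subset hz
  have := tendsto_nhds_unique (hlim.congr' (eventually_nhdsWithin_of_forall hball))
    tendsto_const_nhds
  exact sub_eq_zero.1 this

theorem hasDerivWithinAt_domain {D : DiskPunctures} {f : ℂ → ℂ} (hf : ContDiffOn ℝ ∞ f D.domain)
    (hd : DifferentiableOn ℂ f (ball 0 1)) {z : ℂ} (hz : z ∈ D.domain) :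
    HasDerivWithinAt f (fderivWithin ℝ f D.domain z 1) D.domain z := by
  have h1 : HasFDerivWithinAt f (fderivWithin ℝ f D.domain z) D.domain z :=
    (hf.differentiableOn (by simp) z hz).hasFDerivWithinAt
  rw [hasDerivWithinAt_iff_hasFDerivWithinAt]
  refine h1.of_restrictScalars ℝ (ContinuousLinearMap.ext fun v => ?_)
  simpa using (fderivWithin_domain_apply hf hd hz v).symm

theorem contDiffOn_fderivWithin_one {D : DiskPunctures} {f : ℂ → ℂ}
    (hf : ContDiffOn ℝ ∞ f D.domain) :
    ContDiffOn ℝ ∞ (fun z => fderivWithin ℝ f D.domain z 1) D.domain :=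
  (hf.fderivWithin D.uniqueDiffOn_domain (by simp)).clm_apply contDiffOn_const

theorem fderivWithin_one_eq_deriv {D : DiskPunctures} {f : ℂ → ℂ} (hf : ContDiffOn ℝ ∞ f D.domain)
    (hd : DifferentiableOn ℂ f (ball 0 1)) {z : ℂ} (hz : z ∈ ball (0 : ℂ) 1) :
    fderivWithin ℝ f D.domain z 1 = deriv f z :=
  ((hasDerivWithinAt_domain hf hd (D.ball_subset_domain hz)).hasDerivAt
    (mem_of_superset (isOpen_ball.mem_nhds hz) D.ball_subset_domain)).deriv.symm

theorem differentiableOn_fderivWithin_one {D : DiskPunctures} {f : ℂ → ℂ}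
    (hf : ContDiffOn ℝ ∞ f D.domain) (hd : DifferentiableOn ℂ f (ball 0 1)) :
    DifferentiableOn ℂ (fun z => fderivWithin ℝ f D.domain z 1) (ball 0 1) :=
  (hd.deriv isOpen_ball).congr fun _ hz => fderivWithin_one_eq_deriv hf hd hz

/-- A map `U` of the closed disk which is continuous, holomorphic in the interior, and differentiable
with derivative `g` also at the boundary points that are not punctures. -/
structure IsDiskExtension (D : DiskPunctures) (U g : ℂ → ℂ) : Prop where
  cont : ContinuousOn U (closedBall 0 1)
  diff : DifferentiableOn ℂ U (ball 0 1)
  hasDeriv : ∀ z ∈ D.domain, HasDerivWithinAt U (g z) (closedBall 0 1) z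

namespace IsHolomorphicDisk

variable {L : LegendrianLink} {D : DiskPunctures} {u : ℂ → ℂ}

theorem extendFrom_eq (hu : IsHolomorphicDisk L D u) {z : ℂ} (hz : z ∈ D.domain) :
    extendFrom D.domain u z = u z :=
  _root_.extendFrom_eq (subset_closure hz) (hu.smooth.continuousOn z hz)

theorem continuousOn_extendFrom (hu : IsHolomorphicDisk L D u) :
    ContinuousOn (extendFrom D.domain u) (closedBall 0 1) := by
  refine _root_.continuousOn_extendFrom D.closedBall_subset_closure fun z hz => ?_
  by_cases h : z ∈ D.domain
  · exact ⟨u z, hu.smooth.continuousOn z h⟩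
  · have : z ∈ range D.point := by
      by_contra h'
      exact h ⟨hz, h'⟩
    obtain ⟨k, rfl⟩ := this
    obtain ⟨q, -, hq⟩ := hu.asymptotic k
    exact ⟨q, hq⟩

theorem extendFrom_point_mem (hu : IsHolomorphicDisk L D u) (k : Fin D.m) :
    extendFrom D.domain u (D.point k) ∈ L.doublePoints := by
  obtain ⟨q, hq, hlim⟩ := hu.asymptotic k
  rwa [_root_.extendFrom_eq (D.closedBall_subset_closure (by simp [D.norm_point])) hlim]

theorem isDiskExtension (hu : IsHolomorphicDisk L D u) :
    IsDiskExtension D (extendFrom D.domain u) (fun z => fderivWithin ℝ u D.domain z 1) where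
  cont := hu.continuousOn_extendFrom
  diff := hu.holomorphic.congr fun _ hz => hu.extendFrom_eq (D.ball_subset_domain hz)
  hasDeriv z hz := by
    have h1 := hasDerivWithinAt_domain hu.smooth hu.holomorphic hz
    have h2 : HasDerivWithinAt (extendFrom D.domain u) (fderivWithin ℝ u D.domain z 1)
        D.domain z := h1.congr (fun x hx => hu.extendFrom_eq hx) (hu.extendFrom_eq hz)
    exact h2.mono_of_mem_nhdsWithin (D.domain_mem_nhdsWithin hz)

end IsHolomorphicDisk

/-! ### Extrema of the real part on the closed disk. -/

/-- A local maximum of `σ * Re U` on the closed unit disk. For `σ = ±1`, this is a local maximum or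
a local minimum of `Re U`. -/
def IsExtremum (U : ℂ → ℂ) (σ : ℝ) (z : ℂ) : Prop :=
  ∀ᶠ w in 𝓝[closedBall 0 1] z, σ * (U w).re ≤ σ * (U z).re

namespace IsDiskExtension

open DiskPunctures

variable {D : DiskPunctures} {U g : ℂ → ℂ}

/-- An extremum of `σ * Re U` is a local maximum of `|exp (σ U)|`. The maximum modulus principle and
the identity theorem make `exp (σ U)`, hence `U`, constant on the disk, and by continuity on its
closure. -/
theorem not_isExtremum_of_mem_ball (hU : IsDiskExtension D U g)
    (hne : ∃ z ∈ closedBall (0 : ℂ) 1, ∃ w ∈ closedBall (0 : ℂ) 1, U z ≠ U w) {σ : ℝ} (hσ : σ ≠ 0)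
    {z : ℂ} (hz : z ∈ ball (0 : ℂ) 1) : ¬ IsExtremum U σ z := by
  intro hext
  have hd : DifferentiableOn ℂ (fun w => Complex.exp (σ * U w)) (ball 0 1) :=
    (hU.diff.const_mul _).cexp
  have hnhds : 𝓝[closedBall 0 1] z = 𝓝 z :=
    nhdsWithin_eq_nhds.2 (mem_of_superset (isOpen_ball.mem_nhds hz) ball_subset_closedBall)
  have hmax : IsLocalMax (norm ∘ fun w => Complex.exp (σ * U w)) z := by
    rw [IsExtremum, hnhds] at hext
    filter_upwards [hext] with w hw
    simpa [Complex.norm_exp] using hw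
  have hev := Complex.eventually_eq_of_isLocalMax_norm
    (hd.eventually_differentiableAt (isOpen_ball.mem_nhds hz)) hmax
  have heq := (hd.analyticOnNhd isOpen_ball).eqOn_of_preconnected_of_eventuallyEq
    analyticOnNhd_const (convex_ball (0 : ℂ) 1).isPreconnected hz hev
  have hderiv : (ball (0 : ℂ) 1).EqOn (deriv U) 0 := by
    intro w hw
    have hnw := isOpen_ball.mem_nhds hw
    have h1 : HasDerivAt (fun w => Complex.exp (σ * U w)) (Complex.exp (σ * U w) * (σ * deriv U w)) w :=
      ((hU.diff.differentiableAt hnw).hasDerivAt.const_mul (σ : ℂ)).cexp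
    have h2 : HasDerivAt (fun w => Complex.exp (σ * U w)) 0 w :=
      (hasDerivAt_const w (Complex.exp (σ * U z))).congr_of_eventuallyEq
        (mem_of_superset hnw fun x hx => heq hx)
    have h3 := h1.unique h2
    simpa [Complex.exp_ne_zero, hσ] using h3
  obtain ⟨c, hc⟩ := isOpen_ball.exists_is_const_of_deriv_eq_zero
    (convex_ball (0 : ℂ) 1).isPreconnected hU.diff hderiv
  have hcl : (closedBall (0 : ℂ) 1).EqOn U fun _ => c := by
    have h1 : (ball (0 : ℂ) 1).EqOn U fun _ => c := hc
    refine h1.of_subset_closure hU.cont continuousOn_const ball_subset_closedBall ?_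
    rw [closure_ball (0 : ℂ) one_ne_zero]
  obtain ⟨x, hx, y, hy, hxy⟩ := hne
  exact hxy ((hcl hx).trans (hcl hy).symm)

/-- If `σ * Re U` is at most its value at `z` on a relative neighbourhood of `z`, it is smaller at
the interior points of the neighbourhood. -/
theorem re_pos_of_not_isExtremum {σ : ℝ} {z : ℂ} {ε : ℝ}
    (hε : ∀ w ∈ closedBall (0 : ℂ) 1 ∩ ball z ε, σ * (U w).re ≤ σ * (U z).re)
    {w : ℂ} (hw : w ∈ closedBall (0 : ℂ) 1 ∩ ball z ε) (hnot : ¬ IsExtremum U σ w) :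
    0 < (σ * (U z - U w)).re := by
  rw [Complex.re_ofReal_mul, Complex.sub_re, mul_sub, sub_pos]
  refine lt_of_le_of_ne (hε w hw) fun h => hnot ?_
  filter_upwards [self_mem_nhdsWithin,
    mem_nhdsWithin_of_mem_nhds (isOpen_ball.mem_nhds hw.2)] with x hx hx2
  rw [h]
  exact hε x ⟨hx, hx2⟩

/-- The Hopf lemma for `σ * (U z - U)`, whose real part is positive at nearby interior points. -/
theorem hopf_of_isExtremum (hU : IsDiskExtension D U g)
    (hne : ∃ z ∈ closedBall (0 : ℂ) 1, ∃ w ∈ closedBall (0 : ℂ) 1, U z ≠ U w) {σ : ℝ} (hσ : σ ≠ 0)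
    {z : ℂ} (hz : z ∈ D.domain) (hz1 : ‖z‖ = 1) (hext : IsExtremum U σ z) :
    0 < σ * (g z * z).re := by
  obtain ⟨ε, hε, hsub⟩ := mem_nhdsWithin_iff.1 hext
  have hle : ∀ w ∈ closedBall (0 : ℂ) 1 ∩ ball z ε, σ * (U w).re ≤ σ * (U z).re :=
    fun w hw => hsub ⟨hw.2, hw.1⟩
  set ρ := min (ε / 2) (1 / 2) with hρ
  have hρ0 : 0 < ρ := by positivity
  have hρ1 : ρ ≤ 1 / 2 := min_le_right _ _
  have hρ2 : ρ ≤ ε / 2 := min_le_left _ _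
  -- The ball of radius `ρ` about `c` touches the unit circle from inside at `z` and lies in the
  -- neighbourhood where `z` is extremal.
  set c : ℂ := ((1 - ρ : ℝ) : ℂ) * z with hc
  have hzc : z - c = (ρ : ℝ) * z := by rw [hc]; push_cast; ring
  have hdist : dist z c = ρ := by
    rw [dist_eq_norm, hzc, norm_mul, hz1, mul_one, Complex.norm_real, Real.norm_of_nonneg hρ0.le]
  have hcn : ‖c‖ = 1 - ρ := by
    rw [hc, norm_mul, hz1, mul_one, Complex.norm_real, Real.norm_of_nonneg (by linarith)]
  have hb1 : ball c (dist z c) ⊆ ball 0 1 := by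
    rw [hdist]
    refine ball_subset_ball' ?_
    rw [dist_zero_right, hcn]; linarith
  have hb2 : ball c (dist z c) ⊆ ball z ε := by
    refine ball_subset_ball' ?_
    rw [dist_comm c z, hdist]; linarith
  have hder : HasDerivWithinAt (fun w => (σ : ℂ) * (U z - U w)) (σ * -g z) (closedBall 0 1) z :=
    ((hU.hasDeriv z hz).const_sub (U z)).const_mul (σ : ℂ)
  have h := hopf_re (p := z) (c := c) (fun h => by rw [h, dist_self] at hdist; linarith)
    (((hU.diff.const_sub (U z)).const_mul (σ : ℂ)).mono hb1)
    (fun w hw => re_pos_of_not_isExtremum hle ⟨ball_subset_closedBall (hb1 hw), hb2 hw⟩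
      (hU.not_isExtremum_of_mem_ball hne hσ (hb1 hw)))
    (hb1.trans ball_subset_closedBall) hder (by simp)
  rw [← neg_sub, hzc] at h
  have h2 : (σ : ℂ) * -g z * -(ρ * z) = ((σ * ρ : ℝ) : ℂ) * (g z * z) := by push_cast; ring
  rw [h2, Complex.re_ofReal_mul] at h
  by_contra! hneg
  nlinarith

theorem hasDerivAt_circle (hU : IsDiskExtension D U g) {s : ℝ} (hs : circlePoint s ∈ D.domain) :
    HasDerivAt (fun s => U (circlePoint s)) (g (circlePoint s) * (Complex.I * circlePoint s)) s := by
  have h1 := hasDerivAt_circlePoint s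
  rw [← hasDerivWithinAt_univ] at h1 ⊢
  have := HasDerivWithinAt.scomp s (hU.hasDeriv _ hs) h1 fun x _ => circlePoint_mem_closedBall x
  rwa [smul_eq_mul, mul_comm] at this

/-- At an extremum, the boundary of the disk moves vertically. -/
theorem velocity_of_isExtremum (hU : IsDiskExtension D U g)
    (hne : ∃ z ∈ closedBall (0 : ℂ) 1, ∃ w ∈ closedBall (0 : ℂ) 1, U z ≠ U w) {σ : ℝ} (hσ : σ ≠ 0)
    {s : ℝ} (hs : circlePoint s ∈ D.domain) (hext : IsExtremum U σ (circlePoint s)) :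
    (g (circlePoint s) * (Complex.I * circlePoint s)).re = 0 ∧
      0 < σ * (g (circlePoint s) * (Complex.I * circlePoint s)).im := by
  constructor
  · have h1 : HasDerivAt (fun s => σ * (U (circlePoint s)).re)
        (σ * (g (circlePoint s) * (Complex.I * circlePoint s)).re) s :=
      (Complex.reCLM.hasFDerivAt.comp_hasDerivAt s (hU.hasDerivAt_circle hs) :
        HasDerivAt (fun s => (U (circlePoint s)).re) _ s).const_mul σ
    have h2 : Tendsto circlePoint (𝓝 s) (𝓝[closedBall 0 1] (circlePoint s)) :=
      tendsto_nhdsWithin_iff.2 ⟨continuous_circlePoint.continuousAt,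
        Eventually.of_forall circlePoint_mem_closedBall⟩
    have h3 : IsLocalMax (fun s => σ * (U (circlePoint s)).re) s := h2.eventually hext
    have h4 := h3.hasDerivAt_eq_zero h1
    exact (mul_eq_zero.1 h4).resolve_left hσ
  · have h1 := hU.hopf_of_isExtremum hne hσ hs (norm_circlePoint s) hext
    have h2 : g (circlePoint s) * (Complex.I * circlePoint s) =
        Complex.I * (g (circlePoint s) * circlePoint s) := by ring
    rwa [h2, Complex.I_mul_im]

/-- The maximum principle for `exp (σ U)`. It turns bounds on the projected link into bounds on the
whole disk. -/
theorem re_le_of_circle (hU : IsDiskExtension D U g) {σ M : ℝ}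
    (h : ∀ z : ℂ, ‖z‖ = 1 → σ * (U z).re ≤ M) {z : ℂ} (hz : z ∈ closedBall (0 : ℂ) 1) :
    σ * (U z).re ≤ M := by
  have hd : DiffContOnCl ℂ (fun w => Complex.exp (σ * U w)) (ball 0 1) := by
    refine ⟨(hU.diff.const_mul _).cexp, ?_⟩
    rw [closure_ball (0 : ℂ) one_ne_zero]
    exact (continuousOn_const.mul hU.cont).cexp
  have := Complex.norm_le_of_forall_mem_frontier_norm_le (C := Real.exp M) isBounded_ball hd
    (fun w hw => by
      rw [frontier_ball (0 : ℂ) one_ne_zero, mem_sphere_zero_iff_norm] at hw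
      simpa [Complex.norm_exp] using h w hw) (z := z)
    (by rwa [closure_ball (0 : ℂ) one_ne_zero])
  simpa [Complex.norm_exp] using this

end IsDiskExtension

/-- Here `diskMap` is `p * (1 + 2 * I * x) / (1 - 2 * I * x)`, of argument twice `arctan (2 * x)`
relative to `p`. So positive `x` parametrizes the outgoing arc and negative `x` the incoming one. -/
theorem diskMap_neg_eq_circlePoint (a x : ℝ) :
    diskMap (DiskPunctures.circlePoint a) (-DiskPunctures.circlePoint a) x =
      DiskPunctures.circlePoint (a + 2 * Real.arctan (2 * x)) := by
  set p := DiskPunctures.circlePoint a with hp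
  have hp1 : ‖p‖ = 1 := DiskPunctures.norm_circlePoint a
  have hp0 : p ≠ 0 := by intro h; rw [h] at hp1; simp at hp1
  have hpp : p ≠ -p := fun h => hp0 (self_eq_neg.1 h)
  have hd := diskMap_den_ne_zero hp1 (by rw [norm_neg, hp1]) hpp (w := (x : ℂ)) (by simp)
  have hμ : diskCoeff p (-p) = -2 * Complex.I := by
    rw [diskCoeff, map_neg, mul_neg, mul_conj_of_norm_eq_one hp1]; ring
  rw [hμ] at hd
  set θ := Real.arctan (2 * x) with hθ
  have hc : 0 < Real.cos θ := Real.cos_arctan_pos _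
  have hs : Real.sin θ = 2 * x * Real.cos θ := by
    have := Real.tan_mul_cos hc.ne'
    rw [hθ, Real.tan_arctan] at this
    exact this.symm
  have h1 : Real.cos θ ^ 2 * (1 + 4 * x ^ 2) = 1 := by
    have := Real.sin_sq_add_cos_sq θ
    rw [hs] at this
    linarith
  have hE : Complex.exp (θ * Complex.I) = Real.cos θ * (1 + 2 * x * Complex.I) := by
    rw [Complex.exp_mul_I, ← Complex.ofReal_cos, ← Complex.ofReal_sin, hs]
    push_cast; ring
  have hR : DiskPunctures.circlePoint (a + 2 * θ) =
      p * (Complex.exp (θ * Complex.I) * Complex.exp (θ * Complex.I)) := by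
    rw [hp, DiskPunctures.circlePoint, DiskPunctures.circlePoint, ← Complex.exp_add,
      ← Complex.exp_add]
    congr 1; push_cast; ring
  rw [diskMap, hμ, hR, hE, div_eq_iff hd]
  have h2 : (Real.cos θ : ℂ) ^ 2 * (1 + 4 * x ^ 2) = 1 := by exact_mod_cast h1
  linear_combination (-p * (1 + 2 * x * Complex.I)) * h2 + (4 * p * (Real.cos θ : ℂ) ^ 2 * x ^ 2 * (1 + 2 * x * Complex.I)) * Complex.I_sq

namespace IsDiskExtension

open DiskPunctures

variable {D : DiskPunctures} {U g : ℂ → ℂ}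

/-- If an extremum is a corner with edges of slope `±1`, the incoming edge has slope `1` and the
outgoing edge has slope `-1`. -/
theorem slopes_of_isExtremum (hU : IsDiskExtension D U g)
    (hne : ∃ z ∈ closedBall (0 : ℂ) 1, ∃ w ∈ closedBall (0 : ℂ) 1, U z ≠ U w) {σ : ℝ} (hσ : σ ≠ 0)
    {T : Set ℂ} (hT : T.Finite) (hText : ∀ z : ℂ, ‖z‖ = 1 → z ∉ T → ¬ IsExtremum U σ z)
    {a b : ℝ} (hab : circlePoint b = circlePoint a) (hext : IsExtremum U σ (circlePoint a))
    {d e : ℝ} (hd : d = 1 ∨ d = -1) (he : e = 1 ∨ e = -1)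
    (hout : ∀ᶠ s in 𝓝[>] a, (U (circlePoint s)).im - (U (circlePoint a)).im =
      d * ((U (circlePoint s)).re - (U (circlePoint a)).re))
    (hin : ∀ᶠ s in 𝓝[<] b, (U (circlePoint s)).im - (U (circlePoint a)).im =
      e * ((U (circlePoint s)).re - (U (circlePoint a)).re)) : d = -1 ∧ e = 1 := by
  -- Near the corner there are no other extrema, so `σ * Re (U (circlePoint a) - U)` is strictly
  -- positive off the corner.
  have hfin : (T \ {circlePoint a}).Finite := hT.subset sdiff_subset
  have hTn : ∀ᶠ w in 𝓝[closedBall 0 1] (circlePoint a), w ∉ T \ {circlePoint a} :=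
    mem_nhdsWithin_of_mem_nhds (hfin.isClosed.isOpen_compl.mem_nhds (by simp))
  obtain ⟨ε, hε, hsub⟩ := mem_nhdsWithin_iff.1 (hext.and hTn)
  have hle : ∀ w ∈ closedBall (0 : ℂ) 1 ∩ ball (circlePoint a) ε,
      σ * (U w).re ≤ σ * (U (circlePoint a)).re := fun w hw => (hsub ⟨hw.2, hw.1⟩).1
  have key : ∀ e : ℝ, ∀ z : ℂ, z.im - (U (circlePoint a)).im = e * (z.re - (U (circlePoint a)).re) →
      (σ * (U (circlePoint a) - z)).im = e * (σ * (U (circlePoint a) - z)).re := by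
    intro e z hz
    simp only [Complex.re_ofReal_mul, Complex.im_ofReal_mul, Complex.sub_re, Complex.sub_im]
    linear_combination -σ * hz
  have hlim : ∀ c : ℝ, Tendsto (fun x : ℝ => c + 2 * Real.arctan (2 * x)) (𝓝 0) (𝓝 c) := by
    intro c
    have : Continuous fun x : ℝ => c + 2 * Real.arctan (2 * x) := by fun_prop
    simpa using this.tendsto 0
  refine slopes_of_right_corner (v := fun z => σ * (U (circlePoint a) - U z)) (norm_circlePoint a) hε
    ((continuousOn_const.mul (continuousOn_const.sub hU.cont)).mono inter_subset_left)
    (((hU.diff.const_sub _).const_mul _).mono inter_subset_left) (by simp) ?_ hd he ?_ ?_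
  · intro z hz hzp
    refine re_pos_of_not_isExtremum hle hz fun hz_ext => ?_
    have hz1 : ‖z‖ ≤ 1 := by simpa using hz.1
    rcases hz1.lt_or_eq with h | h
    · exact hU.not_isExtremum_of_mem_ball hne hσ (by simpa using h) hz_ext
    · refine hText z h (fun hzT => ?_) hz_ext
      exact (hsub ⟨hz.2, hz.1⟩).2 ⟨hzT, hzp⟩
  · have h1 : Tendsto (fun x : ℝ => a + 2 * Real.arctan (2 * x)) (𝓝[>] 0) (𝓝[>] a) := by
      refine tendsto_nhdsWithin_iff.2 ⟨(hlim a).mono_left nhdsWithin_le_nhds, ?_⟩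
      filter_upwards [self_mem_nhdsWithin] with x hx
      have : 0 < Real.arctan (2 * x) := Real.arctan_pos.2 (by simpa using hx)
      simpa using this
    filter_upwards [h1.eventually hout] with x hx
    rw [diskMap_neg_eq_circlePoint]
    exact key d _ hx
  · have h1 : Tendsto (fun x : ℝ => b + 2 * Real.arctan (2 * x)) (𝓝[<] 0) (𝓝[<] b) := by
      refine tendsto_nhdsWithin_iff.2 ⟨(hlim b).mono_left nhdsWithin_le_nhds, ?_⟩
      filter_upwards [self_mem_nhdsWithin] with x hx
      have hx0 : x < 0 := hx
      have : Real.arctan (2 * x) < 0 := Real.arctan_lt_zero.2 (by linarith)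
      exact mem_Iio.2 (by linarith)
    filter_upwards [h1.eventually hin] with x hx
    rw [← hab, diskMap_neg_eq_circlePoint]
    rw [← hab] at hx key
    exact key e _ hx

end IsDiskExtension

/-! ### Tangent angles along the boundary arcs. -/

/-- A lift of a boundary arc to the link, with a continuous angle of the tangent line. -/
structure IsArcLift (L : LegendrianLink) (U : ℂ → ℂ) (a b : ℝ) (τ φ : ℝ → ℝ) : Prop where
  contLift : ContinuousOn τ (Ioo a b)
  mem_carrier : ∀ s ∈ Ioo a b, (τ s, U (DiskPunctures.circlePoint s)) ∈ L.carrier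
  contAngle : ContinuousOn φ (Icc a b)
  isTangentAngle : ∀ s ∈ Ioo a b, L.IsTangentAngle (τ s, U (DiskPunctures.circlePoint s)) (φ s)

/-- At the ends of an arc, the tangent angle is that of a line of slope `±1`, on which the arc runs
near its end. -/
theorem exists_end_slope {L : LegendrianLink} (hL : L.GoodPosition) {q : ℂ}
    (hq : q ∈ L.doublePoints) {F : Filter ℝ} [F.NeBot] {τ φ : ℝ → ℝ} {w : ℝ → ℂ} {φ₀ : ℝ}
    (hφ : Tendsto φ F (𝓝 φ₀)) (hw : Tendsto w F (𝓝 q))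
    (hcar : ∀ᶠ s in F, (τ s, w s) ∈ L.carrier)
    (htan : ∀ᶠ s in F, L.IsTangentAngle (τ s, w s) (φ s)) :
    ∃ e : ℝ, (e = 1 ∨ e = -1) ∧ Real.sin φ₀ = e * Real.cos φ₀ ∧
      ∀ᶠ s in F, (w s).im - q.im = e * ((w s).re - q.re) := by
  have hev : ∀ᶠ s in F, ∃ e : ℝ, (e = 1 ∨ e = -1) ∧
      (w s).im - q.im = e * ((w s).re - q.re) ∧ Real.sin (φ s) = e * Real.cos (φ s) := by
    filter_upwards [hw.eventually (hL.eventually_slope hq), hcar, htan] with s h1 h2 h3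
    obtain ⟨e, he, h4, h5⟩ := h1 _ h2 rfl
    exact ⟨e, he, h4, h5 _ h3⟩
  -- The slope could a priori alternate between `1` and `-1`, so only `sin ^ 2 = cos ^ 2` is passed
  -- to the limit.
  have hsq : Real.sin φ₀ ^ 2 - Real.cos φ₀ ^ 2 = 0 := by
    have h1 : Tendsto (fun s => Real.sin (φ s) ^ 2 - Real.cos (φ s) ^ 2) F
        (𝓝 (Real.sin φ₀ ^ 2 - Real.cos φ₀ ^ 2)) := by
      have : Continuous fun x => Real.sin x ^ 2 - Real.cos x ^ 2 := by fun_prop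
      exact (this.tendsto φ₀).comp hφ
    refine tendsto_nhds_unique (h1.congr' ?_) tendsto_const_nhds
    filter_upwards [hev] with s hs
    obtain ⟨e, he, -, h2⟩ := hs
    rw [h2]
    rcases he with rfl | rfl <;> ring
  have hcos : Real.cos φ₀ ≠ 0 := by
    intro h
    have := Real.sin_sq_add_cos_sq φ₀
    rw [h] at this hsq
    linarith
  obtain ⟨e, he, hsin⟩ : ∃ e : ℝ, (e = 1 ∨ e = -1) ∧ Real.sin φ₀ = e * Real.cos φ₀ := by
    have : (Real.sin φ₀ - Real.cos φ₀) * (Real.sin φ₀ + Real.cos φ₀) = 0 := by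
      linear_combination hsq
    rcases mul_eq_zero.1 this with h | h
    · exact ⟨1, Or.inl rfl, by linarith⟩
    · exact ⟨-1, Or.inr rfl, by linarith⟩
  refine ⟨e, he, hsin, ?_⟩
  -- Continuity of the angle now rules out the other slope `-e` near the end.
  have hne : ∀ᶠ s in F, Real.sin (φ s) + e * Real.cos (φ s) ≠ 0 := by
    have h1 : Continuous fun x => Real.sin x + e * Real.cos x := by fun_prop
    refine ((h1.tendsto φ₀).comp hφ).eventually_ne ?_
    rw [hsin]
    rcases he with rfl | rfl
    · intro h; apply hcos; linarith
    · intro h; apply hcos; linarith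
  filter_upwards [hev, hne] with s h1 h2
  obtain ⟨e', he', h3, h4⟩ := h1
  have : e' = e := by
    rcases he with rfl | rfl <;> rcases he' with rfl | rfl
    · rfl
    · exact absurd (by rw [h4]; ring) h2
    · exact absurd (by rw [h4]; ring) h2
    · rfl
  rw [← this]
  exact h3

namespace IsArcLift

open DiskPunctures

variable {L : LegendrianLink} {D : DiskPunctures} {U g : ℂ → ℂ} {τ φ : ℝ → ℝ} {k : Fin D.m}

theorem eventually_mem_carrier {a b : ℝ} (h : IsArcLift L U a b τ φ) {s : ℝ} (hs : s ∈ Ioo a b) :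
    ∀ᶠ t in 𝓝 s, (τ t, U (circlePoint t)) ∈ L.carrier :=
  mem_of_superset (Ioo_mem_nhds hs.1 hs.2) h.mem_carrier

/-- The velocity of a boundary arc is tangent to the link. -/
theorem exists_velocity_eq (hU : IsDiskExtension D U g)
    (h : IsArcLift L U (D.angle k.castSucc) (D.angle k.succ) τ φ) {s : ℝ}
    (hs : s ∈ Ioo (D.angle k.castSucc) (D.angle k.succ)) :
    ∃ ρ : ℝ, g (circlePoint s) * (Complex.I * circlePoint s) =
      ρ * Complex.exp (φ s * Complex.I) :=
  LegendrianLink.exists_velocity_eq (h.contLift.continuousAt (Ioo_mem_nhds hs.1 hs.2))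
    (hU.hasDerivAt_circle (D.circlePoint_mem_domain hs)) (h.eventually_mem_carrier hs)
    (h.isTangentAngle s hs)

/-- The velocity at an extremum is vertical and nonzero, by the Hopf lemma, and it is a real
multiple of the tangent direction. -/
theorem cos_eq_zero_of_isExtremum (hU : IsDiskExtension D U g)
    (hne : ∃ z ∈ closedBall (0 : ℂ) 1, ∃ w ∈ closedBall (0 : ℂ) 1, U z ≠ U w)
    (h : IsArcLift L U (D.angle k.castSucc) (D.angle k.succ) τ φ) {s : ℝ}
    (hs : s ∈ Ioo (D.angle k.castSucc) (D.angle k.succ)) {σ : ℝ} (hσ : σ ≠ 0)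
    (hext : IsExtremum U σ (circlePoint s)) : Real.cos (φ s) = 0 := by
  obtain ⟨h1, h2⟩ := hU.velocity_of_isExtremum hne hσ (D.circlePoint_mem_domain hs) hext
  obtain ⟨ρ, hρ⟩ := exists_velocity_eq hU h hs
  rw [hρ, Complex.re_ofReal_mul, Complex.exp_ofReal_mul_I_re] at h1
  refine (mul_eq_zero.1 h1).resolve_left ?_
  rintro rfl
  rw [hρ] at h2
  simp at h2

/-- A boundary point with a vertical tangent is an extremum, and the tangent angle increases there. -/
theorem of_cos_eq_zero (hL : L.LeftRightSimple) (hU : IsDiskExtension D U g)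
    (hne : ∃ z ∈ closedBall (0 : ℂ) 1, ∃ w ∈ closedBall (0 : ℂ) 1, U z ≠ U w)
    (hproj : ∀ z : ℂ, ‖z‖ = 1 → U z ∈ L.proj)
    (h : IsArcLift L U (D.angle k.castSucc) (D.angle k.succ) τ φ) {s : ℝ}
    (hs : s ∈ Ioo (D.angle k.castSucc) (D.angle k.succ)) (hcos : Real.cos (φ s) = 0) :
    (∃ σ : ℝ, (σ = 1 ∨ σ = -1) ∧ IsExtremum U σ (circlePoint s)) ∧
      (∀ᶠ t in 𝓝[>] s, φ s < φ t) ∧ ∀ᶠ t in 𝓝[<] s, φ t < φ s := by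
  have hnhds := Ioo_mem_nhds hs.1 hs.2
  obtain ⟨i, r, hr⟩ := h.mem_carrier s hs
  obtain ⟨c, hc⟩ := h.isTangentAngle s hs i r hr
  have hv : (deriv (L.param i) r).2.re = 0 := by
    rw [hc, Complex.re_ofReal_mul, Complex.exp_ofReal_mul_I_re, hcos, mul_zero]
  have hcross := fun hsign => LegendrianLink.upward_crossing
    (h.contLift.continuousAt hnhds)
    (h.contAngle.continuousAt (Icc_mem_nhds hs.1 hs.2))
    (hU.hasDerivAt_circle (D.circlePoint_mem_domain hs)) (h.eventually_mem_carrier hs)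
    (mem_of_superset hnhds h.isTangentAngle) hr hcos hsign
  have hval : (L.param i r).2 = U (circlePoint s) := by rw [hr]
  rcases hL.of_vertical hv with ⟨hX, hmax⟩ | ⟨hX, hmin⟩
  -- The point is rightmost on the link, hence a maximum of `Re U` on the whole disk. There the
  -- boundary moves upwards while the link bends to the left; the leftmost case is the mirror image.
  · have hext : IsExtremum U 1 (circlePoint s) := by
      refine eventually_nhdsWithin_of_forall fun z hz => ?_
      refine hU.re_le_of_circle (fun w hw => ?_) hz
      obtain ⟨P, hP, hPw⟩ := hproj w hw
      rw [one_mul, one_mul, ← hPw, ← hval]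
      exact hmax P hP
    obtain ⟨-, h2⟩ := hU.velocity_of_isExtremum hne one_ne_zero (D.circlePoint_mem_domain hs) hext
    exact ⟨⟨1, Or.inl rfl, hext⟩, hcross (mul_neg_of_neg_of_pos hX (by linarith))⟩
  · have hext : IsExtremum U (-1) (circlePoint s) := by
      refine eventually_nhdsWithin_of_forall fun z hz => ?_
      refine hU.re_le_of_circle (fun w hw => ?_) hz
      obtain ⟨P, hP, hPw⟩ := hproj w hw
      rw [neg_one_mul, neg_one_mul, ← hPw, ← hval]
      exact neg_le_neg (hmin P hP)
    obtain ⟨-, h2⟩ := hU.velocity_of_isExtremum hne (by norm_num) (D.circlePoint_mem_domain hs) hext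
    exact ⟨⟨-1, Or.inr rfl, hext⟩, hcross (mul_neg_of_pos_of_neg hX (by linarith))⟩

end IsArcLift

/-! ### Index zero leaves exactly two extrema. -/

section

open DiskPunctures

variable {L : LegendrianLink} {D : DiskPunctures} {U g : ℂ → ℂ}

theorem IsArcLift.exists_start_slope (hL : L.GoodPosition) (hU : IsDiskExtension D U g)
    {τ φ : ℝ → ℝ} {a b : ℝ} (hab : a < b) (h : IsArcLift L U a b τ φ)
    (hq : U (circlePoint a) ∈ L.doublePoints) :
    ∃ e : ℝ, (e = 1 ∨ e = -1) ∧ Real.sin (φ a) = e * Real.cos (φ a) ∧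
      ∀ᶠ s in 𝓝[>] a, (U (circlePoint s)).im - (U (circlePoint a)).im =
        e * ((U (circlePoint s)).re - (U (circlePoint a)).re) := by
  have hsub : Ioo a b ⊆ Icc a b := Ioo_subset_Icc_self
  have h1 := (h.contAngle a (left_mem_Icc.2 hab.le)).mono hsub
  rw [ContinuousWithinAt, nhdsWithin_Ioo_eq_nhdsGT hab] at h1
  have h2 : Continuous fun s => U (circlePoint s) :=
    hU.cont.comp_continuous continuous_circlePoint circlePoint_mem_closedBall
  exact exists_end_slope hL hq h1 ((h2.tendsto a).mono_left nhdsWithin_le_nhds)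
    (mem_of_superset (Ioo_mem_nhdsGT hab) h.mem_carrier)
    (mem_of_superset (Ioo_mem_nhdsGT hab) h.isTangentAngle)

theorem IsArcLift.exists_terminal_slope (hL : L.GoodPosition) (hU : IsDiskExtension D U g)
    {τ φ : ℝ → ℝ} {a b : ℝ} (hab : a < b) (h : IsArcLift L U a b τ φ)
    (hq : U (circlePoint b) ∈ L.doublePoints) :
    ∃ e : ℝ, (e = 1 ∨ e = -1) ∧ Real.sin (φ b) = e * Real.cos (φ b) ∧
      ∀ᶠ s in 𝓝[<] b, (U (circlePoint s)).im - (U (circlePoint b)).im =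
        e * ((U (circlePoint s)).re - (U (circlePoint b)).re) := by
  have hsub : Ioo a b ⊆ Icc a b := Ioo_subset_Icc_self
  have h1 := (h.contAngle b (right_mem_Icc.2 hab.le)).mono hsub
  rw [ContinuousWithinAt, nhdsWithin_Ioo_eq_nhdsLT hab] at h1
  have h2 : Continuous fun s => U (circlePoint s) :=
    hU.cont.comp_continuous continuous_circlePoint circlePoint_mem_closedBall
  exact exists_end_slope hL hq h1 ((h2.tendsto b).mono_left nhdsWithin_le_nhds)
    (mem_of_superset (Ioo_mem_nhdsLT hab) h.mem_carrier)
    (mem_of_superset (Ioo_mem_nhdsLT hab) h.isTangentAngle)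

/-- If the index vanishes, the real part of the disk has at most two local extrema. -/
theorem ncard_extrema_le (hL : L.LeftRightSimple) (hU : IsDiskExtension D U g)
    (hne : ∃ z ∈ closedBall (0 : ℂ) 1, ∃ w ∈ closedBall (0 : ℂ) 1, U z ≠ U w)
    (hproj : ∀ z : ℂ, ‖z‖ = 1 → U z ∈ L.proj) (hpt : ∀ k, U (D.point k) ∈ L.doublePoints)
    {τ φ : Fin D.m → ℝ → ℝ}
    (h : ∀ k, IsArcLift L U (D.angle k.castSucc) (D.angle k.succ) (τ k) (φ k))
    (hsum : ∑ k, (φ k (D.angle k.succ) - φ k (D.angle k.castSucc)) = Real.pi * (2 - D.m / 2)) :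
    {z ∈ closedBall (0 : ℂ) 1 | ∃ σ : ℝ, (σ = 1 ∨ σ = -1) ∧ IsExtremum U σ z}.Finite ∧
    {z ∈ closedBall (0 : ℂ) 1 | ∃ σ : ℝ, (σ = 1 ∨ σ = -1) ∧ IsExtremum U σ z}.ncard ≤ 2 := by
  have hσ0 : ∀ σ : ℝ, (σ = 1 ∨ σ = -1) → σ ≠ 0 := by
    rintro σ (rfl | rfl) <;> norm_num
  obtain ⟨next, hnext⟩ := D.exists_next
  choose d hd hdφ hdline using fun k => (h k).exists_start_slope hL.goodPosition hU (D.angle_lt k)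
    (hpt k)
  choose e he heφ heline using fun k => (h k).exists_terminal_slope hL.goodPosition hU
    (D.angle_lt k) (by rw [hnext]; exact hpt _)
  set V : Fin D.m → Set ℝ := fun k =>
    {s ∈ Ioo (D.angle k.castSucc) (D.angle k.succ) | Real.cos (φ k s) = 0} with hV
  have hcount : ∀ k, (V k).Finite ∧ Real.pi * (V k).ncard + (e k - d k) * (Real.pi / 4) ≤
      φ k (D.angle k.succ) - φ k (D.angle k.castSucc) := fun k =>
    card_vertical_le (D.angle_lt k) (h k).contAngle
      (fun s hs hcos => ((h k).of_cos_eq_zero hL hU hne hproj hs hcos).2) (hd k) (he k) (hdφ k)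
      (heφ k)
  have hcirc : ∀ z ∈ D.domain, ‖z‖ = 1 → ∀ σ : ℝ, σ ≠ 0 → IsExtremum U σ z →
      ∃ k, z ∈ circlePoint '' V k := by
    intro z hz hz1 σ hσ hext
    obtain ⟨k, s, hs, rfl⟩ := D.exists_arc hz hz1
    exact ⟨k, s, ⟨hs, (h k).cos_eq_zero_of_isExtremum hU hne hs hσ hext⟩, rfl⟩
  have hT : (range D.point ∪ ⋃ k, circlePoint '' V k).Finite :=
    (finite_range _).union (finite_iUnion fun k => (hcount k).1.image _)
  set A : Fin D.m → Set ℂ := fun k => {z | z = D.point (next k) ∧ d (next k) = -1 ∧ e k = 1} with hA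
  have hAfin : ∀ k, (A k).Finite := fun k =>
    (finite_singleton (D.point (next k))).subset fun z hz => hz.1
  -- The right side is `0`, `1 / 2` or `1`, and it is `1` exactly for incoming slope `1` and
  -- outgoing slope `-1`.
  have hAcard : ∀ k, ((A k).ncard : ℝ) ≤ (e k - d (next k) + 2) / 4 := by
    intro k
    by_cases hk : d (next k) = -1 ∧ e k = 1
    · have h1 : (A k).ncard ≤ 1 := by
        rw [← ncard_singleton (D.point (next k))]
        exact ncard_le_ncard (fun z hz => hz.1) (finite_singleton _)
      have h2 : ((A k).ncard : ℝ) ≤ 1 := by exact_mod_cast h1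
      rw [hk.1, hk.2]
      linarith
    · have h1 : A k = ∅ := eq_empty_of_forall_notMem fun z hz => hk hz.2
      rw [h1, ncard_empty, Nat.cast_zero]
      rcases hd (next k) with h2 | h2 <;> rcases he k with h3 | h3 <;> rw [h2, h3] <;> norm_num
  have hsubset : {z ∈ closedBall (0 : ℂ) 1 | ∃ σ : ℝ, (σ = 1 ∨ σ = -1) ∧ IsExtremum U σ z} ⊆
      ⋃ k, (circlePoint '' V k ∪ A k) := by
    rintro z ⟨hz, σ, hσ, hext⟩
    have hz1 : ‖z‖ ≤ 1 := by simpa using hz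
    rcases hz1.lt_or_eq with hlt | heq
    · exact absurd hext (hU.not_isExtremum_of_mem_ball hne (hσ0 σ hσ) (by simpa using hlt))
    · by_cases hzD : z ∈ D.domain
      · obtain ⟨k, hk⟩ := hcirc z hzD heq σ (hσ0 σ hσ) hext
        exact mem_iUnion.2 ⟨k, Or.inl hk⟩
      · obtain ⟨j, rfl⟩ : z ∈ range D.point := by
          by_contra h'
          exact hzD ⟨hz, h'⟩
        obtain ⟨k, rfl⟩ := next.surjective j
        refine mem_iUnion.2 ⟨k, Or.inr ⟨rfl, ?_⟩⟩
        have hline := heline k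
        rw [hnext k] at hline
        refine hU.slopes_of_isExtremum hne (hσ0 σ hσ) hT (fun z hz1 hzT hzext => ?_) (hnext k)
          hext (hd (next k)) (he k) (hdline (next k)) hline
        obtain ⟨k', hk'⟩ := hcirc z ⟨by simp [hz1], fun hr => hzT (Or.inl hr)⟩ hz1 σ (hσ0 σ hσ) hzext
        exact hzT (Or.inr (mem_iUnion.2 ⟨k', hk'⟩))
  have hfin : (⋃ k, (circlePoint '' V k ∪ A k)).Finite :=
    finite_iUnion fun k => ((hcount k).1.image _).union (hAfin k)
  refine ⟨hfin.subset hsubset, ?_⟩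
  have h1 : (⋃ k, (circlePoint '' V k ∪ A k)).ncard ≤ ∑ k, ((V k).ncard + (A k).ncard) := by
    refine (ncard_iUnion_le_of_fintype _).trans (Finset.sum_le_sum fun k _ => ?_)
    exact (ncard_union_le _ _).trans (Nat.add_le_add_right (ncard_image_le (hcount k).1) _)
  -- The slope terms of the arcs and of the corners cancel, because `next` permutes the arcs. The `m
  -- / 2` from the corners cancels the one in `hsum`, leaving `2`.
  have h2 : Real.pi * ∑ k, (((V k).ncard : ℝ) + (A k).ncard) ≤ Real.pi * 2 := by
    have e1 : ∑ k, (Real.pi * (V k).ncard + (e k - d k) * (Real.pi / 4)) ≤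
        Real.pi * (2 - D.m / 2) := by
      rw [← hsum]
      exact Finset.sum_le_sum fun k _ => (hcount k).2
    have e2 : ∑ k, d (next k) = ∑ k, d k := Equiv.sum_comp next d
    have e3 : ∑ k, ((A k).ncard : ℝ) ≤ ∑ k, (e k - d (next k) + 2) / 4 :=
      Finset.sum_le_sum fun k _ => hAcard k
    rw [← Finset.sum_div, Finset.sum_add_distrib, Finset.sum_sub_distrib, e2] at e3
    rw [Finset.sum_add_distrib, ← Finset.mul_sum, ← Finset.sum_mul, Finset.sum_sub_distrib] at e1
    rw [Finset.sum_add_distrib]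
    simp only [Finset.sum_const, Finset.card_univ, Fintype.card_fin, nsmul_eq_mul] at e3
    have hpi := Real.pi_pos
    nlinarith [mul_le_mul_of_nonneg_left e3 hpi.le]
  have h3 : ∑ k, (((V k).ncard : ℝ) + (A k).ncard) ≤ 2 := le_of_mul_le_mul_left h2 Real.pi_pos
  have h4 : ∑ k, ((V k).ncard + (A k).ncard) ≤ 2 := by exact_mod_cast h3
  exact (ncard_le_ncard hsubset hfin).trans (h1.trans h4)

/-- If there are at most two local extrema, they are the minimum and the maximum. -/
theorem exists_unique_extrema (hU : IsDiskExtension D U g)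
    (hne : ∃ z ∈ closedBall (0 : ℂ) 1, ∃ w ∈ closedBall (0 : ℂ) 1, U z ≠ U w)
    (hfin : {z ∈ closedBall (0 : ℂ) 1 | ∃ σ : ℝ, (σ = 1 ∨ σ = -1) ∧ IsExtremum U σ z}.Finite)
    (hcard : {z ∈ closedBall (0 : ℂ) 1 |
      ∃ σ : ℝ, (σ = 1 ∨ σ = -1) ∧ IsExtremum U σ z}.ncard ≤ 2) :
    ∃ p q : ℂ, ‖p‖ = 1 ∧ ‖q‖ = 1 ∧ p ≠ q ∧ IsExtremum U (-1) p ∧ IsExtremum U 1 q ∧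
      (∀ z ∈ closedBall (0 : ℂ) 1, IsExtremum U 1 z → z = q) ∧
      (∀ z ∈ closedBall (0 : ℂ) 1, IsExtremum U (-1) z → z = p) := by
  have hre := Complex.continuous_re.comp_continuousOn hU.cont
  obtain ⟨p, hp, hpmin⟩ := (isCompact_closedBall (0 : ℂ) 1).exists_isMinOn ⟨0, by simp⟩ hre
  obtain ⟨q, hq, hqmax⟩ := (isCompact_closedBall (0 : ℂ) 1).exists_isMaxOn ⟨0, by simp⟩ hre
  have hpext : IsExtremum U (-1) p := eventually_nhdsWithin_of_forall fun w hw => by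
    have : (U p).re ≤ (U w).re := hpmin hw
    linarith
  have hqext : IsExtremum U 1 q := eventually_nhdsWithin_of_forall fun w hw => by
    have : (U w).re ≤ (U q).re := hqmax hw
    linarith
  have hnorm : ∀ z ∈ closedBall (0 : ℂ) 1, ∀ σ : ℝ, σ ≠ 0 → IsExtremum U σ z → ‖z‖ = 1 := by
    intro z hz σ hσ hext
    have hz1 : ‖z‖ ≤ 1 := by simpa using hz
    refine hz1.eq_of_not_lt fun hlt => ?_
    exact hU.not_isExtremum_of_mem_ball hne hσ (by simpa using hlt) hext
  -- A simultaneous maximum and minimum would make `Re U` constant nearby, so a nearby interior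
  -- point would be an extremum.
  have hboth : ∀ z ∈ closedBall (0 : ℂ) 1, IsExtremum U 1 z → ¬ IsExtremum U (-1) z := by
    intro z hz h1 h2
    obtain ⟨ε, hε, hsub⟩ := mem_nhdsWithin_iff.1 (h1.and h2)
    have hconst : ∀ w ∈ closedBall (0 : ℂ) 1 ∩ ball z ε, (U w).re = (U z).re := fun w hw => by
      obtain ⟨h3, h4⟩ := hsub ⟨hw.2, hw.1⟩
      linarith
    have hcl : z ∈ closure (ball (0 : ℂ) 1) := by rwa [closure_ball (0 : ℂ) one_ne_zero]
    obtain ⟨w, hwz, hw⟩ := mem_closure_iff_nhds.1 hcl _ (ball_mem_nhds z hε)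
    refine hU.not_isExtremum_of_mem_ball hne one_ne_zero hw ?_
    filter_upwards [self_mem_nhdsWithin,
      mem_nhdsWithin_of_mem_nhds (isOpen_ball.mem_nhds hwz)] with x hx hx2
    rw [hconst x ⟨hx, hx2⟩, hconst w ⟨ball_subset_closedBall hw, hwz⟩]
  have hpq : p ≠ q := by
    rintro rfl
    exact hboth p hp hqext hpext
  have hsub : {p, q} ⊆ {z ∈ closedBall (0 : ℂ) 1 |
      ∃ σ : ℝ, (σ = 1 ∨ σ = -1) ∧ IsExtremum U σ z} := by
    rintro z (rfl | rfl)
    · exact ⟨hp, -1, Or.inr rfl, hpext⟩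
    · exact ⟨hq, 1, Or.inl rfl, hqext⟩
  have heq := eq_of_subset_of_ncard_le hsub (by rwa [ncard_pair hpq]) hfin
  refine ⟨p, q, hnorm p hp (-1) (by norm_num) hpext, hnorm q hq 1 one_ne_zero hqext, hpq, hpext,
    hqext, fun z hz hext => ?_, fun z hz hext => ?_⟩
  · have : z ∈ ({p, q} : Set ℂ) := heq ▸ ⟨hz, 1, Or.inl rfl, hext⟩
    rcases this with rfl | h
    · exact absurd hpext (hboth _ hz hext)
    · exact h
  · have : z ∈ ({p, q} : Set ℂ) := heq ▸ ⟨hz, -1, Or.inr rfl, hext⟩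
    rcases this with h | h
    · exact h
    · rw [mem_singleton_iff] at h
      subst h
      exact absurd hext (hboth _ hz hqext)

end

/-! ### Immersion at the boundary and injectivity of the disk. -/

/-- A curve that starts at the tip of a cone in the right half plane and stays in it near the tip has
velocity zero there. -/
theorem velocity_eq_zero_of_mem_cone {W : ℝ → ℂ} {w : ℂ} {s K : ℝ} (hW : HasDerivAt W w s)
    (h0 : W s = 0) (hK : 0 < K) (hcone : ∀ᶠ t in 𝓝 s, |(W t).im| ≤ K * (W t).re) : w = 0 := by
  have hre : HasDerivAt (fun t => (W t).re) w.re s := Complex.reCLM.hasFDerivAt.comp_hasDerivAt s hW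
  have him : HasDerivAt (fun t => (W t).im) w.im s := Complex.imCLM.hasFDerivAt.comp_hasDerivAt s hW
  have h1 : IsLocalMin (fun t => (W t).re) s := by
    filter_upwards [hcone] with t ht
    rw [h0, Complex.zero_re]
    exact nonneg_of_mul_nonneg_right ((abs_nonneg _).trans ht) hK
  -- Both `Re W` and `K * Re W + Im W` are nonnegative near `s` and zero at `s`; being two-sided
  -- minima, they have vanishing derivatives.
  have h2 : IsLocalMin (fun t => K * (W t).re + (W t).im) s := by
    filter_upwards [hcone] with t ht
    rw [h0, Complex.zero_re, Complex.zero_im]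
    linarith [neg_abs_le (W t).im]
  have h3 := h1.hasDerivAt_eq_zero hre
  have h4 := h2.hasDerivAt_eq_zero ((hre.const_mul K).add him)
  rw [h3, mul_zero, zero_add] at h4
  exact Complex.ext h3 h4

namespace IsDiskExtension

open DiskPunctures

variable {L : LegendrianLink} {D : DiskPunctures} {U g : ℂ → ℂ} {τ φ : ℝ → ℝ} {k : Fin D.m} {p q : ℂ}

theorem deriv_eq (hU : IsDiskExtension D U g) {z : ℂ} (hz : z ∈ ball (0 : ℂ) 1) :
    deriv U z = g z :=
  ((hU.hasDeriv z (D.ball_subset_domain hz)).hasDerivAt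
    (mem_of_superset (isOpen_ball.mem_nhds hz) ball_subset_closedBall)).deriv

/-- The derivative does not vanish at the boundary points where the link is not vertical. -/
theorem deriv_ne_zero_of_cos_ne_zero (hU : IsDiskExtension D U g)
    (h : IsArcLift L U (D.angle k.castSucc) (D.angle k.succ) τ φ) {s : ℝ}
    (hs : s ∈ Ioo (D.angle k.castSucc) (D.angle k.succ)) (hcos : Real.cos (φ s) ≠ 0)
    (hp : ‖p‖ = 1) (hq : ‖q‖ = 1) (hpq : p ≠ q)
    (hpos : ∀ z ∈ ball (0 : ℂ) 1, 0 < (g z * diskField p q z).re)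
    (hgd : DifferentiableOn ℂ g (ball 0 1))
    (hg : ∀ z ∈ D.domain, ∃ l, HasDerivWithinAt g l (closedBall 0 1) z) :
    g (circlePoint s) ≠ 0 := by
  intro h0
  have hX : ∀ z, HasDerivAt (diskField p q) (deriv (diskField p q) z) z := fun z => by
    have : DifferentiableAt ℂ (diskField p q) z := by unfold diskField; fun_prop
    exact this.hasDerivAt
  obtain ⟨l, hl⟩ := hg _ (D.circlePoint_mem_domain hs)
  have hV : HasDerivWithinAt (fun z => g z * diskField p q z) (l * diskField p q (circlePoint s))
      (closedBall 0 1) (circlePoint s) :=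
    (hl.mul (hX _).hasDerivWithinAt).congr_deriv (by rw [h0]; ring)
  have hc0 : circlePoint s ≠ 0 := fun h => by simpa [h] using norm_circlePoint s
  -- `g * diskField` has positive real part inside and vanishes at the boundary point, so by the
  -- Hopf lemma its derivative there is nonzero.
  have hlX : l * diskField p q (circlePoint s) ≠ 0 := by
    intro hzero
    rw [hzero] at hV
    have hsub : ball (0 : ℂ) (dist (circlePoint s) 0) = ball 0 1 := by
      rw [dist_zero_right, norm_circlePoint]
    have hdX : DifferentiableOn ℂ (diskField p q) (ball 0 1) := fun z _ =>
      (hX z).differentiableAt.differentiableWithinAt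
    have := hopf_re (c := 0) hc0 (hsub ▸ hgd.mul hdX) (hsub ▸ hpos)
      (hsub ▸ ball_subset_closedBall) hV (by simp [h0])
    simp at this
  have hW : HasDerivAt (fun t => g (circlePoint t) * diskField p q (circlePoint t))
      ((Complex.I * circlePoint s) • (l * diskField p q (circlePoint s))) s := by
    have h1 := hasDerivAt_circlePoint s
    rw [← hasDerivWithinAt_univ] at h1 ⊢
    exact HasDerivWithinAt.scomp s hV h1 fun x _ => circlePoint_mem_closedBall x
  have hφ : ContinuousAt φ s := h.contAngle.continuousAt (Icc_mem_nhds hs.1 hs.2)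
  have hκ : 0 < |Real.cos (φ s)| / 2 := by positivity
  have hev : ∀ᶠ t in 𝓝 s, |Real.cos (φ s)| / 2 < |Real.cos (φ t)| := by
    have : ContinuousAt (fun t => |Real.cos (φ t)|) s := (Real.continuous_cos.continuousAt.comp hφ).abs
    exact this.eventually_const_lt (by linarith)
  -- On the circle `diskField` is tangent, so the product is a real multiple of `exp (φ t * I)` with
  -- nonnegative real part. Since `|cos (φ t)|` stays above half its value at `s`, this lies in a
  -- cone.
  have hvel := velocity_eq_zero_of_mem_cone hW (by simp [h0]) (inv_pos.2 hκ) (by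
    filter_upwards [hev, Ioo_mem_nhds hs.1 hs.2] with t ht hts
    have hnonneg : 0 ≤ (g (circlePoint t) * diskField p q (circlePoint t)).re := by
      obtain ⟨l', hl'⟩ := hg _ (D.circlePoint_mem_domain hts)
      have hcont : ContinuousWithinAt (fun z => (g z * diskField p q z).re) (ball 0 1)
          (circlePoint t) :=
        Complex.continuous_re.continuousAt.comp_continuousWithinAt
          ((hl'.continuousWithinAt.mono ball_subset_closedBall).mul
            (hX _).continuousAt.continuousWithinAt)
      have hcl : circlePoint t ∈ closure (ball (0 : ℂ) 1) := by
        rw [closure_ball (0 : ℂ) one_ne_zero]; exact circlePoint_mem_closedBall t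
      have := mem_closure_iff_nhdsWithin_neBot.1 hcl
      exact ge_of_tendsto hcont (eventually_nhdsWithin_of_forall fun z hz => (hpos z hz).le)
    obtain ⟨ρ, hρ⟩ := h.exists_velocity_eq hU hts
    obtain ⟨r, hr⟩ := exists_diskField_eq hp hq hpq (norm_circlePoint t)
    have hVt : g (circlePoint t) * diskField p q (circlePoint t) =
        ((r * ρ : ℝ) : ℂ) * Complex.exp (φ t * Complex.I) := by
      rw [hr, mul_left_comm, hρ]; push_cast; ring
    rw [hVt, Complex.re_ofReal_mul, Complex.exp_ofReal_mul_I_re] at hnonneg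
    rw [hVt, Complex.re_ofReal_mul, Complex.im_ofReal_mul, Complex.exp_ofReal_mul_I_re,
      Complex.exp_ofReal_mul_I_im, inv_mul_eq_div, le_div_iff₀ hκ]
    rw [← abs_of_nonneg hnonneg, abs_mul (r * ρ), abs_mul (r * ρ)]
    have h1 := abs_nonneg (r * ρ)
    have h2 := Real.abs_sin_le_one (φ t)
    have h3 := mul_le_mul_of_nonneg_left h2 h1
    have h4 := mul_le_mul h3 ht.le hκ.le (by linarith)
    linarith)
  rw [smul_eq_mul] at hvel
  exact mul_ne_zero (mul_ne_zero Complex.I_ne_zero hc0) hlX hvel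

/-- A disk with smooth boundary arcs on a left-right-simple link, whose real part has only one local
minimum and one local maximum, is an immersion and injective. -/
theorem deriv_ne_zero_and_injOn (hL : L.LeftRightSimple) (hU : IsDiskExtension D U g)
    (hne : ∃ z ∈ closedBall (0 : ℂ) 1, ∃ w ∈ closedBall (0 : ℂ) 1, U z ≠ U w)
    (hproj : ∀ z : ℂ, ‖z‖ = 1 → U z ∈ L.proj) {τ φ : Fin D.m → ℝ → ℝ}
    (h : ∀ k, IsArcLift L U (D.angle k.castSucc) (D.angle k.succ) (τ k) (φ k))
    (hp : ‖p‖ = 1) (hq : ‖q‖ = 1) (hpq : p ≠ q) (hpext : IsExtremum U (-1) p)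
    (hqext : IsExtremum U 1 q) (hmax : ∀ z ∈ closedBall (0 : ℂ) 1, IsExtremum U 1 z → z = q)
    (hmin : ∀ z ∈ closedBall (0 : ℂ) 1, IsExtremum U (-1) z → z = p)
    (hg : ∀ z ∈ D.domain, ∃ l, HasDerivWithinAt g l (closedBall 0 1) z) :
    (∀ z ∈ D.domain, g z ≠ 0) ∧ InjOn U (closedBall 0 1) := by
  have hmax' : ∀ z ∈ closedBall (0 : ℂ) 1,
      (∀ᶠ w in 𝓝[closedBall 0 1] z, (U w).re ≤ (U z).re) → z = q := fun z hz hz2 =>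
    hmax z hz (by simpa [IsExtremum] using hz2)
  have hmin' : ∀ z ∈ closedBall (0 : ℂ) 1,
      (∀ᶠ w in 𝓝[closedBall 0 1] z, (U z).re ≤ (U w).re) → z = p := fun z hz hz2 =>
    hmin z hz (by simpa [IsExtremum] using hz2)
  have hpos : ∀ z ∈ ball (0 : ℂ) 1, 0 < (g z * diskField p q z).re := fun z hz => by
    rw [← hU.deriv_eq hz]
    exact re_deriv_mul_diskField_pos hp hq hpq hU.cont hU.diff hmax' hmin' hz
  have hgd : DifferentiableOn ℂ g (ball 0 1) :=
    (hU.diff.deriv isOpen_ball).congr fun z hz => (hU.deriv_eq hz).symm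
  have hcos : ∀ k : Fin D.m, ∀ s ∈ Ioo (D.angle k.castSucc) (D.angle k.succ), circlePoint s ≠ p →
      circlePoint s ≠ q → Real.cos (φ k s) ≠ 0 := by
    intro k s hs hsp hsq hc
    obtain ⟨⟨σ, hσ, hext⟩, -⟩ := (h k).of_cos_eq_zero hL hU hne hproj hs hc
    rcases hσ with rfl | rfl
    · exact hsq (hmax _ (circlePoint_mem_closedBall s) hext)
    · exact hsp (hmin _ (circlePoint_mem_closedBall s) hext)
  have hgs : ∀ k : Fin D.m, ∀ s ∈ Ioo (D.angle k.castSucc) (D.angle k.succ), circlePoint s ≠ p →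
      circlePoint s ≠ q → g (circlePoint s) ≠ 0 := fun k s hs hsp hsq =>
    hU.deriv_ne_zero_of_cos_ne_zero (h k) hs (hcos k s hs hsp hsq) hp hq hpq hpos hgd hg
  constructor
  · intro z hz h0
    have hz1 : ‖z‖ ≤ 1 := by simpa using D.domain_subset hz
    rcases hz1.lt_or_eq with hlt | heq
    · have := hpos z (by simpa using hlt)
      simp [h0] at this
    -- At `p` and `q` the tangent may be vertical and the cone argument fails, but these are extrema
    -- and the Hopf lemma applies to `U` itself.
    · by_cases hzp : z = p
      · subst hzp
        have := hU.hopf_of_isExtremum hne (by norm_num) hz heq hpext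
        simp [h0] at this
      by_cases hzq : z = q
      · subst hzq
        have := hU.hopf_of_isExtremum hne (by norm_num) hz heq hqext
        simp [h0] at this
      obtain ⟨k, s, hs, rfl⟩ := D.exists_arc hz heq
      exact hgs k s hs hzp hzq h0
  · refine injOn_of_unique_local_extrema hp hq hpq hU.cont hU.diff hmax' hmin'
      (finite_range D.point) fun z hz1 hzP hzp hzq => ?_
    have hz : z ∈ D.domain := ⟨by simp [hz1], hzP⟩
    refine ⟨g z, (hU.hasDeriv z hz).mono sphere_subset_closedBall, ?_⟩
    obtain ⟨k, s, hs, rfl⟩ := D.exists_arc hz hz1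
    obtain ⟨ρ, hρ⟩ := (h k).exists_velocity_eq hU hs
    have hc0 : circlePoint s ≠ 0 := fun h => by simpa [h] using norm_circlePoint s
    have hvel := mul_ne_zero (hgs k s hs hzp hzq) (mul_ne_zero Complex.I_ne_zero hc0)
    rw [hρ] at hvel ⊢
    rw [Complex.re_ofReal_mul, Complex.exp_ofReal_mul_I_re]
    refine mul_ne_zero ?_ (hcos k s hs hzp hzq)
    rintro rfl
    simp at hvel

end IsDiskExtension

/-! ### Assembly of the theorem. -/

/-- A continuous injection of a compact space into a Hausdorff space is a closed embedding.
Injectivity is therefore needed on the closed disk, punctures included, to control the non-compact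
domain. -/
theorem isEmbedding_of_injOn {U : ℂ → ℂ} {S K : Set ℂ} (hK : IsCompact K) (hc : ContinuousOn U K)
    (hinj : InjOn U K) (hS : S ⊆ K) : Topology.IsEmbedding (fun z : S => U z) := by
  have := isCompact_iff_compactSpace.1 hK
  have h1 : Topology.IsClosedEmbedding (K.domRestrict U) :=
    (continuousOn_iff_continuous_domRestrict.1 hc).isClosedEmbedding hinj.injective
  exact h1.isEmbedding.comp (Topology.IsEmbedding.inclusion hS)

end

theorem proposition5p8 (L : LegendrianLink) (hL : L.LeftRightSimple)
    (D : DiskPunctures) (u : ℂ → ℂ) (hu : IsHolomorphicDisk L D u)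
    (hconst : ∃ z ∈ D.domain, ∃ w ∈ D.domain, u z ≠ u w)
    (hind : HasIndex L D u 0) :
    IsSmoothEmbeddingOn u D.domain := by
  obtain ⟨μ, ⟨θ, hθ, hμ⟩, h0⟩ := hind
  choose τ φ hτ hcar hφ htan hθφ using hθ
  have hU := hu.isDiskExtension
  have hne : ∃ z ∈ closedBall (0 : ℂ) 1, ∃ w ∈ closedBall (0 : ℂ) 1,
      extendFrom D.domain u z ≠ extendFrom D.domain u w := by
    obtain ⟨z, hz, w, hw, hzw⟩ := hconst
    refine ⟨z, D.domain_subset hz, w, D.domain_subset hw, ?_⟩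
    rwa [hu.extendFrom_eq hz, hu.extendFrom_eq hw]
  have hproj : ∀ z : ℂ, ‖z‖ = 1 → extendFrom D.domain u z ∈ L.proj := by
    intro z hz
    by_cases hzP : z ∈ range D.point
    · obtain ⟨k, rfl⟩ := hzP
      obtain ⟨P, hP, Q, -, -, hPq, -⟩ := hu.extendFrom_point_mem k
      exact ⟨P, hP, hPq⟩
    · have hzD : z ∈ D.domain := ⟨by simp [hz], hzP⟩
      rw [hu.extendFrom_eq hzD]
      exact hu.boundary z hzD hz
  have harc : ∀ k, IsArcLift L (extendFrom D.domain u) (D.angle k.castSucc) (D.angle k.succ)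
      (τ k) (φ k) := fun k => by
    refine ⟨hτ k, fun s hs => ?_, hφ k, fun s hs => ?_⟩
    · rw [hu.extendFrom_eq (D.circlePoint_mem_domain hs)]
      exact hcar k s hs
    · rw [hu.extendFrom_eq (D.circlePoint_mem_domain hs)]
      exact htan k s hs
  -- Vanishing index solved for the total rotation.
  have hsum : ∑ k, (φ k (D.angle k.succ) - φ k (D.angle k.castSucc)) =
      Real.pi * (2 - D.m / 2) := by
    rw [← Finset.sum_congr rfl fun k _ => hθφ k]
    have hpi := Real.pi_ne_zero
    rw [hμ] at h0
    field_simp at h0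
    linarith
  obtain ⟨hfin, hcard⟩ := ncard_extrema_le hL hU hne hproj hu.extendFrom_point_mem harc hsum
  obtain ⟨p, q, hp, hq, hpq, hpext, hqext, hmax, hmin⟩ := exists_unique_extrema hU hne hfin hcard
  obtain ⟨hg0, hinj⟩ := hU.deriv_ne_zero_and_injOn hL hne hproj harc hp hq hpq hpext hqext hmax hmin
    fun z hz => ⟨_, (hasDerivWithinAt_domain (contDiffOn_fderivWithin_one hu.smooth)
      (differentiableOn_fderivWithin_one hu.smooth hu.holomorphic) hz).mono_of_mem_nhdsWithin
      (D.domain_mem_nhdsWithin hz)⟩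
  refine ⟨hu.smooth, fun z hz v w hvw => ?_, ?_⟩
  · rw [fderivWithin_domain_apply hu.smooth hu.holomorphic hz v,
      fderivWithin_domain_apply hu.smooth hu.holomorphic hz w] at hvw
    exact mul_right_cancel₀ (hg0 z hz) hvw
  · have := isEmbedding_of_injOn (isCompact_closedBall 0 1) hU.cont hinj D.domain_subset
    convert this using 2 with z
    exact (hu.extendFrom_eq z.2).symm
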